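/- Work over $\mathbb{C}$. Let $0\le k\le l$, $l>0$, and let $S_{k,l}\subset\mathbb{P}^{k+l+1}$ be the rational normal surface scroll, swept out by the lines joining corresponding points of rational normal curves of degrees $k$ and $l$ with disjoint spans (a cone if $k=0$). It is the image of the Hirzebruch surface $F_{l-k}$ under the complete linear series $|E+lf|$, where $f$ is the class of a fiber of the ruling and $E$ is a section with $E^2=-(l-k)$. If $k<l$, the curve $E$ is unique and is called the directrix; if $k=l$, we say by convention that there is no directrix. A section $C$ of the ruling has degree $d$ if it lies in the class $E+(d-k)f$. Fix a hyperplane $H\subset\mathbb{P}^N$, integers $d,e,m,n\ge 0$, $m_1,\dots,m_m\ge 1$, $n_1,\dots,n_m\ge 0$ and $n_{m+1},\dots,n_{m+n}\ge 1$. Consider the locus of maps $\pi:F_{l-k}\to\mathbb{P}^N$ given by sections of $\mathcal{O}(E+lf)$, together with two marked irreducible sections $C$ and $D$ of $F_{l-k}$, up to isomorphism (automorphisms of the ruled surface $F_{l-k}$), such that (a) the image of $\pi$ is a scroll $S_{k,l}$ (in some $\mathbb{P}^{k+l+1}\subset\mathbb{P}^N$), and $C$, $D$ have degrees $d$, $e$;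 (b) for suitable distinct fibers $\lambda_1,\dots,\lambda_{m+n}$: the fibers contained in $\pi^{-1}(H)$ are exactly $\lambda_1,\dots,\lambda_m$, and the contact with $H$ along $\lambda_i$ (the multiplicity of $\lambda_i$ in the divisor $\pi^*H$) is of order $m_i$; and, in case $C\ne D$, the curves $C$ and $D$ have contact of order $n_i$ with each other on $\lambda_i$ for all $i\le m+n$ with $n_i\geq 1$ (there is no condition for $n_i=0$). Say that a curve lies in $H$ if $\pi$ maps it into $H$. Set $\delta_{k,l}=1$ if $k=l$ and $0$ otherwise. Then for each of the conditions on $C$ and $D$ listed below, the locus where this condition holds, if it is non-empty, has the stated dimension. If $\sum_{i=1}^m m_i>k$, the dimension is $$N(k+l+2)+k-l-5-\delta_{k,l}+m+\alpha,\quad\text{where}$$ (i) $\alpha=0$ if $C$ and $D$ lie in $H$; (ii) $\alpha=2d-k-l+1$ if $C$ and $D$ coincide, but do not lie in $H$; (iii) $\alpha=2e-k-l+1+n-\sum_{i=1}^{m+n}n_i$ if $C$ lies in $H$, but $D$ does not; (iv) $\alpha=2d+2e-2k-2l+2+n-\sum_{i=1}^{m+n}n_i$ if $C$ and $D$ are distinct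 and neither lies in $H$. If $\sum_{i=1}^m m_i\le k$, the dimension is $$N(k+l+2)+2k-4-\delta_{k,l}-2\sum_{i=1}^m m_i+m+\alpha,\quad\text{where}$$ (i) $\alpha=0$ if $C$ and $D$ both coincide with the directrix, or both lie in $H$; (ii) $\alpha=n-\sum_{i=1}^{m+n}n_i$ if one of $C$, $D$ coincides with the directrix and the other lies in $H$; (iii) $\alpha=2d-k-l+1$ if $C$ and $D$ coincide, are distinct from the directrix and do not lie in $H$; (iv) $\alpha=2d-k-l+1+n-\sum_{i=1}^{m+n}n_i$ if $D$ coincides with the directrix or lies in $H$, and $C$ is distinct from the directrix and does not lie in $H$; (v) $\alpha=2d+2e-2k-2l+2+n-\sum_{i=1}^{m+n}n_i$ if $C$ and $D$ do not coincide, are distinct from the directrix, and neither lies in $H$. -/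

import Mathlib

/-! ## Hirzebruch surfaces

Everything is over `ℂ`.  A point of the projective line is a point of
`Projectivization ℂ (Fin 2 → ℂ)`; a binary form of degree `n - 1` is given by its `n` coefficients
(so that a "form of negative degree" is zero). -/

namespace Scroll

/-- The binary form `∑ cᵢ uⁱ vⁿ⁻¹⁻ⁱ` of degree `n - 1` with coefficients `c`. -/
noncomputable def form {n : ℕ} (c : Fin n → ℂ) : MvPolynomial (Fin 2) ℂ :=
  ∑ i : Fin n, MvPolynomial.C (c i) * MvPolynomial.X 0 ^ (i : ℕ) *
    MvPolynomial.X 1 ^ (n - 1 - (i : ℕ))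

/-- The linear form vanishing exactly at the point `q` of the projective line. -/
noncomputable def linearForm (q : Projectivization ℂ (Fin 2 → ℂ)) : MvPolynomial (Fin 2) ℂ :=
  MvPolynomial.C (q.rep 1) * MvPolynomial.X 0 - MvPolynomial.C (q.rep 0) * MvPolynomial.X 1

/-- Homogeneous coordinates `(t; x, y)` on a Hirzebruch surface: `t` are homogeneous coordinates
on the base `ℙ¹`, and `x, y` are homogeneous coordinates on the fibre. -/
structure Coord where
  t : Fin 2 → ℂ
  x : ℂ
  y : ℂ
  base_ne : t ≠ 0
  fibre_ne : x ≠ 0 ∨ y ≠ 0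

/-- `(t; x, y)` and `(a t; b aʳ x, b y)` with `a, b ≠ 0` are the same point of `F_r`. -/
def coordSetoid (r : ℕ) : Setoid Coord where
  r z z' := ∃ a b : ℂ, a ≠ 0 ∧ b ≠ 0 ∧ z'.t = a • z.t ∧ z'.x = b * a ^ r * z.x ∧ z'.y = b * z.y
  iseqv :=
    { refl := fun z => ⟨1, 1, one_ne_zero, one_ne_zero, by simp, by simp, by simp⟩
      symm := by
        rintro z z' ⟨a, b, ha, hb, ht, hx, hy⟩
        refine ⟨a⁻¹, b⁻¹, inv_ne_zero ha, inv_ne_zero hb, ?_, ?_, ?_⟩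
        · rw [ht, smul_smul, inv_mul_cancel₀ ha, one_smul]
        · rw [hx, inv_pow]; field_simp
        · rw [hy]; field_simp
      trans := by
        rintro z z' z'' ⟨a, b, ha, hb, ht, hx, hy⟩ ⟨a', b', ha', hb', ht', hx', hy'⟩
        refine ⟨a' * a, b' * b, mul_ne_zero ha' ha, mul_ne_zero hb' hb, ?_, ?_, ?_⟩
        · rw [ht', ht, smul_smul]
        · rw [hx', hx]; ring
        · rw [hy', hy]; ring }

/-- The (points of the) Hirzebruch surface `F_r`, the projectivization of `𝒪 ⊕ 𝒪(r)` over `ℙ¹`. -/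
def Hirzebruch (r : ℕ) : Type := Quotient (coordSetoid r)

/-- The point of `F_r` with given homogeneous coordinates. -/
def Hirzebruch.mk (r : ℕ) (z : Coord) : Hirzebruch r := Quotient.mk (coordSetoid r) z

/-- Automorphisms of the ruled surface `F_r`: a linear change `g` of the coordinates of the base,
followed by `x ↦ a x + f(t) y`, `y ↦ c x + b y` in the fibres, where `f` is a form of degree `r`
and where `c = 0` unless `r = 0`; the determinant `a b - c f` must not vanish. -/
def IsRuledAut {r : ℕ} (φ : Hirzebruch r ≃ Hirzebruch r) : Prop :=
  ∃ (g : GL (Fin 2) ℂ) (a b c : ℂ) (f : Fin (r + 1) → ℂ),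
    (0 < r → c = 0) ∧
    (∀ t : Fin 2 → ℂ, t ≠ 0 → a * b - c * MvPolynomial.eval t (form f) ≠ 0) ∧
    ∀ z z' : Coord,
      z'.t = (g : Matrix (Fin 2) (Fin 2) ℂ).mulVec z.t →
      z'.x = a * z.x + MvPolynomial.eval z.t (form f) * z.y →
      z'.y = c * z.x + b * z.y →
      φ (Hirzebruch.mk r z) = Hirzebruch.mk r z'

/-! ### Section classes

`E` denotes the curve `y = 0` in `F_{l-k}`, and `f` the class of a fibre.  A global section of
`𝒪(E + m f)` is `A x + B y` with binary forms `A`, `B` of degrees `m - (l - k)` and `m`. -/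

/-- The curve `A x + B y = 0` in `F_r`. -/
def curve (r : ℕ) (A B : MvPolynomial (Fin 2) ℂ) : Set (Hirzebruch r) :=
  {P | ∃ z : Coord, Hirzebruch.mk r z = P ∧
    MvPolynomial.eval z.t A * z.x + MvPolynomial.eval z.t B * z.y = 0}

/-- A divisor `A x + B y = 0` in a section class is irreducible iff it contains no fibre,
that is, iff `A` and `B` have no common zero on `ℙ¹`. -/
def IsIrreducibleSection (A B : MvPolynomial (Fin 2) ℂ) : Prop :=
  ∀ t : Fin 2 → ℂ, t ≠ 0 → MvPolynomial.eval t A ≠ 0 ∨ MvPolynomial.eval t B ≠ 0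

/-- The order of vanishing of `A x + B y` along the fibre over `q`. -/
noncomputable def fibreOrder (A B : MvPolynomial (Fin 2) ℂ)
    (q : Projectivization ℂ (Fin 2 → ℂ)) : ℕ∞ :=
  min (emultiplicity (linearForm q) A) (emultiplicity (linearForm q) B)

/-- The order of contact, on the fibre over `q`, of the sections `A x + B y = 0` and
`A' x + B' y = 0`: the order of vanishing at `q` of the second equation pulled back along the
parametrization `t ↦ (t; B(t), -A(t))` of the first section. -/
noncomputable def contactOrder (A B A' B' : MvPolynomial (Fin 2) ℂ)
    (q : Projectivization ℂ (Fin 2 → ℂ)) : ℕ∞ :=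
  emultiplicity (linearForm q) (A' * B - B' * A)

/-! ## Scrolls -/

/-- Affine lift of the parametrized rational normal curve of degree `n`. -/
def veronese (n : ℕ) (t : Fin 2 → ℂ) : Fin (n + 1) → ℂ :=
  fun i => t 0 ^ (i : ℕ) * t 1 ^ (n - (i : ℕ))

/-- `S ⊆ ℙᴺ` is a rational normal scroll `S_{k,l}`: after a linear embedding of `ℙᵏ⁺ˡ⁺¹` in `ℙᴺ`,
it is swept out by the lines that join corresponding points of two rational normal curves of
degrees `k` and `l` in disjoint linear spaces of dimensions `k` and `l`. -/
def IsScroll (k l : ℕ) {N : ℕ} (S : Set (Projectivization ℂ (Fin (N + 1) → ℂ))) : Prop :=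
  ∃ T : ((Fin (k + 1) → ℂ) × (Fin (l + 1) → ℂ)) →ₗ[ℂ] (Fin (N + 1) → ℂ),
    Function.Injective T ∧
    S = {Q | ∃ z : Coord,
      Q.submodule = Submodule.span ℂ {T (z.x • veronese k z.t, z.y • veronese l z.t)}}

/-- A map from `F_r` to `ℙᴺ` and two marked curves on `F_r`. -/
structure MarkedMap (r N : ℕ) where
  π : Hirzebruch r → Projectivization ℂ (Fin (N + 1) → ℂ)
  C : Set (Hirzebruch r)
  D : Set (Hirzebruch r)

/-- Isomorphism of maps with marked curves. -/
def MarkedMap.Iso {r N : ℕ} (M M' : MarkedMap r N) : Prop :=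
  ∃ φ : Hirzebruch r ≃ Hirzebruch r, IsRuledAut φ ∧
    (∀ P, M'.π (φ P) = M.π P) ∧ φ '' M.C = M'.C ∧ φ '' M.D = M'.D

/-- The curve `Z` is mapped into the hyperplane `∑ hᵢ Xᵢ = 0`. -/
def MarkedMap.LiesIn {r N : ℕ} (M : MarkedMap r N) (h : Fin (N + 1) → ℂ)
    (Z : Set (Hirzebruch r)) : Prop :=
  ∀ P ∈ Z, h ⬝ᵥ (M.π P).rep = 0

/-- `Z` is the directrix, i.e. the exceptional section `y = 0` of `F_r`, `r > 0`.
By convention a perfectly balanced scroll (`r = 0`) has no directrix. -/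
def IsDirectrix {r : ℕ} (Z : Set (Hirzebruch r)) : Prop :=
  0 < r ∧ Z = curve r 0 1

/-! ## Coordinates

A tuple of `N + 1` sections `Aᵢ x + Bᵢ y` of `𝒪(E + l f)` on `F_{l-k}` (with `deg Aᵢ = k` and
`deg Bᵢ = l`), an equation of `C` in the class `E + (d - k) f` of sections of degree `d`, and an
equation of `D` in the class `E + (e - k) f` of sections of degree `e`, form a point of an affine
space. -/

/-- The coordinates of this affine space. -/
abbrev Idx (N k l d e : ℕ) : Type :=
  (Fin (N + 1) × (Fin (k + 1) ⊕ Fin (l + 1))) ⊕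
    ((Fin (d + 1 - l) ⊕ Fin (d + 1 - k)) ⊕ (Fin (e + 1 - l) ⊕ Fin (e + 1 - k)))

section Datum

variable {N k l d e : ℕ} (x : Idx N k l d e → ℂ)

/-- The form `Aᵢ` of degree `k`. -/
noncomputable def secA (i : Fin (N + 1)) : MvPolynomial (Fin 2) ℂ :=
  form fun j : Fin (k + 1) => x (.inl (i, .inl j))

/-- The form `Bᵢ` of degree `l`. -/
noncomputable def secB (i : Fin (N + 1)) : MvPolynomial (Fin 2) ℂ :=
  form fun j : Fin (l + 1) => x (.inl (i, .inr j))

/-- The equation of `C`: coefficient of `x`, of degree `d - l`. -/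
noncomputable def eqnCA : MvPolynomial (Fin 2) ℂ :=
  form fun j : Fin (d + 1 - l) => x (.inr (.inl (.inl j)))

/-- The equation of `C`: coefficient of `y`, of degree `d - k`. -/
noncomputable def eqnCB : MvPolynomial (Fin 2) ℂ :=
  form fun j : Fin (d + 1 - k) => x (.inr (.inl (.inr j)))

/-- The equation of `D`: coefficient of `x`, of degree `e - l`. -/
noncomputable def eqnDA : MvPolynomial (Fin 2) ℂ :=
  form fun j : Fin (e + 1 - l) => x (.inr (.inr (.inl j)))

/-- The equation of `D`: coefficient of `y`, of degree `e - k`. -/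
noncomputable def eqnDB : MvPolynomial (Fin 2) ℂ :=
  form fun j : Fin (e + 1 - k) => x (.inr (.inr (.inr j)))

/-- The values of the `N + 1` sections at a point. -/
noncomputable def values (z : Coord) : Fin (N + 1) → ℂ :=
  fun i => MvPolynomial.eval z.t (secA x i) * z.x + MvPolynomial.eval z.t (secB x i) * z.y

/-- The data `x` represents the marked map `M`; in particular the sections have no common zero. -/
def Represents (M : MarkedMap (l - k) N) : Prop :=
  (∀ z : Coord, ∃ hz : values x z ≠ 0,
    M.π (Hirzebruch.mk (l - k) z) = Projectivization.mk ℂ (values x z) hz) ∧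
  M.C = curve (l - k) (eqnCA x) (eqnCB x) ∧
  M.D = curve (l - k) (eqnDA x) (eqnDB x)

/-- Two data are equivalent iff they represent isomorphic marked maps. -/
def Equivalent (x x' : Idx N k l d e → ℂ) : Prop :=
  ∃ M M' : MarkedMap (l - k) N, Represents x M ∧ Represents x' M' ∧ M.Iso M'

/-- The order of contact of the scroll with the hyperplane `∑ hᵢ Xᵢ = 0` along the fibre over `q`,
i.e. the multiplicity of that fibre in the pull-back of the hyperplane. -/
noncomputable def hyperplaneContact (h : Fin (N + 1) → ℂ)
    (q : Projectivization ℂ (Fin 2 → ℂ)) : ℕ∞ :=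
  fibreOrder (∑ i, MvPolynomial.C (h i) * secA x i) (∑ i, MvPolynomial.C (h i) * secB x i) q

end Datum

/-- The locus of maps `F_{l-k} → ℙᴺ` with marked irreducible sections `C` of degree `d` and `D` of
degree `e`, which satisfy the additional condition `Q`, such that the image is a scroll `S_{k,l}`
and, for suitable distinct fibres `pᵢ`,
* the fibres contained in the hyperplane `H : ∑ hᵢ Xᵢ = 0` are the first `m` fibres, with
  orders of contact `μᵢ`;
* if `C ≠ D`, then `C` and `D` have contact of order `νᵢ` on the `i`-th fibre for each of the
  `m + n` indices `i` (`νᵢ = 0` standing for no condition). -/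
def locus (N k l d e : ℕ) {m n : ℕ} (h : Fin (N + 1) → ℂ) (μ : Fin m → ℕ)
    (ν : Fin m ⊕ Fin n → ℕ) (Q : MarkedMap (l - k) N → Prop) : Set (Idx N k l d e → ℂ) :=
  {x | ∃ M : MarkedMap (l - k) N, Represents x M ∧ IsScroll k l (Set.range M.π) ∧
    IsIrreducibleSection (eqnCA x) (eqnCB x) ∧ IsIrreducibleSection (eqnDA x) (eqnDB x) ∧
    Q M ∧
    ∃ p : Fin m ⊕ Fin n → Projectivization ℂ (Fin 2 → ℂ), Function.Injective p ∧
      (∀ i, hyperplaneContact x h (p (.inl i)) = μ i) ∧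
      (∀ q, (∀ i, q ≠ p (.inl i)) → hyperplaneContact x h q = 0) ∧
      (M.C ≠ M.D → ∀ i, ν i ≠ 0 →
        contactOrder (eqnCA x) (eqnCB x) (eqnDA x) (eqnDB x) (p i) = ν i)}

/-! ## Dimensions -/

/-- The dimension of a (constructible) subset of an affine space: the Krull dimension of the
coordinate ring of its Zariski closure (`⊥` for the empty set). -/
noncomputable def zariskiDim {ι : Type} (X : Set (ι → ℂ)) : WithBot ℕ∞ :=
  ringKrullDim (MvPolynomial ι ℂ ⧸ MvPolynomial.vanishingIdeal ℂ X)

/-- The set `X` of parameters modulo the equivalence relation `R` has dimension `δ`: all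
equivalence classes have the same dimension `b`, and `δ = dim X - b`. -/
def HasQuotientDim {ι : Type} (X : Set (ι → ℂ)) (R : (ι → ℂ) → (ι → ℂ) → Prop) (δ : ℤ) : Prop :=
  ∃ a b : ℕ, zariskiDim X = a ∧ (∀ x ∈ X, zariskiDim {y ∈ X | R x y} = b) ∧ δ = (a : ℤ) - b

/-- The locus, if it is not empty, has dimension `δ` up to isomorphism. -/
def LocusDim (N k l d e : ℕ) {m n : ℕ} (h : Fin (N + 1) → ℂ) (μ : Fin m → ℕ)
    (ν : Fin m ⊕ Fin n → ℕ) (Q : MarkedMap (l - k) N → Prop) (δ : ℤ) : Prop :=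
  (locus N k l d e h μ ν Q).Nonempty →
    HasQuotientDim (locus N k l d e h μ ν Q) Equivalent δ

end Scroll

/-! In homogeneous coordinates everything is a tuple of binary forms. A map consists of N+1 pairs of
forms of degrees k and l, a section of degree j of a pair of forms of degrees j-l and j-k up to a
scalar. The image is a scroll `S_{k,l}` exactly when the linear map from the k+l+2 coordinates of
the standard scroll is injective (`NonDeg`). The pull-back of H is one more pair of degrees k and l.
Dividing it by the fibres it contains leaves an irreducible section G of degree k+l-Σμ, and a marked
section lies in H iff it equals G. The determinant of two irreducible pairs is their contact form;
it vanishes identically iff the sections coincide, and prescribed contact means divisibility by a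
product of powers of linear forms. Hence each listed condition is a pattern of coincidences among G,
C and D (`Config`, `locus_eq_config`).

The count: tuples with given pull-back form an affine space of dimension N(k+l+2), and the pull-back
varies with m points and G. The equations of irreducible sections of degree j fill an open part of a
space of dimension 2j-k-l+2 if j ≥ l, and of dimension 1 for the directrix. If C ≠ D, the condition
that the contact form be a product of linear powers times a free form R is linear in R and one of
the two sections. Its equations are independent because contact with a fixed irreducible section
maps onto all forms of the right degree (`Irr.contact_surjective`). So contact costs Σν and the n
extra points contribute n. This gives `hasDim_distinct`, `hasDim_fst_eq`, `hasDim_eq` and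
`hasDim_all_eq`.

Dimension is controlled by polynomial maps: finitely many images of affine a-space that cover a set
bound it above (`zariskiDim_le`), and a map with one finite fibre on an open set bounds it below
(`le_zariskiDim`). Local parametrizations of linear systems supply such maps
(`LocalParamAt.linear_system`, `HasDim.of_charts`).

Isomorphism classes are orbits of the automorphisms of the ruled surface together with rescaling of
the equations; the stabilizer is trivial, so all classes have dimension l-k+8, plus one if k = l
(`hasDim_orbit`). Subtracting gives the stated numbers. -/

namespace Scroll

/-! ## Polynomial maps between complex vector spaces -/

/-- The algebra of polynomial functions on a complex vector space. -/
def polyFun (V : Type*) [AddCommGroup V] [Module ℂ V] : Subalgebra ℂ (V → ℂ) :=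
  Algebra.adjoin ℂ (Set.range fun φ : Module.Dual ℂ V => (φ : V → ℂ))

/-- Polynomial maps between complex vector spaces. -/
@[fun_prop] def IsPolyMap {V W : Type*} [AddCommGroup V] [Module ℂ V] [AddCommGroup W] [Module ℂ W]
    (F : V → W) : Prop :=
  F ∈ Submodule.span ℂ {G : V → W | ∃ f ∈ polyFun V, ∃ w : W, G = fun v => f v • w}

namespace IsPolyMap

variable {V W W₁ W₂ W₃ : Type*} [AddCommGroup V] [Module ℂ V] [AddCommGroup W] [Module ℂ W]
  [AddCommGroup W₁] [Module ℂ W₁] [AddCommGroup W₂] [Module ℂ W₂] [AddCommGroup W₃] [Module ℂ W₃]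

theorem of_mem {f : V → ℂ} (hf : f ∈ polyFun V) (w : W) : IsPolyMap fun v => f v • w :=
  Submodule.subset_span ⟨f, hf, w, rfl⟩

theorem mem {f : V → ℂ} (hf : IsPolyMap f) : f ∈ polyFun V := by
  induction hf using Submodule.span_induction with
  | mem G hG =>
    obtain ⟨f, hf, w, rfl⟩ := hG
    have : (fun v => f v • w) = w • f := by ext; simp [mul_comm]
    rw [this]; exact Subalgebra.smul_mem _ hf _
  | zero => exact zero_mem _
  | add x y _ _ hx hy => exact add_mem hx hy
  | smul a x _ hx => exact Subalgebra.smul_mem _ hx _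

theorem of_mem' {f : V → ℂ} (hf : f ∈ polyFun V) : IsPolyMap f := by
  simpa using of_mem hf (1 : ℂ)

@[fun_prop] theorem const (w : W) : IsPolyMap fun _ : V => w := by
  simpa using of_mem (one_mem (polyFun V)) w

@[fun_prop] theorem add {F G : V → W} (hF : IsPolyMap F) (hG : IsPolyMap G) :
    IsPolyMap fun v => F v + G v := Submodule.add_mem _ hF hG

@[fun_prop] theorem sub {F G : V → W} (hF : IsPolyMap F) (hG : IsPolyMap G) :
    IsPolyMap fun v => F v - G v := Submodule.sub_mem _ hF hG

@[fun_prop] theorem sum {ι : Type*} {s : Finset ι} {F : ι → V → W} (hF : ∀ i, IsPolyMap (F i)) :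
    IsPolyMap fun v => ∑ i ∈ s, F i v := by
  have : (fun v => ∑ i ∈ s, F i v) = ∑ i ∈ s, F i := by ext; simp
  rw [this]
  exact Submodule.sum_mem _ fun i _ => hF i

theorem linear (L : W →ₗ[ℂ] W₁) {F : V → W} (hF : IsPolyMap F) : IsPolyMap fun v => L (F v) := by
  induction hF using Submodule.span_induction with
  | mem G hG =>
    obtain ⟨f, hf, w, rfl⟩ := hG
    simpa using of_mem hf (L w)
  | zero => simpa using const (V := V) (0 : W₁)
  | add x y _ _ hx hy => simpa using hx.add hy
  | smul a x _ hx =>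
    simp only [Pi.smul_apply, map_smul]
    exact Submodule.smul_mem _ a hx

theorem bilin (B : W₁ →ₗ[ℂ] W₂ →ₗ[ℂ] W₃) {F : V → W₁} {G : V → W₂} (hF : IsPolyMap F)
    (hG : IsPolyMap G) : IsPolyMap fun v => B (F v) (G v) := by
  induction hF using Submodule.span_induction with
  | mem F' hF' =>
    obtain ⟨f, hf, w, rfl⟩ := hF'
    induction hG using Submodule.span_induction with
    | mem G' hG' =>
      obtain ⟨g, hg, w', rfl⟩ := hG'
      simpa [smul_smul, mul_comm] using of_mem (mul_mem hf hg) (B w w')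
    | zero => simpa using const (V := V) (0 : W₃)
    | add x y _ _ hx hy => simpa using hx.add hy
    | smul a x _ hx =>
      simp only [Pi.smul_apply, map_smul] at hx ⊢
      exact Submodule.smul_mem _ a hx
  | zero => simpa using const (V := V) (0 : W₃)
  | add x y _ _ hx hy => simpa using hx.add hy
  | smul a x _ hx =>
    simp only [Pi.smul_apply, map_smul, LinearMap.smul_apply] at hx ⊢
    exact Submodule.smul_mem _ a hx

@[fun_prop] theorem smul {f : V → ℂ} {G : V → W} (hf : IsPolyMap f) (hG : IsPolyMap G) :
    IsPolyMap fun v => f v • G v := bilin (LinearMap.lsmul ℂ W) hf hG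

@[fun_prop] theorem mul {A : Type*} [CommRing A] [Algebra ℂ A] {f g : V → A} (hf : IsPolyMap f)
    (hg : IsPolyMap g) : IsPolyMap fun v => f v * g v := bilin (LinearMap.mul ℂ A) hf hg

@[fun_prop] theorem pow {A : Type*} [CommRing A] [Algebra ℂ A] {f : V → A} (hf : IsPolyMap f)
    (n : ℕ) : IsPolyMap fun v => f v ^ n := by
  induction n with
  | zero => simpa using const (1 : A)
  | succ n ih => simpa [pow_succ] using ih.mul hf

@[fun_prop] theorem prod {A : Type*} [CommRing A] [Algebra ℂ A] {ι : Type*} {s : Finset ι}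
    {F : ι → V → A} (hF : ∀ i, IsPolyMap (F i)) : IsPolyMap fun v => ∏ i ∈ s, F i v := by
  classical
  induction s using Finset.induction_on with
  | empty => simpa using const (1 : A)
  | insert a s ha ih => simpa [Finset.prod_insert ha] using (hF a).mul ih

@[fun_prop] theorem id [FiniteDimensional ℂ V] : IsPolyMap fun v : V => v := by
  let b := Module.finBasis ℂ V
  have : (fun v : V => v) = fun v => ∑ i, b.coord i v • b i := by
    ext v; exact (b.sum_repr v).symm
  rw [this]
  exact sum fun i => of_mem (Algebra.subset_adjoin ⟨b.coord i, rfl⟩) (b i)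

theorem linearMap [FiniteDimensional ℂ V] (L : V →ₗ[ℂ] W) : IsPolyMap fun v => L v :=
  linear L id

theorem comp_polyFun {F : V → W} (hF : IsPolyMap F) {f : W → ℂ} (hf : f ∈ polyFun W) :
    IsPolyMap fun v => f (F v) := by
  induction hf using Algebra.adjoin_induction with
  | mem x hx => obtain ⟨φ, rfl⟩ := hx; exact linear φ hF
  | algebraMap r => exact const r
  | add x y _ _ hx hy => exact hx.add hy
  | mul x y _ _ hx hy => exact hx.mul hy

@[fun_prop] theorem comp {G : W → W₁} {F : V → W} (hG : IsPolyMap G) (hF : IsPolyMap F) :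
    IsPolyMap fun v => G (F v) := by
  induction hG using Submodule.span_induction with
  | mem G hG =>
    obtain ⟨f, hf, w, rfl⟩ := hG
    exact (comp_polyFun hF hf).smul (const w)
  | zero => exact const 0
  | add x y _ _ hx hy => exact hx.add hy
  | smul a x _ hx => exact (const a).smul hx

@[fun_prop] theorem prodMk {F : V → W₁} {G : V → W₂} (hF : IsPolyMap F) (hG : IsPolyMap G) :
    IsPolyMap fun v => (F v, G v) := by
  simpa using (linear (LinearMap.inl ℂ W₁ W₂) hF).add (linear (LinearMap.inr ℂ W₁ W₂) hG)

@[fun_prop] theorem fst {F : V → W₁ × W₂} (hF : IsPolyMap F) : IsPolyMap fun v => (F v).1 :=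
  linear (LinearMap.fst ℂ W₁ W₂) hF

@[fun_prop] theorem snd {F : V → W₁ × W₂} (hF : IsPolyMap F) : IsPolyMap fun v => (F v).2 :=
  linear (LinearMap.snd ℂ W₁ W₂) hF

@[fun_prop] theorem pi {ι : Type*} [Finite ι] {E : ι → Type*} [∀ i, AddCommGroup (E i)]
    [∀ i, Module ℂ (E i)] {F : V → ∀ i, E i} (hF : ∀ i, IsPolyMap fun v => F v i) :
    IsPolyMap F := by
  classical
  have := Fintype.ofFinite ι
  have h : F = fun v => ∑ i, LinearMap.single ℂ E i (F v i) := by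
    ext v i
    simp [Finset.sum_apply]
  rw [h]
  exact sum fun i => linear _ (hF i)

theorem apply {ι : Type*} {E : ι → Type*} [∀ i, AddCommGroup (E i)]
    [∀ i, Module ℂ (E i)] {F : V → ∀ i, E i} (hF : IsPolyMap F) (i : ι) :
    IsPolyMap fun v => F v i :=
  linear (LinearMap.proj i) hF

@[fun_prop] theorem eval_at {ι : Type*} [Finite ι] {E : ι → Type*} [∀ i, AddCommGroup (E i)]
    [∀ i, Module ℂ (E i)] [∀ i, FiniteDimensional ℂ (E i)] (i : ι) :
    IsPolyMap fun v : ∀ i, E i => v i :=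
  linear (LinearMap.proj (R := ℂ) (φ := E) i) id

theorem linearMap_apply {L : V → (W₁ →ₗ[ℂ] W₂)} {F : V → W₁} (hL : IsPolyMap L)
    (hF : IsPolyMap F) : IsPolyMap fun v => L v (F v) := bilin LinearMap.id hL hF

theorem linearMap_comp {L : V → (W₁ →ₗ[ℂ] W₂)} {M : V → (W →ₗ[ℂ] W₁)}
    (hL : IsPolyMap L) (hM : IsPolyMap M) : IsPolyMap fun v => L v ∘ₗ M v :=
  bilin (LinearMap.llcomp ℂ W W₁ W₂) hL hM

@[fun_prop] theorem matrix_det {n : Type*} [Fintype n] [DecidableEq n] {M : V → Matrix n n ℂ}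
    (hM : IsPolyMap M) : IsPolyMap fun v => (M v).det := by
  have hM' : ∀ i j, IsPolyMap fun v => M v i j := fun i j =>
    linear (Matrix.entryLinearMap ℂ ℂ i j) hM
  simp only [Matrix.det_apply]
  refine sum fun σ => ?_
  have h : ∀ v, (Equiv.Perm.sign σ • ∏ i, M v (σ i) i)
      = ((Equiv.Perm.sign σ : ℤ) : ℂ) * ∏ i, M v (σ i) i := by
    intro v; rw [Units.smul_def]; simp
  simp only [h]
  exact (const _).mul (prod fun i => hM' _ _)

theorem of_entries {m n : Type*} [Finite m] [Finite n] {M : V → Matrix m n ℂ}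
    (hM : ∀ i j, IsPolyMap fun v => M v i j) : IsPolyMap M := by
  have h : IsPolyMap fun v => (fun i j => M v i j : m → n → ℂ) := pi fun i => pi fun j => hM i j
  exact linear ((Matrix.ofLinearEquiv (α := ℂ) ℂ : (m → n → ℂ) ≃ₗ[ℂ] Matrix m n ℂ) :
    (m → n → ℂ) →ₗ[ℂ] Matrix m n ℂ) h

theorem matrix_adjugate {n : Type*} [Fintype n] [DecidableEq n] {M : V → Matrix n n ℂ}
    (hM : IsPolyMap M) : IsPolyMap fun v => (M v).adjugate := by
  have hM' : ∀ i j, IsPolyMap fun v => M v i j := fun i j =>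
    linear (Matrix.entryLinearMap ℂ ℂ i j) hM
  refine of_entries fun i j => ?_
  simp only [Matrix.adjugate_apply]
  refine matrix_det (of_entries fun a b => ?_)
  by_cases h : a = j
  · subst h; simp only [Matrix.updateRow_self]; exact const _
  · simp only [Matrix.updateRow_ne h]; exact hM' _ _

end IsPolyMap

/-- On a finite-dimensional space there are polynomial endomorphism-valued maps which serve as
determinant and adjugate. -/
theorem exists_adjugate (E : Type*) [AddCommGroup E] [Module ℂ E] [FiniteDimensional ℂ E] :
    ∃ adj : Module.End ℂ E → Module.End ℂ E, IsPolyMap adj ∧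
      IsPolyMap (fun A : Module.End ℂ E => LinearMap.det A) ∧
      ∀ A, A * adj A = LinearMap.det A • 1 ∧ adj A * A = LinearMap.det A • 1 := by
  let b := Module.finBasis ℂ E
  let e := LinearMap.toMatrixAlgEquiv b
  have he : IsPolyMap fun A : Module.End ℂ E => e A := IsPolyMap.linearMap e.toLinearMap
  refine ⟨fun A => e.symm (e A).adjugate, ?_, ?_, fun A => ?_⟩
  · exact IsPolyMap.linear e.symm.toLinearMap (IsPolyMap.matrix_adjugate he)
  · have : ∀ A : Module.End ℂ E, LinearMap.det A = (e A).det := fun A =>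
      (LinearMap.det_toMatrix b A).symm
    simp only [this]
    exact IsPolyMap.matrix_det he
  · have h : LinearMap.det A = (e A).det := (LinearMap.det_toMatrix b A).symm
    constructor <;> apply e.injective <;>
      simp [h, Matrix.mul_adjugate, Matrix.adjugate_mul]

/-- Passes from coordinate-free polynomial functions to polynomials in coordinates, to which the
dimension theory of rings applies. -/
theorem exists_mvPolynomial {κ : Type*} [Finite κ] {f : (κ → ℂ) → ℂ} (hpoly : IsPolyMap f) :
    ∃ p : MvPolynomial κ ℂ, ∀ v, f v = MvPolynomial.eval v p := by
  classical
  have := Fintype.ofFinite κ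
  have hf := hpoly.mem
  clear hpoly
  induction hf using Algebra.adjoin_induction with
  | mem x hx =>
    obtain ⟨φ, rfl⟩ := hx
    refine ⟨∑ i, MvPolynomial.C (φ (Pi.single i 1)) * MvPolynomial.X i, fun v => ?_⟩
    conv_lhs => rw [← Finset.univ_sum_single v]
    simp only [map_sum, map_mul, MvPolynomial.eval_C, MvPolynomial.eval_X]
    refine Finset.sum_congr rfl fun i _ => ?_
    have : Pi.single i (v i) = v i • Pi.single i (1 : ℂ) := by
      rw [← Pi.single_smul]; simp
    rw [this, map_smul]; simp [mul_comm]
  | algebraMap r => exact ⟨MvPolynomial.C r, by simp⟩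
  | add x y _ _ hx hy =>
    obtain ⟨p, hp⟩ := hx
    obtain ⟨q, hq⟩ := hy
    exact ⟨p + q, by simp [hp, hq]⟩
  | mul x y _ _ hx hy =>
    obtain ⟨p, hp⟩ := hx
    obtain ⟨q, hq⟩ := hy
    exact ⟨p * q, by simp [hp, hq]⟩

theorem isPolyMap_eval {κ : Type*} [Finite κ] (p : MvPolynomial κ ℂ) :
    IsPolyMap fun v : κ → ℂ => MvPolynomial.eval v p := by
  induction p using MvPolynomial.induction_on with
  | C a => simpa using IsPolyMap.const a
  | add p q hp hq => simpa using hp.add hq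
  | mul_X p i hp => simpa using hp.mul (IsPolyMap.id.apply i)

/-! ## Zariski neighbourhoods -/

/-- The filter of Zariski neighbourhoods of a point. -/
def zn {V : Type*} [AddCommGroup V] [Module ℂ V] (v : V) : Filter V where
  sets := {S | ∃ f : V → ℂ, IsPolyMap f ∧ f v ≠ 0 ∧ ∀ w, f w ≠ 0 → w ∈ S}
  univ_sets := ⟨fun _ => 1, IsPolyMap.const 1, one_ne_zero, fun _ _ => trivial⟩
  sets_of_superset := by
    rintro S T ⟨f, hf, hv, h⟩ hST
    exact ⟨f, hf, hv, fun w hw => hST (h w hw)⟩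
  inter_sets := by
    rintro S T ⟨f, hf, hv, h⟩ ⟨g, hg, hv', h'⟩
    exact ⟨fun v => f v * g v, hf.mul hg, mul_ne_zero hv hv', fun w hw =>
      ⟨h w (left_ne_zero_of_mul hw), h' w (right_ne_zero_of_mul hw)⟩⟩

section zn

open Filter

variable {V W : Type*} [AddCommGroup V] [Module ℂ V] [AddCommGroup W] [Module ℂ W]

theorem eventually_ne_zero {v : V} {f : V → ℂ} (hf : IsPolyMap f) (hv : f v ≠ 0) :
    ∀ᶠ w in zn v, f w ≠ 0 := ⟨f, hf, hv, fun _ h => h⟩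

theorem IsPolyMap.tendsto {F : V → W} (hF : IsPolyMap F) (v : V) :
    Tendsto F (zn v) (zn (F v)) := by
  rintro S ⟨f, hf, hv, h⟩
  exact ⟨fun v => f (F v), hf.comp hF, hv, fun w hw => h _ hw⟩

/-- Linear functionals separate points, so some functional reduces the claim to a scalar function.
-/
theorem eventually_ne_zero' {v : V} {F : V → W} (hF : IsPolyMap F) (hv : F v ≠ 0) :
    ∀ᶠ w in zn v, F w ≠ 0 := by
  obtain ⟨φ, hφ⟩ : ∃ φ : Module.Dual ℂ W, φ (F v) ≠ 0 := by
    by_contra! h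
    exact hv ((Module.forall_dual_apply_eq_zero_iff ℂ _).1 h)
  filter_upwards [eventually_ne_zero (hF.linear φ) hφ] with w hw h0
  exact hw (by simp [h0])

/-- With a left inverse `S` of `T v`, the determinant of `S ∘ T w` is polynomial in `w` and equals 1
at `v`. Where it is nonzero, `T w` is injective. -/
theorem eventually_injective {E E' : Type*} [AddCommGroup E] [Module ℂ E] [FiniteDimensional ℂ E]
    [AddCommGroup E'] [Module ℂ E'] {v : V} {T : V → (E →ₗ[ℂ] E')} (hT : IsPolyMap T)
    (hv : Function.Injective (T v)) : ∀ᶠ w in zn v, Function.Injective (T w) := by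
  obtain ⟨S, hS⟩ := (T v).exists_leftInverse_of_injective (LinearMap.ker_eq_bot.2 hv)
  obtain ⟨adj, -, hdet, hadj⟩ := exists_adjugate E
  have hp : IsPolyMap fun w => LinearMap.det (S ∘ₗ T w) :=
    hdet.comp (IsPolyMap.linearMap_comp (IsPolyMap.const S) hT)
  filter_upwards [eventually_ne_zero hp (by rw [hS]; simp)] with w hw
  have : Function.Injective (S ∘ₗ T w) := by
    intro x y hxy
    have h := congrArg (adj (S ∘ₗ T w)) hxy
    have h2 := fun x => LinearMap.congr_fun (hadj (S ∘ₗ T w)).2 x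
    simp only [Module.End.mul_apply, LinearMap.smul_apply, Module.End.one_apply] at h2
    rw [h2, h2] at h
    exact smul_right_injective _ hw h
  exact Function.Injective.of_comp this

/-- Dual to the injective case: the determinant of `T w ∘ S` for a right inverse `S` of `T v`, with
the adjugate giving preimages. -/
theorem eventually_surjective {E E' : Type*} [AddCommGroup E] [Module ℂ E]
    [AddCommGroup E'] [Module ℂ E'] [FiniteDimensional ℂ E'] {v : V} {T : V → (E →ₗ[ℂ] E')}
    (hT : IsPolyMap T) (hv : Function.Surjective (T v)) :
    ∀ᶠ w in zn v, Function.Surjective (T w) := by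
  obtain ⟨S, hS⟩ := (T v).exists_rightInverse_of_surjective (LinearMap.range_eq_top.2 hv)
  obtain ⟨adj, -, hdet, hadj⟩ := exists_adjugate E'
  have hp : IsPolyMap fun w => LinearMap.det (T w ∘ₗ S) :=
    hdet.comp (IsPolyMap.linearMap_comp hT (IsPolyMap.const S))
  filter_upwards [eventually_ne_zero hp (by rw [hS]; simp)] with w hw
  intro y
  have h2 := LinearMap.congr_fun (hadj (T w ∘ₗ S)).1 y
  refine ⟨(LinearMap.det (T w ∘ₗ S))⁻¹ • S (adj (T w ∘ₗ S) y), ?_⟩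
  simp only [Module.End.mul_apply, LinearMap.smul_apply, Module.End.one_apply,
    LinearMap.comp_apply] at h2
  rw [map_smul, h2, smul_smul, inv_mul_cancel₀ hw, one_smul]

end zn

end Scroll

/-! ### Krull dimension of images of polynomial maps -/

namespace Scroll
open MvPolynomial

theorem aeval_eq_eval' {κ : Type*} (v : κ → ℂ) (p : MvPolynomial κ ℂ) : aeval v p = eval v p := by
  rw [← coe_aeval_eq_eval]; rfl

/-- Every point of affine space has the full height. -/
theorem natCast_le_height_point {κ : Type} [Finite κ] (w : κ → ℂ) :
    (Nat.card κ : ℕ∞) ≤ (vanishingIdeal ℂ ({w} : Set (κ → ℂ))).height := by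
  -- Translation by `v - w` is an automorphism of the polynomial ring that matches the two maximal
  -- ideals, so all points have the same height.
  have key : ∀ v : κ → ℂ, (vanishingIdeal ℂ ({v} : Set (κ → ℂ))).height
      = (vanishingIdeal ℂ ({w} : Set (κ → ℂ))).height := by
    intro v
    let φ : MvPolynomial κ ℂ →ₐ[ℂ] MvPolynomial κ ℂ := aeval fun i => X i + C (v i - w i)
    let ψ : MvPolynomial κ ℂ →ₐ[ℂ] MvPolynomial κ ℂ := aeval fun i => X i - C (v i - w i)
    let e : MvPolynomial κ ℂ ≃ₐ[ℂ] MvPolynomial κ ℂ := AlgEquiv.ofAlgHom φ ψ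
      (by ext i : 1; simp [φ, ψ]) (by ext i : 1; simp [φ, ψ])
    have hev : ∀ p, aeval w (e p) = aeval v p := by
      have : (aeval w : MvPolynomial κ ℂ →ₐ[ℂ] ℂ).comp φ = aeval v := by
        ext i : 1; simp [φ]
      exact fun p => DFunLike.congr_fun this p
    have : vanishingIdeal ℂ ({v} : Set (κ → ℂ))
        = (vanishingIdeal ℂ ({w} : Set (κ → ℂ))).comap (e.toRingEquiv : _ ≃+* _) := by
      ext p
      simp only [mem_vanishingIdeal_singleton_iff, Ideal.mem_comap]
      change _ ↔ aeval w (e p) = 0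
      rw [hev]
    rw [this, RingEquiv.height_comap]
  have hdim : ringKrullDim (MvPolynomial κ ℂ) = (Nat.card κ : WithBot ℕ∞) := by
    rw [MvPolynomial.ringKrullDim_of_isNoetherianRing, ringKrullDim_eq_zero_of_field, zero_add]
  -- The dimension is the supremum of the heights of maximal ideals, which are ideals of points by
  -- the Nullstellensatz.
  have hle : ringKrullDim (MvPolynomial κ ℂ)
      ≤ ((vanishingIdeal ℂ ({w} : Set (κ → ℂ))).height : ℕ∞) := by
    rw [ringKrullDim_le_iff_isMaximal_height_le]
    intro M hM
    obtain ⟨v, rfl⟩ := isMaximal_iff_eq_vanishingIdeal_singleton.1 hM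
    rw [key v]
  rw [hdim] at hle
  exact_mod_cast hle

/-- The comorphism of a polynomial map. -/
theorem exists_comorphism {κ ι : Type} [Finite κ] {F : (κ → ℂ) → ι → ℂ} (hF : IsPolyMap F) :
    ∃ φ : MvPolynomial ι ℂ →ₐ[ℂ] MvPolynomial κ ℂ, ∀ v P,
      aeval v (φ P) = aeval (F v) P := by
  choose p hp using fun i => exists_mvPolynomial (hF.apply i)
  refine ⟨aeval p, fun v P => ?_⟩
  have : (aeval v : MvPolynomial κ ℂ →ₐ[ℂ] ℂ).comp (aeval p) = aeval (F v) := by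
    ext i : 1; simp [hp]
  exact DFunLike.congr_fun this P

/-- Incomparability: contraction of primes along an integral map is strictly monotone. -/
theorem ringKrullDim_le_of_isIntegral {A B : Type} [CommRing A] [CommRing B] (g : A →+* B)
    (hg : g.IsIntegral) : ringKrullDim B ≤ ringKrullDim A := by
  let _ := g.toAlgebra
  have : Algebra.IsIntegral A B := ⟨hg⟩
  refine Order.krullDim_le_of_strictMono (PrimeSpectrum.comap g) ?_
  intro p q hpq
  exact Ideal.IsIntegral.comap_lt_comap (R := A) (I := p.asIdeal) (J := q.asIdeal) hpq

/-- By Noether normalization the quotient is integral over a polynomial ring in `s` variables, so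
its dimension is at most `s`. It also embeds in the polynomial ring in the variables `κ`, and
transcendence degrees give `s ≤ card κ`. -/
theorem ringKrullDim_quotient_ker_le {κ ι : Type} [Finite κ] [Finite ι]
    (φ : MvPolynomial ι ℂ →ₐ[ℂ] MvPolynomial κ ℂ) :
    ringKrullDim (MvPolynomial ι ℂ ⧸ RingHom.ker φ) ≤ Nat.card κ := by
  have : Nontrivial (MvPolynomial ι ℂ ⧸ RingHom.ker φ) :=
    Ideal.Quotient.nontrivial_iff.2 (RingHom.ker_ne_top φ)
  obtain ⟨s, g, hg, hint⟩ := exists_integral_inj_algHom_of_fg ℂ (MvPolynomial ι ℂ ⧸ RingHom.ker φ)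
  have h1 := ringKrullDim_le_of_isIntegral g.toRingHom hint
  rw [MvPolynomial.ringKrullDim_of_isNoetherianRing, ringKrullDim_eq_zero_of_field, zero_add] at h1
  refine h1.trans ?_
  have hinj : Function.Injective ((Ideal.kerLiftAlg φ).comp g) :=
    (Ideal.kerLiftAlg_injective φ).comp hg
  have h2 := lift_trdeg_le_of_injective _ hinj
  rw [MvPolynomial.trdeg_of_isDomain, MvPolynomial.trdeg_of_isDomain] at h2
  have := Fintype.ofFinite κ
  simp only [Cardinal.lift_natCast, Cardinal.mk_fintype, Nat.cast_le, Fintype.card_fin] at h2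
  rw [Nat.card_fin, Nat.card_eq_fintype_card]
  exact_mod_cast h2

/-- The vanishing ideal contains the intersection of finitely many kernels of comorphisms. The
bottom prime of a chain above it contains one of these kernels, so the whole chain lives over a
single one. -/
theorem zariskiDim_le {ι κ J : Type} [Finite ι] [Finite κ] [Finite J] {X : Set (ι → ℂ)}
    {F : J → (κ → ℂ) → ι → ℂ} (hF : ∀ j, IsPolyMap (F j)) (hX : X ⊆ ⋃ j, Set.range (F j)) :
    zariskiDim X ≤ Nat.card κ := by
  have := Fintype.ofFinite J
  choose φ hφ using fun j => exists_comorphism (hF j)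
  have hle : ⨅ j ∈ Finset.univ, RingHom.ker (φ j) ≤ vanishingIdeal ℂ X := by
    intro P hP
    rw [mem_vanishingIdeal_iff]
    intro x hx
    obtain ⟨j, v, rfl⟩ := Set.mem_iUnion.1 (hX hx)
    have : φ j P = 0 := by
      simp only [Finset.mem_univ, iInf_pos, Ideal.mem_iInf, RingHom.mem_ker] at hP
      exact hP j
    have h := hφ j v P
    rw [this, map_zero] at h
    exact h.symm
  rw [zariskiDim, ringKrullDim_quotient]
  refine iSup_le fun p => ?_
  have h0 : vanishingIdeal ℂ X ≤ (p 0).1.asIdeal := by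
    exact (PrimeSpectrum.mem_zeroLocus _ _).1 (p 0).2
  obtain ⟨j, -, hj⟩ := (Ideal.IsPrime.inf_le' (p 0).1.2).1
    ((Finset.inf_eq_iInf _ _).le.trans (hle.trans h0))
  have hmem : ∀ i, (p i).1 ∈ PrimeSpectrum.zeroLocus (RingHom.ker (φ j) : Set (MvPolynomial ι ℂ)) := by
    intro i
    rw [PrimeSpectrum.mem_zeroLocus]
    exact hj.trans (p.monotone (Fin.zero_le i))
  let q : LTSeries (PrimeSpectrum.zeroLocus (RingHom.ker (φ j) : Set (MvPolynomial ι ℂ))) :=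
    { length := p.length
      toFun := fun i => ⟨(p i).1, hmem i⟩
      step := fun i => p.step i }
  have h := ringKrullDim_quotient_ker_le (φ j)
  rw [ringKrullDim_quotient] at h
  exact (le_iSup (fun p : LTSeries (PrimeSpectrum.zeroLocus
    (RingHom.ker (φ j) : Set (MvPolynomial ι ℂ))) => (p.length : WithBot ℕ∞)) q).trans h

/-- A prime whose zeros outside a hypersurface are finite in number is the ideal of a point. -/
theorem exists_point_of_finite {κ : Type} [Finite κ] {q : Ideal (MvPolynomial κ ℂ)} [hq : q.IsPrime]
    {f : MvPolynomial κ ℂ} (hfq : f ∉ q) {s : Finset (κ → ℂ)}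
    (hs : ∀ v ∈ zeroLocus ℂ q, aeval v f ≠ 0 → v ∈ s) :
    ∃ v, q = vanishingIdeal ℂ ({v} : Set (κ → ℂ)) := by
  -- Every element of this product vanishes on the zero set of `q`: the factor `f` takes care of the
  -- hypersurface and the point ideals of the rest.
  have hprod : Ideal.span {f} * ∏ v ∈ s, vanishingIdeal ℂ ({v} : Set (κ → ℂ)) ≤ q := by
    conv_rhs => rw [← MvPolynomial.IsPrime.vanishingIdeal_zeroLocus (K := ℂ) q]
    intro x hx
    rw [mem_vanishingIdeal_iff]
    intro v hv
    by_cases hvf : aeval v f = 0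
    · have h := Ideal.mul_le_left hx
      rw [Ideal.mem_span_singleton] at h
      obtain ⟨y, rfl⟩ := h
      rw [map_mul, hvf, zero_mul]
    · have h := (Ideal.mul_le_right.trans Ideal.prod_le_inf) hx
      rw [Submodule.mem_finsetInf] at h
      exact (mem_vanishingIdeal_singleton_iff _ _).1 (h v (hs v hv hvf))
  obtain ⟨v, -, hv⟩ : ∃ v ∈ s, vanishingIdeal ℂ ({v} : Set (κ → ℂ)) ≤ q := by
    rcases hq.mul_le.1 hprod with h | h
    · exact absurd (h (Ideal.mem_span_singleton_self f)) hfq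
    · exact (Ideal.IsPrime.prod_le hq).1 h
  have hvm : (vanishingIdeal ℂ ({v} : Set (κ → ℂ))).IsMaximal :=
    isMaximal_iff_eq_vanishingIdeal_singleton.2 ⟨v, rfl⟩
  exact ⟨v, (hvm.eq_of_le hq.ne_top hv).symm⟩

/-- Let `P` be the ideal of `w` and `p` its contraction to the coordinate ring of the closure of
`Y`. The height of `P` is at most that of `p` plus the height of `P` in the fibre ring. The finite
fibre makes the last term zero, while `P` has height `card κ`. -/
theorem le_zariskiDim {ι κ : Type} [Finite ι] [Finite κ] {Y : Set (ι → ℂ)}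
    {F : (κ → ℂ) → ι → ℂ} (hF : IsPolyMap F) {w : κ → ℂ} {U : Set (κ → ℂ)} (hU : U ∈ zn w)
    (hY : Set.MapsTo F U Y) (hfin : {v ∈ U | F v = F w}.Finite) :
    Nat.card κ ≤ zariskiDim Y := by
  obtain ⟨φ, hφ⟩ := exists_comorphism hF
  obtain ⟨f, hf, hfw, hfU⟩ := hU
  obtain ⟨f, hf'⟩ := exists_mvPolynomial hf
  simp only [hf', ← aeval_eq_eval'] at hfw hfU
  -- `F` is known to land in `Y` only where `f ≠ 0`; multiplying by `f` gives an identity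
  -- everywhere, and `f` cancels in a domain.
  have hker : ∀ P ∈ vanishingIdeal ℂ Y, φ P = 0 := by
    intro P hP
    have : f * φ P = 0 := by
      apply MvPolynomial.funext
      intro v
      rw [← aeval_eq_eval', ← aeval_eq_eval', map_mul, map_zero]
      by_cases hv : aeval v f = 0
      · simp [hv]
      · have h := hY (hfU v hv)
        rw [mem_vanishingIdeal_iff] at hP
        rw [hφ, hP _ h, mul_zero]
    rcases mul_eq_zero.1 this with h | h
    · simp [h] at hfw
    · exact h
  let R := MvPolynomial ι ℂ ⧸ vanishingIdeal ℂ Y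
  let S := MvPolynomial κ ℂ
  let g : R →+* S := Ideal.Quotient.lift _ φ.toRingHom hker
  let _ : Algebra R S := g.toAlgebra
  let P : Ideal S := vanishingIdeal ℂ ({w} : Set (κ → ℂ))
  have hPm : P.IsMaximal := isMaximal_iff_eq_vanishingIdeal_singleton.2 ⟨w, rfl⟩
  have hPp : P.IsPrime := hPm.isPrime
  let p : Ideal R := P.comap g
  have hpp : p.IsPrime := Ideal.comap_isPrime g P
  have : P.LiesOver p := ⟨rfl⟩
  have h1 := Ideal.height_le_height_add_of_liesOver p P
  -- A prime between the extension of `p` and `P` omits `f`, and its zeros outside `f = 0` lie in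
  -- the finite fibre. Hence it is the ideal of a point, and equals `P`.
  have h2 : (P.map (Ideal.Quotient.mk <| p.map (algebraMap R S))).height = 0 := by
    set mk := Ideal.Quotient.mk (p.map (algebraMap R S)) with hmk
    have hpP : p.map (algebraMap R S) ≤ P := Ideal.map_comap_le
    have hker' : RingHom.ker mk ≤ P := by rw [hmk, Ideal.mk_ker]; exact hpP
    have hPp' : (P.map mk).IsPrime := Ideal.map_isPrime_of_surjective Ideal.Quotient.mk_surjective hker'
    rw [Ideal.height_eq_zero_iff]
    refine ⟨⟨hPp', bot_le⟩, ?_⟩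
    rintro q' ⟨hq', -⟩ hqP
    let q : Ideal S := q'.comap mk
    have hq : q.IsPrime := Ideal.comap_isPrime mk q'
    have hqle : q ≤ P := by
      refine (Ideal.comap_mono hqP).trans ?_
      rw [Ideal.comap_map_of_surjective mk Ideal.Quotient.mk_surjective]
      exact sup_le le_rfl hker'
    have hpq : p.map (algebraMap R S) ≤ q := by
      intro x hx
      change mk x ∈ q'
      rw [hmk, Ideal.Quotient.eq_zero_iff_mem.2 hx]; exact zero_mem _
    have hfq : f ∉ q := fun h => hfw (by
      have := hqle h
      exact (mem_vanishingIdeal_singleton_iff _ _).1 this)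
    have hpt : ∀ v ∈ zeroLocus ℂ q, aeval v f ≠ 0 → v ∈ hfin.toFinset := by
      intro v hv hvf
      rw [Set.Finite.mem_toFinset]
      refine ⟨hfU v hvf, ?_⟩
      ext i
      have hm : φ (X i - C (F w i)) ∈ q := by
        apply hpq
        have : (Ideal.Quotient.mk (vanishingIdeal ℂ Y) (X i - C (F w i)) : R) ∈ p := by
          change φ _ ∈ P
          rw [mem_vanishingIdeal_singleton_iff]
          rw [hφ]; simp
        exact Ideal.mem_map_of_mem (algebraMap R S) this
      have := hv _ hm
      have h' := hφ v (X i - C (F w i))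
      rw [this] at h'
      simp only [map_sub, aeval_X, aeval_C, Algebra.algebraMap_self, RingHom.id_apply] at h'
      exact (sub_eq_zero.1 h'.symm)
    obtain ⟨v, hv⟩ := exists_point_of_finite hfq hpt
    have hvm : (vanishingIdeal ℂ ({v} : Set (κ → ℂ))).IsMaximal :=
      isMaximal_iff_eq_vanishingIdeal_singleton.2 ⟨v, rfl⟩
    have hqP' : P ≤ q := by
      rw [hv] at hqle ⊢
      exact (hvm.eq_of_le hPp.ne_top hqle).ge
    exact (Ideal.map_mono hqP').trans Ideal.map_comap_le
  rw [h2, add_zero] at h1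
  have h3 := (natCast_le_height_point w).trans h1
  have h4 : (p.height : WithBot ℕ∞) ≤ ringKrullDim R :=
    Ideal.height_le_ringKrullDim_of_ne_top hpp.ne_top
  refine le_trans ?_ h4
  exact_mod_cast h3

end Scroll

namespace Scroll

/-! ## Dimensions by local parametrizations -/

open Set

variable {V W W' : Type} [AddCommGroup V] [Module ℂ V] [AddCommGroup W] [Module ℂ W]
  [AddCommGroup W'] [Module ℂ W']

/-- `X` is covered by finitely many polynomial images of affine `a`-space, and the image of some
open subset of affine `a`-space under a polynomial map with a finite fibre lies in `X`. -/
def HasDim (X : Set W) (a : ℕ) : Prop :=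
  (∃ (J : Type) (_ : Finite J) (F : J → (Fin a → ℂ) → W), (∀ j, IsPolyMap (F j)) ∧
    X ⊆ ⋃ j, range (F j)) ∧
  ∃ (F : (Fin a → ℂ) → W) (w : Fin a → ℂ) (U : Set (Fin a → ℂ)), IsPolyMap F ∧ U ∈ zn w ∧
    MapsTo F U X ∧ {v ∈ U | F v = F w}.Finite

theorem HasDim.zariskiDim_eq {ι : Type} [Finite ι] {X : Set (ι → ℂ)} {a : ℕ} (h : HasDim X a) :
    zariskiDim X = a := by
  obtain ⟨⟨J, _, F, hF, hX⟩, G, w, U, hG, hU, hGU, hfin⟩ := h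
  have h1 := zariskiDim_le hF hX
  have h2 := le_zariskiDim hG hU hGU hfin
  rw [Nat.card_fin] at h1 h2
  exact le_antisymm h1 h2

theorem HasDim.image_equiv [FiniteDimensional ℂ W] {X : Set W} {a : ℕ} (h : HasDim X a)
    (e : W ≃ₗ[ℂ] W') : HasDim (e '' X) a := by
  obtain ⟨⟨J, hJ, F, hF, hX⟩, G, w, U, hG, hU, hGU, hfin⟩ := h
  refine ⟨⟨J, hJ, fun j v => e (F j v), fun j => (hF j).linear e.toLinearMap, ?_⟩,
    fun v => e (G v), w, U, hG.linear e.toLinearMap, hU, fun v hv => ⟨_, hGU hv, rfl⟩, ?_⟩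
  · rintro _ ⟨x, hx, rfl⟩
    obtain ⟨j, v, rfl⟩ := mem_iUnion.1 (hX hx)
    exact mem_iUnion.2 ⟨j, v, rfl⟩
  · simpa using hfin

/-- A polynomial parametrization of `Z` near `z` by affine `a`-space. -/
def LocalParamAt (Z : Set W) (z : W) (a : ℕ) : Prop :=
  ∃ (F : (Fin a → ℂ) → W) (w : Fin a → ℂ), IsPolyMap F ∧ F w = z ∧
    (∃ U ∈ zn w, InjOn F U ∧ MapsTo F U Z) ∧ ∃ O ∈ zn z, Z ∩ O ⊆ range F

theorem LocalParamAt.of_param [FiniteDimensional ℂ V] {Z : Set W} {z : W} {a : ℕ}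
    (ha : Module.finrank ℂ V = a) (F : V → W) (v : V) (hF : IsPolyMap F) (hv : F v = z) {U : Set V}
    (hU : U ∈ zn v) (hinj : InjOn F U) (hZ : MapsTo F U Z) {O : Set W} (hO : O ∈ zn z)
    (hOZ : Z ∩ O ⊆ range F) : LocalParamAt Z z a := by
  subst ha
  let e := (Module.finBasis ℂ V).equivFun
  have he : IsPolyMap fun w => e.symm w := IsPolyMap.linearMap e.symm.toLinearMap
  refine ⟨fun w => F (e.symm w), e v, hF.comp he, by simp [hv], ⟨e.symm ⁻¹' U, ?_, ?_, ?_⟩,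
    O, hO, ?_⟩
  · have := he.tendsto (e v)
    rw [LinearEquiv.symm_apply_apply] at this
    exact this hU
  · exact fun x hx y hy hxy => e.symm.injective (hinj hx hy hxy)
  · exact fun x hx => hZ hx
  · intro x hx
    obtain ⟨y, rfl⟩ := hOZ hx
    exact ⟨e y, by simp⟩

theorem LocalParamAt.univ [FiniteDimensional ℂ W] {Z : Set W} (hZ : ∀ z, z ∈ Z) (z : W) :
    LocalParamAt Z z (Module.finrank ℂ W) :=
  LocalParamAt.of_param rfl (fun v => v) z IsPolyMap.id rfl (Filter.univ_mem)
    (fun _ _ _ _ h => h) (fun v _ => hZ v) Filter.univ_mem (fun x _ => ⟨x, rfl⟩)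

theorem LocalParamAt.equiv [FiniteDimensional ℂ W] {Z : Set W} {z : W} {a : ℕ}
    (h : LocalParamAt Z z a) (e : W' ≃ₗ[ℂ] W) {Z' : Set W'} {z' : W'}
    (hZ : ∀ x, x ∈ Z' ↔ e x ∈ Z) (hz : e z' = z) :
    LocalParamAt Z' z' a := by
  have : FiniteDimensional ℂ W' := e.symm.finiteDimensional
  obtain ⟨F, w, hF, hw, ⟨U, hU, hinj, hUZ⟩, O, hO, hOZ⟩ := h
  refine ⟨fun v => e.symm (F v), w, hF.linear e.symm.toLinearMap, ?_, ⟨U, hU, ?_, ?_⟩,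
    e ⁻¹' O, ?_, ?_⟩
  · change e.symm (F w) = z'
    rw [hw, ← hz, e.symm_apply_apply]
  · exact fun x hx y hy hxy => hinj hx hy (e.symm.injective hxy)
  · intro x hx
    rw [hZ, e.apply_symm_apply]; exact hUZ hx
  · have := (IsPolyMap.linearMap e.toLinearMap).tendsto z'
    simp only [LinearEquiv.coe_coe, hz] at this
    exact this hO
  · rintro x ⟨hx, hxO⟩
    obtain ⟨v, hv⟩ := hOZ ⟨(hZ x).1 hx, hxO⟩
    exact ⟨v, by simp [hv]⟩

theorem LocalParamAt.prod_free [FiniteDimensional ℂ V] [FiniteDimensional ℂ W] {Z : Set W}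
    {z : W} {a : ℕ} (h : LocalParamAt Z z a) (v : V) :
    LocalParamAt {p : V × W | p.2 ∈ Z} (v, z) (Module.finrank ℂ V + a) := by
  obtain ⟨F, w, hF, hw, ⟨U, hU, hinj, hUZ⟩, O, hO, hOZ⟩ := h
  have hF' : IsPolyMap fun p : V × (Fin a → ℂ) => (p.1, F p.2) := by fun_prop
  refine LocalParamAt.of_param (V := V × (Fin a → ℂ)) (by simp) (fun p => (p.1, F p.2)) (v, w)
    hF' (by simp [hw]) (U := {p | p.2 ∈ U}) ?_ ?_ ?_ (O := {p | p.2 ∈ O}) ?_ ?_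
  · exact (show IsPolyMap fun p : V × (Fin a → ℂ) => p.2 by fun_prop).tendsto (v, w) hU
  · rintro ⟨a, x⟩ hx ⟨b, y⟩ hy hxy
    simp only [Prod.mk.injEq] at hxy ⊢
    exact ⟨hxy.1, hinj hx hy hxy.2⟩
  · exact fun x hx => hUZ hx
  · exact (show IsPolyMap fun p : V × W => p.2 by fun_prop).tendsto (v, z) hO
  · rintro ⟨b, x⟩ hx
    obtain ⟨y, rfl⟩ := hOZ hx
    exact ⟨(b, y), rfl⟩

/-- The solutions of a polynomial family of surjective systems of linear equations. -/
theorem LocalParamAt.linear_system {Θ Q E : Type} [AddCommGroup Θ] [Module ℂ Θ] [AddCommGroup Q]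
    [Module ℂ Q] [AddCommGroup E] [Module ℂ E] [FiniteDimensional ℂ Θ] [FiniteDimensional ℂ Q]
    [FiniteDimensional ℂ E] {A : Θ → Q →ₗ[ℂ] E} (hA : IsPolyMap A) {θ : Θ} {q : Q}
    (hsurj : Function.Surjective (A θ)) (hq : A θ q = 0) {a : ℕ}
    (ha : a + Module.finrank ℂ E = Module.finrank ℂ Θ + Module.finrank ℂ Q) :
    LocalParamAt {p : Θ × Q | A p.1 p.2 = 0} (θ, q) a := by
  -- The right inverse is fixed at the base point. The endomorphism `D η = A η ∘ S` is the identity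
  -- at `θ` and stays invertible nearby.
  obtain ⟨S, hS⟩ := (A θ).exists_rightInverse_of_surjective (LinearMap.range_eq_top.2 hsurj)
  obtain ⟨adj, hadj, hdet, hmul⟩ := exists_adjugate E
  let K := LinearMap.ker (A θ)
  have hrank : Module.finrank ℂ E + Module.finrank ℂ K = Module.finrank ℂ Q := by
    rw [← (A θ).finrank_range_add_finrank_ker, LinearMap.range_eq_top.2 hsurj, finrank_top]
  have hS' : ∀ y, A θ (S y) = y := LinearMap.congr_fun hS
  let D : Θ → Module.End ℂ E := fun η => A η ∘ₗ S
  have hD : IsPolyMap D := IsPolyMap.linearMap_comp hA (IsPolyMap.const S)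
  have hdetD : IsPolyMap fun η => LinearMap.det (D η) := hdet.comp hD
  have hadjD : IsPolyMap fun η => adj (D η) := hadj.comp hD
  have hDθ : D θ = 1 := hS
  have hmul1 : ∀ η y, A η (S (adj (D η) y)) = LinearMap.det (D η) • y := fun η y =>
    LinearMap.congr_fun (hmul (D η)).1 y
  have hmul2 : ∀ η y, adj (D η) (A η (S y)) = LinearMap.det (D η) • y := fun η y =>
    LinearMap.congr_fun (hmul (D η)).2 y
  -- A kernel vector of `A θ` is corrected to one of `A η`. Multiplication by the determinant clears
  -- denominators: `F` is polynomial and solves the system for every `η`, even where the determinant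
  -- vanishes.
  let F : Θ × K → Θ × Q := fun p =>
    (p.1, LinearMap.det (D p.1) • (p.2 : Q) - S (adj (D p.1) (A p.1 (p.2 : Q))))
  have h1 : IsPolyMap fun p : Θ × K => ((p.2 : K) : Q) :=
    IsPolyMap.linear K.subtype (by fun_prop)
  have h2 : IsPolyMap fun p : Θ × K => p.1 := by fun_prop
  have hF : IsPolyMap F := by
    refine IsPolyMap.prodMk (by fun_prop) ?_
    refine ((hdetD.comp h2).smul h1).sub (IsPolyMap.linear S ?_)
    exact (hadjD.comp h2).linearMap_apply ((hA.comp h2).linearMap_apply h1)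
  have hdetθ : LinearMap.det (D θ) ≠ 0 := by rw [hDθ]; simp
  have hO : ∀ᶠ η in zn θ, LinearMap.det (D η) ≠ 0 := eventually_ne_zero hdetD hdetθ
  refine LocalParamAt.of_param (V := Θ × K) (by simp; omega) F (θ, ⟨q, hq⟩) hF ?_
    (U := {p | LinearMap.det (D p.1) ≠ 0}) (h2.tendsto (θ, ⟨q, hq⟩) hO) ?_ ?_
    (O := {p | LinearMap.det (D p.1) ≠ 0})
    ((show IsPolyMap fun p : Θ × Q => p.1 by fun_prop).tendsto (θ, q) hO) ?_
  · simp [F, hDθ, hq]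
  · rintro ⟨η, x⟩ hx ⟨η', y⟩ - hxy
    simp only [F, Prod.mk.injEq] at hxy
    obtain ⟨rfl, hxy⟩ := hxy
    -- The projection `q ↦ q - S (A θ q)` onto `K` kills the correction term and recovers the
    -- determinant times `x`.
    have key : ∀ x : K, ∀ y : E, (LinearMap.det (D η) • (x : Q) - S y)
        - S (A θ (LinearMap.det (D η) • (x : Q) - S y)) = LinearMap.det (D η) • (x : Q) := by
      intro x y
      have hx : A θ x = 0 := x.2
      simp [hx, hS']
    have h3 := key x (adj (D η) (A η x))
    rw [hxy, key] at h3
    have h4 := smul_right_injective Q hx h3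
    exact Prod.ext rfl (Subtype.ext h4.symm)
  · rintro ⟨η, x⟩ -
    simp only [F, mem_ofPred_eq, map_sub, map_smul, hmul1, sub_self]
  · rintro ⟨η, x⟩ ⟨hx, hη⟩
    simp only [mem_ofPred_eq] at hx hη
    -- The same projection, divided by the determinant, yields the parameter of a given solution.
    have hmem : (LinearMap.det (D η))⁻¹ • (x - S (A θ x)) ∈ K := by
      simp [K, LinearMap.mem_ker, hS']
    refine ⟨(η, ⟨_, hmem⟩), ?_⟩
    simp only [F, Prod.mk.injEq, true_and]
    simp only [map_smul, map_sub, hx, zero_sub, smul_neg, map_neg, hmul2]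
    rw [smul_smul, smul_smul, mul_inv_cancel₀ hη, inv_mul_cancel₀ hη]
    simp

/-- Quasi-compactness from Noetherianity: finitely many of the polynomials defining the
neighbourhoods generate the ideal of all of them, so they have no common zero in `S`. -/
theorem exists_finite_subcover [FiniteDimensional ℂ W] (S : Set W) (O : W → Set W)
    (hO : ∀ z ∈ S, O z ∈ zn z) : ∃ t : Finset W, ↑t ⊆ S ∧ S ⊆ ⋃ z ∈ t, O z := by
  classical
  let e := (Module.finBasis ℂ W).equivFun
  have he : IsPolyMap fun w => e.symm w := IsPolyMap.linearMap e.symm.toLinearMap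
  have : ∀ z, ∃ p : MvPolynomial (Fin (Module.finrank ℂ W)) ℂ, z ∈ S →
      MvPolynomial.eval (e z) p ≠ 0 ∧ ∀ w, MvPolynomial.eval (e w) p ≠ 0 → w ∈ O z := by
    intro z
    by_cases hz : z ∈ S
    · obtain ⟨f, hf, hfz, hfO⟩ := hO z hz
      obtain ⟨p, hp⟩ := exists_mvPolynomial (hf.comp he)
      refine ⟨p, fun _ => ⟨?_, fun w hw => hfO w ?_⟩⟩
      · rw [← hp]; simpa using hfz
      · rw [← hp] at hw; simpa using hw
    · exact ⟨0, fun h => absurd h hz⟩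
  choose p hp using this
  have hfg : (Submodule.span (MvPolynomial (Fin (Module.finrank ℂ W)) ℂ) (p '' S)).FG :=
    IsNoetherian.noetherian _
  obtain ⟨t, ht, hspan⟩ := (Submodule.fg_span_iff_fg_span_finset_subset _).1 hfg
  obtain ⟨t', ht', rfl⟩ := Finset.subset_set_image_iff.1 ht
  refine ⟨t', ht', fun z hz => ?_⟩
  by_contra hcon
  simp only [mem_iUnion, not_exists] at hcon
  have hzero : ∀ y ∈ t', MvPolynomial.eval (e z) (p y) = 0 := fun y hy => by
    by_contra hne
    exact hcon y hy ((hp y (ht' hy)).2 z hne)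
  have hle : Ideal.span (p '' S) ≤ RingHom.ker (MvPolynomial.eval (e z)) := by
    change Submodule.span _ _ ≤ _
    rw [hspan, Submodule.span_le]
    intro x hx
    simp only [Finset.coe_image, mem_image, Finset.mem_coe] at hx
    obtain ⟨y, hy, rfl⟩ := hx
    exact hzero y hy
  exact (hp z hz).1 (hle (Ideal.subset_span ⟨z, hz, rfl⟩))

/-- The dimension of a set which is covered by finite-to-one polynomial images of sets with local
parametrizations. -/
theorem HasDim.of_charts [FiniteDimensional ℂ W] {J : Type} [Finite J] {Z : J → Set W}
    {π : J → W → W'} (hπ : ∀ j, IsPolyMap (π j)) {X : Set W'} {a : ℕ}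
    (hcov : ∀ x ∈ X, ∃ j, ∃ z ∈ Z j, LocalParamAt (Z j) z a ∧ π j z = x)
    (hlow : ∃ j, ∃ z, LocalParamAt (Z j) z a ∧ (∀ᶠ y in zn z, y ∈ Z j → π j y ∈ X) ∧
      {y ∈ Z j | π j y = π j z}.Finite) :
    HasDim X a := by
  classical
  constructor
  · have hex : ∀ j z, ∃ (F : (Fin a → ℂ) → W) (O : Set W), IsPolyMap F ∧
        (LocalParamAt (Z j) z a → O ∈ zn z ∧ Z j ∩ O ⊆ range F) := by
      intro j z
      by_cases h : LocalParamAt (Z j) z a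
      · obtain ⟨F, w, hF, -, -, O, hO, hOZ⟩ := h
        exact ⟨F, O, hF, fun _ => ⟨hO, hOZ⟩⟩
      · exact ⟨fun _ => 0, ∅, IsPolyMap.const 0, fun h' => absurd h' h⟩
    choose F O hF hFO using hex
    choose t ht1 ht2 using fun j => exists_finite_subcover {z ∈ Z j | LocalParamAt (Z j) z a} (O j)
      (fun z hz => (hFO j z hz.2).1)
    refine ⟨Σ j, t j, inferInstance, fun p v => π p.1 (F p.1 p.2 v),
      fun p => (hπ _).comp (hF _ _), fun x hx => ?_⟩
    obtain ⟨j, z, hz, hlz, rfl⟩ := hcov x hx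
    obtain ⟨y, hy, hzy⟩ := mem_iUnion₂.1 (ht2 j ⟨hz, hlz⟩)
    obtain ⟨v, rfl⟩ := (hFO j y (ht1 j hy).2).2 ⟨hz, hzy⟩
    exact mem_iUnion.2 ⟨⟨j, y, hy⟩, v, rfl⟩
  · obtain ⟨j, z, ⟨F, w, hF, hw, ⟨U, hU, hinj, hUZ⟩, -⟩, hX, hfin⟩ := hlow
    have hX' := (hF.tendsto w).eventually (hw ▸ hX)
    refine ⟨fun v => π j (F v), w, U ∩ {v | F v ∈ Z j → π j (F v) ∈ X}, (hπ j).comp hF,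
      Filter.inter_mem hU hX', fun v hv => hv.2 (hUZ hv.1), ?_⟩
    -- Lower bound: `F` is injective on `U`, so a fibre of `π j ∘ F` is finite as soon as its image
    -- in `Z j` is.
    refine Finite.of_finite_image (f := F) (hfin.subset ?_) (hinj.mono fun v hv => hv.1.1)
    rintro _ ⟨v, ⟨⟨hvU, -⟩, hv⟩, rfl⟩
    exact ⟨hUZ hvU, (show π j (F v) = π j (F w) from hv).trans (by rw [hw])⟩

end Scroll

namespace Scroll

/-! ## Binary forms -/

section Forms

open MvPolynomial

/-- `p` is zero or a binary form of degree `n - 1`; it is zero if `n = 0`. -/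
def IsForm (n : ℕ) (p : MvPolynomial (Fin 2) ℂ) : Prop :=
  ∀ d, coeff d p ≠ 0 → d 0 + d 1 + 1 = n

theorem degree_fin_two (d : Fin 2 →₀ ℕ) : d.degree = d 0 + d 1 := by
  rw [Finsupp.degree_eq_sum]; simp

theorem weight_one_fin_two (d : Fin 2 →₀ ℕ) : Finsupp.weight (1 : Fin 2 → ℕ) d = d 0 + d 1 := by
  rw [← degree_fin_two, Finsupp.degree_eq_weight_one]; rfl

theorem isForm_succ {n : ℕ} {p : MvPolynomial (Fin 2) ℂ} :
    IsForm (n + 1) p ↔ p.IsHomogeneous n := by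
  constructor
  · intro h d hd
    have := h d hd
    rw [weight_one_fin_two]; omega
  · intro h d hd
    have := h hd
    rw [weight_one_fin_two] at this; omega

theorem IsForm.eq_zero {p : MvPolynomial (Fin 2) ℂ} (h : IsForm 0 p) : p = 0 := by
  ext d
  by_contra hd
  exact absurd (h d hd) (by omega)

theorem IsForm.zero (n : ℕ) : IsForm n 0 := fun d hd => absurd (coeff_zero d) hd

theorem IsForm.pos {n : ℕ} {p : MvPolynomial (Fin 2) ℂ} (h : IsForm n p) (hp : p ≠ 0) : 0 < n := by
  rcases Nat.eq_zero_or_pos n with rfl | hn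
  · exact absurd h.eq_zero hp
  · exact hn

theorem IsForm.isHomogeneous {n : ℕ} {p : MvPolynomial (Fin 2) ℂ} (h : IsForm n p) :
    p.IsHomogeneous (n - 1) := by
  cases n with
  | zero => rw [h.eq_zero]; exact isHomogeneous_zero _ _ _
  | succ n => exact isForm_succ.1 h

theorem IsForm.of_isHomogeneous {n : ℕ} {p : MvPolynomial (Fin 2) ℂ} (h : p.IsHomogeneous n) :
    IsForm (n + 1) p := isForm_succ.2 h

theorem IsForm.add {n : ℕ} {p q : MvPolynomial (Fin 2) ℂ} (hp : IsForm n p) (hq : IsForm n q) :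
    IsForm n (p + q) := by
  intro d hd
  by_cases h : coeff d p = 0
  · exact hq d (by simpa [h] using hd)
  · exact hp d h

theorem IsForm.neg {n : ℕ} {p : MvPolynomial (Fin 2) ℂ} (hp : IsForm n p) : IsForm n (-p) :=
  fun d hd => hp d (by simpa using hd)

theorem IsForm.sub {n : ℕ} {p q : MvPolynomial (Fin 2) ℂ} (hp : IsForm n p) (hq : IsForm n q) :
    IsForm n (p - q) := by
  rw [sub_eq_add_neg]; exact hp.add hq.neg

theorem IsForm.sum {ι : Type*} {s : Finset ι} {n : ℕ} {p : ι → MvPolynomial (Fin 2) ℂ}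
    (hp : ∀ i, IsForm n (p i)) : IsForm n (∑ i ∈ s, p i) := by
  classical
  induction s using Finset.induction_on with
  | empty => simpa using IsForm.zero n
  | insert a s ha ih => rw [Finset.sum_insert ha]; exact (hp a).add ih

/-- The sizes need to match only when both factors are nonzero; a factor of negative degree is zero,
so truncated degrees cause no separate case. -/
theorem IsForm.mul_of_le {a b c : ℕ} {p q : MvPolynomial (Fin 2) ℂ} (hp : IsForm a p)
    (hq : IsForm b q) (h : p ≠ 0 → q ≠ 0 → c + 1 = a + b) : IsForm c (p * q) := by
  by_cases hp0 : p = 0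
  · simpa [hp0] using IsForm.zero c
  by_cases hq0 : q = 0
  · simpa [hq0] using IsForm.zero c
  have h := h hp0 hq0
  have h1 := hp.pos hp0
  have h2 := hq.pos hq0
  obtain ⟨c, rfl⟩ : ∃ c', c = c' + 1 := ⟨c - 1, by omega⟩
  rw [isForm_succ]
  convert hp.isHomogeneous.mul hq.isHomogeneous using 1
  omega

theorem IsForm.C_mul {n : ℕ} {p : MvPolynomial (Fin 2) ℂ} (hp : IsForm n p) (c : ℂ) :
    IsForm n (C c * p) :=
  (IsForm.of_isHomogeneous (isHomogeneous_C _ c)).mul_of_le hp (fun _ _ => by omega)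

/-- A factor of a binary form is a binary form. -/
theorem IsForm.of_mul {a n : ℕ} {p q : MvPolynomial (Fin 2) ℂ} (hp : p.IsHomogeneous a)
    (hp0 : p ≠ 0) (h : IsForm n (p * q)) : IsForm (n - a) q := by
  by_cases hq0 : q = 0
  · rw [hq0]; exact IsForm.zero _
  -- Multiplication by the homogeneous `p` shifts homogeneous components, so only one component of
  -- `q` can survive.
  have hcomp : ∀ j, homogeneousComponent (a + j) (p * q) = p * homogeneousComponent j q := by
    intro j
    let _ := MvPolynomial.gradedAlgebra (σ := Fin 2) (R := ℂ)
    have h := DirectSum.coe_decompose_mul_add_of_left_mem (homogeneousSubmodule (Fin 2) ℂ)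
      (i := a) (j := j) (a := p) (b := q) hp
    exact (decomposition.decompose'_apply (p * q) (a + j)).symm.trans
      (h.trans (congrArg (p * ·) (decomposition.decompose'_apply q j)))
  have hz : ∀ j, j + a + 1 ≠ n → homogeneousComponent j q = 0 := by
    intro j hj
    have h1 : homogeneousComponent (a + j) (p * q) = 0 := by
      ext d
      rw [coeff_homogeneousComponent]
      split_ifs with hd
      · by_contra hne
        have := h d hne
        rw [degree_fin_two] at hd
        omega
      · simp
    rw [hcomp] at h1
    exact (mul_eq_zero.1 h1).resolve_left hp0
  intro d hd
  by_contra hcon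
  have h2 : coeff d (homogeneousComponent (d 0 + d 1) q) ≠ 0 := by
    rw [coeff_homogeneousComponent, if_pos (degree_fin_two d)]; exact hd
  exact h2 (by rw [hz _ (by omega), coeff_zero])

theorem form_isForm {n : ℕ} (c : Fin n → ℂ) : IsForm n (form c) := by
  refine IsForm.sum fun i => ?_
  obtain ⟨m, rfl⟩ : ∃ m, n = m + 1 := ⟨n - 1, by have := i.2; omega⟩
  rw [isForm_succ]
  have h := ((isHomogeneous_C (Fin 2) (c i)).mul (isHomogeneous_X_pow (0 : Fin 2) (i : ℕ))).mul
    (isHomogeneous_X_pow (R := ℂ) (1 : Fin 2) (m + 1 - 1 - (i : ℕ)))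
  convert h using 1
  have := i.2
  omega

/-- The linear map which sends coefficients to binary forms. -/
noncomputable def formL (n : ℕ) : (Fin n → ℂ) →ₗ[ℂ] MvPolynomial (Fin 2) ℂ where
  toFun := form
  map_add' c d := by simp [form, add_mul, Finset.sum_add_distrib]
  map_smul' r c := by simp [form, Finset.smul_sum, smul_eq_C_mul, mul_assoc]

@[simp] theorem formL_apply {n : ℕ} (c : Fin n → ℂ) : formL n c = form c := rfl

/-- The exponent of the `i`-th monomial in binary forms of degree `n - 1`. -/
noncomputable def expo (n : ℕ) (i : ℕ) : Fin 2 →₀ ℕ :=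
  Finsupp.single 0 i + Finsupp.single 1 (n - 1 - i)

/-- The coefficients of a binary form of degree `n - 1`. -/
noncomputable def vecL (n : ℕ) : MvPolynomial (Fin 2) ℂ →ₗ[ℂ] (Fin n → ℂ) where
  toFun p i := coeff (expo n i) p
  map_add' p q := by ext; simp
  map_smul' r p := by ext; simp

theorem coeff_form {n : ℕ} (c : Fin n → ℂ) (i : Fin n) : coeff (expo n i) (form c) = c i := by
  classical
  rw [form, coeff_sum, Finset.sum_eq_single i]
  · have : C (c i) * X 0 ^ (i : ℕ) * X 1 ^ (n - 1 - (i : ℕ))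
        = monomial (expo n i) (c i) := by
      rw [expo, X_pow_eq_monomial, X_pow_eq_monomial, C_mul_monomial, monomial_mul]; simp
    rw [this, coeff_monomial, if_pos rfl]
  · intro j _ hj
    have : C (c j) * X 0 ^ (j : ℕ) * X 1 ^ (n - 1 - (j : ℕ))
        = monomial (expo n j) (c j) := by
      rw [expo, X_pow_eq_monomial, X_pow_eq_monomial, C_mul_monomial, monomial_mul]; simp
    rw [this, coeff_monomial, if_neg]
    intro h
    apply hj
    have := DFunLike.congr_fun h 0
    simp [expo] at this
    exact Fin.ext this
  · simp

@[simp] theorem vecL_form {n : ℕ} (c : Fin n → ℂ) : vecL n (form c) = c := by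
  ext i; exact coeff_form c i

theorem form_injective {n : ℕ} : Function.Injective (form : (Fin n → ℂ) → _) :=
  Function.LeftInverse.injective (g := vecL n) vecL_form

theorem IsForm.form_vecL {n : ℕ} {p : MvPolynomial (Fin 2) ℂ} (hp : IsForm n p) :
    form (vecL n p) = p := by
  by_contra hne
  obtain ⟨d, hd⟩ := ne_zero_iff.1 (sub_ne_zero.2 hne)
  have h1 := ((form_isForm (vecL n p)).sub hp) d hd
  have h2 : d = expo n (⟨d 0, by omega⟩ : Fin n) := by
    ext i
    fin_cases i
    · simp [expo]
    · simp [expo]; omega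
  rw [coeff_sub] at hd
  apply hd
  rw [h2, coeff_form]
  simp [vecL]

theorem form_eq_zero_iff {n : ℕ} {c : Fin n → ℂ} : form c = 0 ↔ c = 0 := by
  rw [← formL_apply, map_eq_zero_iff _ form_injective]

theorem isPolyMap_form {V : Type*} [AddCommGroup V] [Module ℂ V] {n : ℕ} {c : V → Fin n → ℂ}
    (hc : IsPolyMap c) : IsPolyMap fun v => form (c v) := hc.linear (formL n)

/-! ### Linear factors -/

theorem IsForm.aeval_smul {n : ℕ} {p : MvPolynomial (Fin 2) ℂ} (hp : p.IsHomogeneous n)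
    {A : Type*} [CommRing A] [Algebra ℂ A] (r : A) (s : Fin 2 → A) :
    aeval (fun i => r * s i) p = r ^ n * aeval s p := by
  rw [aeval_def, aeval_def, eval₂_eq', eval₂_eq', Finset.mul_sum]
  refine Finset.sum_congr rfl fun d hd => ?_
  have := hp (mem_support_iff.1 hd)
  rw [weight_one_fin_two] at this
  simp only [Fin.prod_univ_two, mul_pow, ← this]
  ring

theorem eval_smul_of_isHomogeneous {n : ℕ} {p : MvPolynomial (Fin 2) ℂ} (hp : p.IsHomogeneous n)
    (r : ℂ) (t : Fin 2 → ℂ) : eval (r • t) p = r ^ n * eval t p := by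
  have := IsForm.aeval_smul hp r t
  rw [aeval_eq_eval', aeval_eq_eval'] at this
  exact this

/-- The linear form with zero `v`. -/
noncomputable def lin (v : Fin 2 → ℂ) : MvPolynomial (Fin 2) ℂ := C (v 1) * X 0 - C (v 0) * X 1

theorem eval_lin (t v : Fin 2 → ℂ) : eval t (lin v) = v 1 * t 0 - v 0 * t 1 := by simp [lin]

theorem linearForm_eq_lin (q : Projectivization ℂ (Fin 2 → ℂ)) : linearForm q = lin q.rep := rfl

theorem lin_isHomogeneous (v : Fin 2 → ℂ) : (lin v).IsHomogeneous 1 := by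
  have h := fun (c : ℂ) (i : Fin 2) => (isHomogeneous_C (Fin 2) c).mul (isHomogeneous_X ℂ i)
  exact (h _ _).sub (h _ _)

theorem eval_lin_self (v : Fin 2 → ℂ) : eval v (lin v) = 0 := by rw [eval_lin]; ring

theorem coeff_lin_zero (v : Fin 2 → ℂ) : coeff (Finsupp.single 0 1) (lin v) = v 1 := by
  have : (Finsupp.single 1 1 : Fin 2 →₀ ℕ) ≠ Finsupp.single 0 1 := fun h => by
    simpa using DFunLike.congr_fun h 0
  simp [lin, coeff_C_mul, coeff_X, this]

theorem coeff_lin_one (v : Fin 2 → ℂ) : coeff (Finsupp.single 1 1) (lin v) = - v 0 := by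
  have : (Finsupp.single 0 1 : Fin 2 →₀ ℕ) ≠ Finsupp.single 1 1 := fun h => by
    simpa using DFunLike.congr_fun h 0
  simp [lin, coeff_C_mul, coeff_X, this]

theorem lin_ne_zero {v : Fin 2 → ℂ} (hv : v ≠ 0) : lin v ≠ 0 := by
  intro h
  apply hv
  have h0 := coeff_lin_zero v
  have h1 := coeff_lin_one v
  rw [h, coeff_zero] at h0 h1
  ext i
  fin_cases i
  · simpa using h1.symm
  · exact h0.symm

theorem lin_smul (c : ℂ) (v : Fin 2 → ℂ) : lin (c • v) = C c * lin v := by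
  simp [lin, mul_sub, mul_assoc]

theorem lin_prime {v : Fin 2 → ℂ} (hv : v ≠ 0) : Prime (lin v) := by
  refine Irreducible.prime (irreducible_of_totalDegree_eq_one
    ((lin_isHomogeneous v).totalDegree (lin_ne_zero hv)) fun x hx => ?_)
  rw [isUnit_iff_ne_zero]
  rintro rfl
  simp only [zero_dvd_iff] at hx
  exact lin_ne_zero hv (MvPolynomial.ext _ _ fun d => by simp [hx d])

/-- Modulo `lin v` the variables are proportional to `v`: `c * X i = r * v i`, with `c` a nonzero
coordinate of `v`. Homogeneity turns this into `cⁿ p = rⁿ p(v)`, and `c` is invertible. -/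
theorem lin_dvd_iff {n : ℕ} {p : MvPolynomial (Fin 2) ℂ} (hp : p.IsHomogeneous n)
    {v : Fin 2 → ℂ} (hv : v ≠ 0) : lin v ∣ p ↔ eval v p = 0 := by
  constructor
  · rintro ⟨q, rfl⟩; rw [map_mul, eval_lin_self, zero_mul]
  intro h
  rw [← Ideal.mem_span_singleton, ← Ideal.Quotient.eq_zero_iff_mem]
  set I := Ideal.span {lin v}
  have hmk : ∀ q : MvPolynomial (Fin 2) ℂ, Ideal.Quotient.mk I q
      = aeval (fun i => Ideal.Quotient.mk I (X i)) q := by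
    intro q
    have : (Ideal.Quotient.mkₐ ℂ I) = aeval (fun i => Ideal.Quotient.mk I (X i)) := by
      ext i; simp
    exact DFunLike.congr_fun this q
  have hrel : Ideal.Quotient.mk I (C (v 1)) * Ideal.Quotient.mk I (X 0)
      = Ideal.Quotient.mk I (C (v 0)) * Ideal.Quotient.mk I (X 1) := by
    rw [← map_mul, ← map_mul, Ideal.Quotient.eq]
    exact Ideal.mem_span_singleton_self _
  have hev : ∀ v : Fin 2 → ℂ, aeval (fun i => algebraMap ℂ (MvPolynomial (Fin 2) ℂ ⧸ I) (v i)) p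
      = algebraMap ℂ _ (eval v p) := by
    intro v
    rw [← aeval_eq_eval', ← aeval_algebraMap_apply]
    rfl
  have hC : ∀ c : ℂ, Ideal.Quotient.mk I (C c) = algebraMap ℂ (MvPolynomial (Fin 2) ℂ ⧸ I) c :=
    fun c => rfl
  have key : ∀ (r : MvPolynomial (Fin 2) ℂ ⧸ I) (c : ℂ), c ≠ 0 →
      (∀ i, algebraMap ℂ _ c * Ideal.Quotient.mk I (X i) = r * algebraMap ℂ _ (v i)) →
      Ideal.Quotient.mk I p = 0 := by
    intro r c hc hi
    have h1 := IsForm.aeval_smul hp (algebraMap ℂ (MvPolynomial (Fin 2) ℂ ⧸ I) c)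
      (fun i => Ideal.Quotient.mk I (X i))
    simp only [hi] at h1
    rw [IsForm.aeval_smul hp, hev, h, map_zero, mul_zero, ← hmk, ← map_pow] at h1
    have h2 := congrArg (fun z => algebraMap ℂ (MvPolynomial (Fin 2) ℂ ⧸ I) (c ^ n)⁻¹ * z) h1
    simp only [mul_zero] at h2
    rw [← mul_assoc, ← map_mul, inv_mul_cancel₀ (pow_ne_zero n hc), map_one, one_mul] at h2
    exact h2.symm
  by_cases h1 : v 1 = 0
  · have h0 : v 0 ≠ 0 := by
      intro h0; apply hv; ext i; fin_cases i <;> simp [h0, h1]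
    refine key (Ideal.Quotient.mk I (X 0)) (v 0) h0 fun i => ?_
    fin_cases i
    · simp [mul_comm]
    · simp only [hC] at hrel
      simp only [Fin.mk_one, ← hrel]; ring
  · refine key (Ideal.Quotient.mk I (X 1)) (v 1) h1 fun i => ?_
    fin_cases i
    · simp only [hC] at hrel
      simp only [Fin.zero_eta, hrel]; ring
    · simp [mul_comm]

/-- Either the point at infinity `(1, 0)` is a zero, or the dehomogenized polynomial has nonzero
coefficient in degree `n + 1` and so has a root. -/
theorem exists_zero_of_isHomogeneous {n : ℕ} {p : MvPolynomial (Fin 2) ℂ}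
    (hp : p.IsHomogeneous (n + 1)) : ∃ v : Fin 2 → ℂ, v ≠ 0 ∧ eval v p = 0 := by
  by_cases h : eval ![1, 0] p = 0
  · exact ⟨![1, 0], by simp, h⟩
  obtain ⟨c, rfl⟩ : ∃ c : Fin (n + 2) → ℂ, form c = p := ⟨_, (isForm_succ.2 hp).form_vecL⟩
  let f : Polynomial ℂ := ∑ i : Fin (n + 2), Polynomial.C (c i) * Polynomial.X ^ (i : ℕ)
  have hlast : eval ![1, 0] (form c) = c (Fin.last (n + 1)) := by
    simp only [form, map_sum, map_mul, map_pow, eval_C, eval_X]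
    rw [Finset.sum_eq_single (Fin.last (n + 1))]
    · simp
    · intro i _ hi
      have : n + 2 - 1 - (i : ℕ) ≠ 0 := by
        have := i.2
        have h3 : (i : ℕ) ≠ n + 1 := fun h => hi (Fin.ext h)
        omega
      simp only [Matrix.cons_val_one, Matrix.cons_val_zero, zero_pow this, mul_zero]
    · simp
  have hcoeff : f.coeff (n + 1) = c (Fin.last (n + 1)) := by
    simp only [f, Polynomial.finsetSum_coeff, Polynomial.coeff_C_mul, Polynomial.coeff_X_pow]
    rw [Finset.sum_eq_single (Fin.last (n + 1))]
    · simp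
    · intro i _ hi
      have h3 : n + 1 ≠ (i : ℕ) := fun h => hi (Fin.ext h.symm)
      simp [h3]
    · simp
  have hdeg : f.degree ≠ 0 := by
    intro h0
    have : f.natDegree < n + 1 := by
      rw [Polynomial.natDegree_eq_of_degree_eq_some (n := 0) h0]; omega
    rw [hlast, ← hcoeff] at h
    exact h (Polynomial.coeff_eq_zero_of_natDegree_lt this)
  obtain ⟨s, hs⟩ := IsAlgClosed.exists_root f hdeg
  refine ⟨![s, 1], by simp, ?_⟩
  simp only [Polynomial.IsRoot, f, Polynomial.eval_finsetSum, Polynomial.eval_mul,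
    Polynomial.eval_C, Polynomial.eval_pow, Polynomial.eval_X] at hs
  simpa [form] using hs

/-- Induction on binary forms via linear factors. -/
theorem isHomogeneous_induction {P : MvPolynomial (Fin 2) ℂ → Prop}
    (hC : ∀ c : ℂ, c ≠ 0 → P (C c))
    (hlin : ∀ v p, v ≠ 0 → p ≠ 0 → P p → P (lin v * p)) {n : ℕ} {p : MvPolynomial (Fin 2) ℂ}
    (hp : p.IsHomogeneous n) (hp0 : p ≠ 0) : P p := by
  induction n generalizing p with
  | zero =>
    have := (totalDegree_eq_zero_iff_eq_C (p := p)).1 (Nat.le_zero.1 hp.totalDegree_le)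
    rw [this] at hp0 ⊢
    exact hC _ (fun h => hp0 (by rw [h, C_0]))
  | succ n ih =>
    obtain ⟨v, hv, h⟩ := exists_zero_of_isHomogeneous hp
    obtain ⟨q, rfl⟩ := (lin_dvd_iff hp hv).2 h
    have hq0 := right_ne_zero_of_mul hp0
    have hq := IsForm.of_mul (lin_isHomogeneous v) (lin_ne_zero hv) (isForm_succ.2 hp)
    exact hlin v q hv hq0 (ih (isForm_succ.1 hq) hq0)

/-- Linear factors of `p` are split off one by one; each is prime and cannot divide `q`, which is
nonzero at the point where the factor vanishes. -/
theorem isRelPrime_of_no_common_zero {n : ℕ} {p q : MvPolynomial (Fin 2) ℂ}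
    (hp : p.IsHomogeneous n) (hp0 : p ≠ 0)
    (h : ∀ t : Fin 2 → ℂ, t ≠ 0 → eval t p ≠ 0 ∨ eval t q ≠ 0) : IsRelPrime p q := by
  revert h
  refine isHomogeneous_induction (P := fun p => (∀ t : Fin 2 → ℂ, t ≠ 0 → eval t p ≠ 0 ∨
    eval t q ≠ 0) → IsRelPrime p q) ?_ ?_ hp hp0
  · intro c hc _
    exact IsUnit.isRelPrime_left ((isUnit_iff_ne_zero.2 hc).map C)
  · intro v p hv _ ih h
    refine IsRelPrime.mul_left ?_ (ih fun t ht => ?_)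
    · refine ((lin_prime hv).irreducible.isRelPrime_iff_not_dvd).2 ?_
      rintro ⟨r, rfl⟩
      simpa [eval_lin_self] using h v hv
    · refine (h t ht).imp_left fun h' => ?_
      rw [map_mul] at h'
      exact right_ne_zero_of_mul h'

/-- Two vectors span different lines. -/
def Indep (v w : Fin 2 → ℂ) : Prop := w 1 * v 0 - w 0 * v 1 ≠ 0

theorem Indep.isRelPrime {v w : Fin 2 → ℂ} (h : Indep v w) (hv : v ≠ 0) (a b : ℕ) :
    IsRelPrime (lin v ^ a) (lin w ^ b) := by
  refine IsRelPrime.pow_left (IsRelPrime.pow_right ?_)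
  refine ((lin_prime hv).irreducible.isRelPrime_iff_not_dvd).2 ?_
  rintro ⟨r, hr⟩
  have := congrArg (eval v) hr
  rw [map_mul, eval_lin_self, zero_mul, eval_lin] at this
  exact h this

/-- The two standard affine charts of the projective line. -/
def pt (σ : Bool) (s : ℂ) : Fin 2 → ℂ := if σ then ![s, 1] else ![1, s]

theorem pt_ne_zero (σ : Bool) (s : ℂ) : pt σ s ≠ 0 := by
  cases σ <;> simp [pt]

theorem exists_eq_smul_pt {v : Fin 2 → ℂ} (hv : v ≠ 0) :
    ∃ (σ : Bool) (s c : ℂ), c ≠ 0 ∧ v = c • pt σ s := by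
  by_cases h1 : v 1 = 0
  · have h0 : v 0 ≠ 0 := by
      intro h0; apply hv; ext i; fin_cases i <;> simp [h0, h1]
    refine ⟨false, 0, v 0, h0, ?_⟩
    ext i; fin_cases i <;> simp [pt, h1]
  · refine ⟨true, v 0 / v 1, v 1, h1, ?_⟩
    ext i; fin_cases i <;> simp [pt]; field_simp

@[fun_prop] theorem isPolyMap_pt (σ : Bool) : IsPolyMap (pt σ) := by
  refine IsPolyMap.pi fun i => ?_
  cases σ <;> fin_cases i <;> simp [pt] <;> fun_prop

theorem isPolyMap_lin {V : Type*} [AddCommGroup V] [Module ℂ V] {c : V → Fin 2 → ℂ}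
    (hc : IsPolyMap c) : IsPolyMap fun v => lin (c v) := by
  have h : ∀ v, lin (c v) = c v 1 • X 0 - c v 0 • X 1 := by
    intro v; simp [lin, smul_eq_C_mul]
  simp only [h]
  exact ((hc.apply 1).smul (.const _)).sub ((hc.apply 0).smul (.const _))

theorem finite_zeros {n : ℕ} {p : MvPolynomial (Fin 2) ℂ} (hp : p.IsHomogeneous n) (hp0 : p ≠ 0)
    (σ : Bool) : {s | eval (pt σ s) p = 0}.Finite := by
  refine isHomogeneous_induction (P := fun p => {s | eval (pt σ s) p = 0}.Finite) ?_ ?_ hp hp0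
  · intro c hc; simp [hc]
  · intro v p hv _ ih
    simp only [map_mul, mul_eq_zero]
    refine Set.Finite.union (Set.Subsingleton.finite ?_) ih
    intro s hs s' hs'
    replace hs : eval (pt σ s) (lin v) = 0 := hs
    replace hs' : eval (pt σ s') (lin v) = 0 := hs'
    rw [eval_lin] at hs hs'
    have hne : v 0 ≠ 0 ∨ v 1 ≠ 0 := by
      by_contra! h; apply hv; ext i; fin_cases i <;> simp [h]
    cases σ
    · simp [pt] at hs hs'
      rcases hne with h0 | h1
      · exact mul_left_cancel₀ h0 (by linear_combination hs' - hs)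
      · have : v 0 ≠ 0 := by rintro h; simp [h] at hs; exact h1 hs
        exact mul_left_cancel₀ this (by linear_combination hs' - hs)
    · simp [pt] at hs hs'
      rcases hne with h0 | h1
      · have : v 1 ≠ 0 := by rintro h; simp [h] at hs; exact h0 hs
        exact mul_left_cancel₀ this (by linear_combination hs - hs')
      · exact mul_left_cancel₀ h1 (by linear_combination hs - hs')

end Forms

end Scroll

namespace Scroll

/-! ## Sections of Hirzebruch surfaces -/

section Pairs

open MvPolynomial Module

/-- Pairs of binary forms, given by their coefficients. -/
abbrev Pair (a b : ℕ) : Type := (Fin a → ℂ) × (Fin b → ℂ)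

/-- The equations `A x + B y` in the class of sections of degree `j`. -/
abbrev Sec (k l j : ℕ) : Type := Pair (j + 1 - l) (j + 1 - k)

/-- The form whose zeros are the intersection points of two sections. -/
noncomputable def contact {a b c d : ℕ} (U : Pair a b) (W : Pair c d) : MvPolynomial (Fin 2) ℂ :=
  form W.1 * form U.2 - form W.2 * form U.1

/-- The curve with the given equation is irreducible. -/
def Irr {a b : ℕ} (U : Pair a b) : Prop := IsIrreducibleSection (form U.1) (form U.2)

variable {a b c d : ℕ}

theorem contact_swap (U : Pair a b) (W : Pair c d) : contact W U = - contact U W := by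
  simp only [contact]; ring

theorem contact_add_right (U : Pair a b) (W W' : Pair c d) :
    contact U (W + W') = contact U W + contact U W' := by
  simp only [contact, ← formL_apply, Prod.fst_add, Prod.snd_add, map_add]; ring

theorem contact_smul_right (r : ℂ) (U : Pair a b) (W : Pair c d) :
    contact U (r • W) = r • contact U W := by
  simp only [contact, ← formL_apply, Prod.smul_fst, Prod.smul_snd, map_smul, smul_sub,
    smul_mul_assoc]

theorem contact_smul_left (r : ℂ) (U : Pair a b) (W : Pair c d) :
    contact (r • U) W = r • contact U W := by
  rw [contact_swap, contact_smul_right, contact_swap U W, smul_neg, neg_neg]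

theorem contact_add_left (U U' : Pair a b) (W : Pair c d) :
    contact (U + U') W = contact U W + contact U' W := by
  rw [contact_swap, contact_add_right, contact_swap U W, contact_swap U' W, neg_add, neg_neg, neg_neg]

theorem contact_self (U : Pair a b) : contact U U = 0 := by
  simp only [contact]; ring

theorem isPolyMap_contact {V : Type*} [AddCommGroup V] [Module ℂ V] {U : V → Pair a b}
    {W : V → Pair c d} (hU : IsPolyMap U) (hW : IsPolyMap W) :
    IsPolyMap fun v => contact (U v) (W v) :=
  ((isPolyMap_form hW.fst).mul (isPolyMap_form hU.snd)).sub
    ((isPolyMap_form hW.snd).mul (isPolyMap_form hU.fst))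

theorem Irr.ne_zero {U : Pair a b} (h : Irr U) : U ≠ 0 := by
  rintro rfl
  have := h ![1, 0] (by simp)
  simp [form] at this

theorem Irr.smul {U : Pair a b} (h : Irr U) {r : ℂ} (hr : r ≠ 0) : Irr (r • U) := by
  intro t ht
  simpa [← formL_apply, hr] using h t ht

theorem eval_eq_of_isHomogeneous_zero {p : MvPolynomial (Fin 2) ℂ} (hp : p.IsHomogeneous 0) :
    ∃ c, p = C c :=
  ⟨_, (totalDegree_eq_zero_iff_eq_C (p := p)).1 (Nat.le_zero.1 hp.totalDegree_le)⟩

/-- If the first form of an irreducible section vanishes, the second one is constant. -/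
theorem Irr.of_fst_eq_zero {U : Pair a b} (h : Irr U) (h1 : form U.1 = 0) :
    b = 1 ∧ ∃ c : ℂ, c ≠ 0 ∧ form U.2 = C c := by
  have h2 : ∀ t : Fin 2 → ℂ, t ≠ 0 → eval t (form U.2) ≠ 0 := fun t ht => by
    simpa [h1] using h t ht
  have h3 := form_isForm U.2
  have h4 : form U.2 ≠ 0 := fun h0 => h2 ![1, 0] (by simp) (by rw [h0, map_zero])
  have hb := h3.pos h4
  have hb1 : b = 1 := by
    by_contra hb1
    obtain ⟨n, rfl⟩ : ∃ n, b = n + 2 := ⟨b - 2, by omega⟩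
    obtain ⟨v, hv, h0⟩ := exists_zero_of_isHomogeneous (isForm_succ.1 h3)
    exact h2 v hv h0
  subst hb1
  obtain ⟨c, hc⟩ := eval_eq_of_isHomogeneous_zero (isForm_succ.1 h3)
  exact ⟨rfl, c, fun h0 => h4 (by rw [hc, h0, C_0]), hc⟩

/-- Sections without contact form are multiples of each other. -/
theorem Irr.exists_eq_mul {U : Pair a b} (hU : Irr U) {p q : MvPolynomial (Fin 2) ℂ}
    (h : p * form U.2 = q * form U.1) : ∃ K, p = K * form U.1 ∧ q = K * form U.2 := by
  by_cases h1 : form U.1 = 0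
  · obtain ⟨-, c, hc, h2⟩ := hU.of_fst_eq_zero h1
    rw [h1, mul_zero, h2] at h
    have hC : (C c : MvPolynomial (Fin 2) ℂ) ≠ 0 := by simpa using hc
    refine ⟨q * C c⁻¹, ?_, ?_⟩
    · rw [h1, mul_zero]; exact (mul_eq_zero.1 h).resolve_right hC
    · rw [h2, mul_assoc, ← C_mul, inv_mul_cancel₀ hc, C_1, mul_one]
  · have hrel := isRelPrime_of_no_common_zero (form_isForm U.1).isHomogeneous h1 hU
    obtain ⟨K, hK⟩ := hrel.dvd_of_dvd_mul_right (Dvd.intro_left q h.symm)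
    refine ⟨K, by rw [hK, mul_comm], ?_⟩
    apply mul_right_cancel₀ h1
    rw [← h, hK]; ring

variable {k l : ℕ}

/-- For `i < l` the coefficient of `x` has negative degree and is zero, so the coefficient of `y`
must be a nonzero constant: the section is the directrix. -/
theorem Irr.type_cases (hkl : k ≤ l) {i : ℕ} {U : Sec k l i} (h : Irr U) :
    l ≤ i ∨ (i = k ∧ k < l ∧ U.1 = 0) := by
  by_cases hi : l ≤ i
  · exact Or.inl hi
  · have h1 : IsForm (i + 1 - l) (form U.1) := form_isForm _
    have h0 : form U.1 = 0 := by
      by_contra hne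
      have := h1.pos hne
      omega
    have := (h.of_fst_eq_zero h0).1
    exact Or.inr ⟨by omega, by omega, form_eq_zero_iff.1 h0⟩

/-- If a product is nonzero, both its factors have nonnegative degree and the truncated subtractions
are exact; so the directrix is covered by the same formula. -/
theorem contact_isForm {i j e : ℕ} (he : e = i + j + 1 - k - l) (U : Sec k l i)
    (W : Sec k l j) : IsForm e (contact U W) := by
  refine IsForm.sub ((form_isForm _).mul_of_le (form_isForm _) ?_)
    ((form_isForm _).mul_of_le (form_isForm _) ?_) <;>
  · intro h1 h2
    have := (form_isForm _).pos h1
    have := (form_isForm _).pos h2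
    omega

/-- The coefficients of the contact form, as a bilinear map. -/
noncomputable def contactB (a b c d e : ℕ) : Pair a b →ₗ[ℂ] Pair c d →ₗ[ℂ] (Fin e → ℂ) :=
  LinearMap.mk₂ ℂ (fun U W => vecL e (contact U W))
    (fun U U' W => by rw [contact_add_left, map_add])
    (fun r U W => by rw [contact_smul_left, map_smul])
    (fun U W W' => by rw [contact_add_right, map_add])
    (fun r U W => by rw [contact_smul_right, map_smul])

@[simp] theorem contactB_apply {e : ℕ} (U : Pair a b) (W : Pair c d) :
    contactB a b c d e U W = vecL e (contact U W) := rfl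

/-- Rank-nullity: a section without contact form with `U` is a multiple `K U`, so the kernel has
dimension at most `j + 1 - i`. The hypothesis `hdim` then leaves at least `e` dimensions for the
range. -/
theorem Irr.contact_surjective (hkl : k ≤ l) {i j e : ℕ} (he : e = i + j + 1 - k - l)
    (hdim : e + (j + 1 - i) ≤ (j + 1 - l) + (j + 1 - k)) {U : Sec k l i} (hU : Irr U) :
    Function.Surjective (contactB _ _ (j + 1 - l) (j + 1 - k) e U) := by
  let L := contactB _ _ (j + 1 - l) (j + 1 - k) e U
  let T : (Fin (j + 1 - i) → ℂ) →ₗ[ℂ] Sec k l j :=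
    LinearMap.prod (vecL _ ∘ₗ LinearMap.mulRight ℂ (form U.1) ∘ₗ formL _)
      (vecL _ ∘ₗ LinearMap.mulRight ℂ (form U.2) ∘ₗ formL _)
  have hker : LinearMap.ker L ≤ LinearMap.range T := by
    intro W hW
    have h0 : contact U W = 0 := by
      have h1 := (contact_isForm he U W).form_vecL
      rw [LinearMap.mem_ker] at hW
      rw [← h1, show vecL e (contact U W) = 0 from hW]
      exact form_eq_zero_iff.2 rfl
    obtain ⟨K, hK1, hK2⟩ := hU.exists_eq_mul (sub_eq_zero.1 h0)
    -- The degree of `K` is read off from a nonzero component of `U`: the constant second one if the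
    -- first vanishes, otherwise the first.
    have hK : IsForm (j + 1 - i) K := by
      rcases hU.type_cases hkl with hi | ⟨rfl, hlt, hU1⟩
      · by_cases hU1 : form U.1 = 0
        · obtain ⟨hb, c, hc, hU2⟩ := hU.of_fst_eq_zero hU1
          have h2 := form_isForm W.2
          rw [hK2, mul_comm, hU2] at h2
          have := IsForm.of_mul (isHomogeneous_C (Fin 2) c) (by simpa using hc) h2
          rwa [show j + 1 - k - 0 = j + 1 - i by omega] at this
        · have h2 := form_isForm W.1
          rw [hK1, mul_comm] at h2
          have := IsForm.of_mul (form_isForm U.1).isHomogeneous hU1 h2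
          rwa [show j + 1 - l - (i + 1 - l - 1) = j + 1 - i by omega] at this
      · obtain ⟨hb, c, hc, hU2⟩ := hU.of_fst_eq_zero (form_eq_zero_iff.2 hU1)
        have h2 := form_isForm W.2
        rw [hK2, mul_comm, hU2] at h2
        exact IsForm.of_mul (a := 0) (isHomogeneous_C (Fin 2) c) (by simpa using hc) h2
    refine ⟨vecL _ K, ?_⟩
    have h1 : vecL (j + 1 - l) (K * form U.1) = W.1 := by rw [← hK1, vecL_form]
    have h2 : vecL (j + 1 - k) (K * form U.2) = W.2 := by rw [← hK2, vecL_form]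
    refine Prod.ext ?_ ?_
    · simpa [T, hK.form_vecL] using h1
    · simpa [T, hK.form_vecL] using h2
  have h1 : finrank ℂ (LinearMap.ker L) ≤ j + 1 - i :=
    (Submodule.finrank_mono hker).trans ((LinearMap.finrank_range_le T).trans (by simp))
  have h2 := L.finrank_range_add_finrank_ker
  rw [finrank_prod, finrank_fin_fun, finrank_fin_fun] at h2
  refine LinearMap.range_eq_top.1 (Submodule.eq_top_of_finrank_eq (le_antisymm ?_ ?_))
  · exact Submodule.finrank_le _
  · change _ ≤ finrank ℂ (LinearMap.range L)
    rw [finrank_fin_fun]; omega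

theorem exists_form_eval_ne_zero {e : ℕ} (he : 0 < e) {t : Fin 2 → ℂ} (ht : t ≠ 0) :
    ∃ R : Fin e → ℂ, eval t (form R) ≠ 0 := by
  obtain ⟨n, rfl⟩ : ∃ n, e = n + 1 := ⟨e - 1, by omega⟩
  obtain ⟨i, hi⟩ := Function.ne_iff.1 ht
  have h : IsForm (n + 1) (X i ^ n : MvPolynomial (Fin 2) ℂ) :=
    isForm_succ.2 (isHomogeneous_X_pow i n)
  refine ⟨vecL _ (X i ^ n), ?_⟩
  rw [h.form_vecL]
  simpa using fun h0 => (hi h0).elim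

/-- At a common zero of the two forms of `U` every contact form vanishes, whereas some form of the
target space does not. -/
theorem Irr.of_contact_surjective {i j e : ℕ} (he : e = i + j + 1 - k - l)
    (hpos : 0 < e) {U : Sec k l i}
    (h : Function.Surjective (contactB _ _ (j + 1 - l) (j + 1 - k) e U)) : Irr U := by
  intro t ht
  by_contra! hcon
  obtain ⟨R, hR⟩ := exists_form_eval_ne_zero hpos ht
  obtain ⟨W, rfl⟩ := h R
  apply hR
  rw [contactB_apply, (contact_isForm he U W).form_vecL]
  simp [contact, hcon]

/-- Irreducibility is open, because it is equivalent to surjectivity of contact with sections of a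
large degree; `i + l` is large enough. -/
theorem Irr.eventually (hkl : k ≤ l) {i : ℕ} {U : Sec k l i} (hU : Irr U) :
    ∀ᶠ U' in zn U, Irr U' := by
  have hi := hU.type_cases hkl
  have h := eventually_surjective (v := U) (IsPolyMap.linearMap
    (contactB (i + 1 - l) (i + 1 - k) (i + l + 1 - l) (i + l + 1 - k) (i + (i + l) + 1 - k - l)))
    (hU.contact_surjective hkl rfl (by omega))
  filter_upwards [h] with U' hU'
  exact Irr.of_contact_surjective rfl (by omega) hU'

/-- The product of powers of the linear forms that vanish at given points. -/
noncomputable def linProd {M : Type} [Fintype M] (p : M → Fin 2 → ℂ) (ν : M → ℕ) :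
    MvPolynomial (Fin 2) ℂ :=
  ∏ i, lin (p i) ^ ν i

section linProd

variable {M : Type} [Fintype M] (p : M → Fin 2 → ℂ) (ν : M → ℕ)

theorem linProd_isHomogeneous : (linProd p ν).IsHomogeneous (∑ i, ν i) := by
  refine IsHomogeneous.prod _ _ _ fun i _ => ?_
  simpa using (lin_isHomogeneous (p i)).pow (ν i)

variable {p} in
theorem linProd_ne_zero (hp : ∀ i, p i ≠ 0) : linProd p ν ≠ 0 :=
  Finset.prod_ne_zero_iff.2 fun i _ => pow_ne_zero _ (lin_ne_zero (hp i))

variable {ν} in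
theorem eval_linProd_eq_zero {i : M} (hi : ν i ≠ 0) : eval (p i) (linProd p ν) = 0 := by
  rw [linProd, map_prod]
  refine Finset.prod_eq_zero (Finset.mem_univ i) ?_
  rw [map_pow, eval_lin_self, zero_pow hi]

theorem isPolyMap_linProd {V : Type*} [AddCommGroup V] [Module ℂ V] {p : V → M → Fin 2 → ℂ}
    (hp : IsPolyMap p) (ν : M → ℕ) : IsPolyMap fun v => linProd (p v) ν :=
  IsPolyMap.prod fun i => (isPolyMap_lin (hp.apply i)).pow _

theorem linProd_isForm {n : ℕ} {q : MvPolynomial (Fin 2) ℂ} (hq : IsForm n q) {e : ℕ}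
    (he : 0 < n → e = ∑ i, ν i + n) : IsForm e (linProd p ν * q) := by
  refine (IsForm.of_isHomogeneous (linProd_isHomogeneous p ν)).mul_of_le hq fun _ h => ?_
  rw [he (hq.pos h)]; ring

end linProd

/-- Multiplication of forms, on coefficients. -/
noncomputable def mulB (r e : ℕ) : MvPolynomial (Fin 2) ℂ →ₗ[ℂ] (Fin r → ℂ) →ₗ[ℂ] (Fin e → ℂ) :=
  LinearMap.mk₂ ℂ (fun P R => vecL e (P * form R))
    (fun P P' R => by rw [add_mul, map_add])
    (fun c P R => by rw [smul_mul_assoc, map_smul])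
    (fun P R R' => by rw [← formL_apply, map_add, mul_add, map_add]; rfl)
    (fun c P R => by rw [← formL_apply, map_smul, mul_smul_comm, map_smul]; rfl)

theorem isPolyMap_pts {M : Type} [Fintype M] (σ : M → Bool) :
    IsPolyMap fun (s : M → ℂ) i => pt (σ i) (s i) := by
  refine IsPolyMap.pi fun i => ?_
  exact (isPolyMap_pt (σ i)).comp (IsPolyMap.eval_at i)

/-- With the points and `U` as parameters, the equation is linear in the unknowns `(W, R)`, and it
is already surjective in the direction of `W`. -/
theorem contact_localParam_of_surjective {i j e r : ℕ} (he : e = i + j + 1 - k - l)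
    {M : Type} [Fintype M] (σ : M → Bool) (ν : M → ℕ) (hr : ∑ i, ν i + r = e)
    {s : M → ℂ} {U : Sec k l i} {W : Sec k l j} {R : Fin r → ℂ}
    (h : contact U W = linProd (fun i => pt (σ i) (s i)) ν * form R)
    (hU : Function.Surjective (contactB _ _ (j + 1 - l) (j + 1 - k) e U)) {α : ℕ}
    (hα : α + e = Fintype.card M + ((i + 1 - l) + (i + 1 - k)) + ((j + 1 - l) + (j + 1 - k)) + r) :
    LocalParamAt {z : ((M → ℂ) × Sec k l i) × (Sec k l j × (Fin r → ℂ)) |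
      contact z.1.2 z.2.1 = linProd (fun i => pt (σ i) (z.1.1 i)) ν * form z.2.2}
      ((s, U), (W, R)) α := by
  have hmul : ∀ (s : M → ℂ) (R : Fin r → ℂ),
      IsForm e (linProd (fun i => pt (σ i) (s i)) ν * form R) := fun s R =>
    linProd_isForm _ _ (form_isForm R) (fun _ => hr.symm)
  let A : (M → ℂ) × Sec k l i → (Sec k l j × (Fin r → ℂ)) →ₗ[ℂ] (Fin e → ℂ) := fun θ =>
    contactB _ _ (j + 1 - l) (j + 1 - k) e θ.2 ∘ₗ LinearMap.fst ℂ _ _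
      - mulB r e (linProd (fun i => pt (σ i) (θ.1 i)) ν) ∘ₗ LinearMap.snd ℂ _ _
  have hA : IsPolyMap A := by
    refine IsPolyMap.sub (IsPolyMap.linearMap_comp ?_ (IsPolyMap.const _))
      (IsPolyMap.linearMap_comp ?_ (IsPolyMap.const _))
    · exact IsPolyMap.linear _ (by fun_prop)
    · exact IsPolyMap.linear _ (isPolyMap_linProd
        ((isPolyMap_pts σ).comp (show IsPolyMap fun θ : (M → ℂ) × Sec k l i => θ.1 by fun_prop)) ν)
  have hA0 : ∀ θ q, A θ q = 0 ↔
      contact θ.2 q.1 = linProd (fun i => pt (σ i) (θ.1 i)) ν * form q.2 := by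
    intro θ q
    have h1 : A θ q = vecL e (contact θ.2 q.1 - linProd (fun i => pt (σ i) (θ.1 i)) ν * form q.2) := by
      rw [map_sub]; rfl
    rw [h1, ← sub_eq_zero (a := contact _ _)]
    have h2 := ((contact_isForm he θ.2 q.1).sub (hmul θ.1 q.2)).form_vecL
    constructor
    · intro h3; rw [← h2, h3]; exact form_eq_zero_iff.2 rfl
    · intro h3; rw [h3, map_zero]
  have hsurj : Function.Surjective (A (s, U)) := by
    intro y
    obtain ⟨W', hW'⟩ := hU y
    exact ⟨(W', 0), by simpa [A] using hW'⟩
  have := LocalParamAt.linear_system hA hsurj ((hA0 (s, U) (W, R)).2 h) (a := α)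
    (by simp only [finrank_prod, finrank_fintype_fun_eq_card, Fintype.card_fin]; omega)
  simp only [hA0] at this
  exact this

/-- The pairs of distinct irreducible sections with prescribed contact have local
parametrizations. -/
theorem contact_localParam (hkl : k ≤ l) {i j e r : ℕ} (he : e = i + j + 1 - k - l)
    {M : Type} [Fintype M] (σ : M → Bool) (ν : M → ℕ) (hr : ∑ i, ν i + r = e)
    {s : M → ℂ} {U : Sec k l i} {W : Sec k l j} {R : Fin r → ℂ}
    (h : contact U W = linProd (fun i => pt (σ i) (s i)) ν * form R)
    (hU : Irr U) (hW : Irr W) (hne : contact U W ≠ 0) {α : ℕ}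
    (hα : α + e = Fintype.card M + ((i + 1 - l) + (i + 1 - k)) + ((j + 1 - l) + (j + 1 - k)) + r) :
    LocalParamAt {z : (M → ℂ) × Sec k l i × Sec k l j × (Fin r → ℂ) |
      contact z.2.1 z.2.2.1 = linProd (fun i => pt (σ i) (z.1 i)) ν * form z.2.2.2}
      (s, U, W, R) α := by
  -- Contact with `U` is onto only if `W` has sufficiently large degree or `U` is the directrix. At
  -- least one of the two roles works; two directrices are excluded by `hne`.
  have hcase : (e + (j + 1 - i) ≤ (j + 1 - l) + (j + 1 - k)) ∨
      (e + (i + 1 - j) ≤ (i + 1 - l) + (i + 1 - k)) := by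
    rcases hU.type_cases hkl with hi | ⟨hi, hlt, hU1⟩
    · rcases hW.type_cases hkl with hj | ⟨hj, hlt, hW1⟩
      · omega
      · omega
    · rcases hW.type_cases hkl with hj | ⟨hj, hlt, hW1⟩
      · omega
      · exact absurd (by simp [contact, form_eq_zero_iff.2 hU1, form_eq_zero_iff.2 hW1]) hne
  rcases hcase with hc | hc
  · have := contact_localParam_of_surjective he σ ν hr h
      (hU.contact_surjective hkl he hc) hα
    let E : ((M → ℂ) × Sec k l i × Sec k l j × (Fin r → ℂ)) ≃ₗ[ℂ]
        ((M → ℂ) × Sec k l i) × (Sec k l j × (Fin r → ℂ)) :=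
      { toFun := fun z => ((z.1, z.2.1), (z.2.2.1, z.2.2.2))
        invFun := fun z => (z.1.1, z.1.2, z.2.1, z.2.2)
        map_add' := fun _ _ => rfl
        map_smul' := fun _ _ => rfl
        left_inv := fun _ => rfl
        right_inv := fun _ => rfl }
    exact this.equiv E (fun _ => Iff.rfl) rfl
  -- With the roles exchanged the contact form changes sign, which is absorbed in `R`.
  · have h' : contact W U = linProd (fun i => pt (σ i) (s i)) ν * form (-R) := by
      rw [contact_swap, h, ← formL_apply (-R), map_neg, mul_neg]; rfl
    have := contact_localParam_of_surjective (show e = j + i + 1 - k - l by omega) σ ν hr h'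
      (hW.contact_surjective hkl (by omega) hc) (α := α) (by omega)
    let E : ((M → ℂ) × Sec k l i × Sec k l j × (Fin r → ℂ)) ≃ₗ[ℂ]
        ((M → ℂ) × Sec k l j) × (Sec k l i × (Fin r → ℂ)) :=
      { toFun := fun z => ((z.1, z.2.2.1), (z.2.1, -z.2.2.2))
        invFun := fun z => (z.1.1, z.2.1, z.1.2, -z.2.2)
        map_add' := fun x y => by simp [add_comm]
        map_smul' := fun _ _ => by simp
        left_inv := fun _ => by simp
        right_inv := fun _ => by simp }
    refine this.equiv E (fun z => ?_) rfl
    change contact z.2.1 z.2.2.1 = _ ↔ contact z.2.2.1 z.2.1 = _ * form (-z.2.2.2)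
    rw [contact_swap z.2.1, ← formL_apply (-z.2.2.2), map_neg, mul_neg, neg_inj, formL_apply]
    rfl

end Pairs

end Scroll

namespace Scroll

/-! ## Configurations -/

section Config

open MvPolynomial Module

variable {N k l d e hh m n : ℕ}

/-- The pull-back of the hyperplane. -/
noncomputable def hypL (N k l : ℕ) (h : Fin (N + 1) → ℂ) :
    (Fin (N + 1) → Pair (k + 1) (l + 1)) →ₗ[ℂ] Pair (k + 1) (l + 1) :=
  ∑ i, h i • LinearMap.proj i

theorem hypL_apply (h : Fin (N + 1) → ℂ) (T : Fin (N + 1) → Pair (k + 1) (l + 1)) :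
    hypL N k l h T = ∑ i, h i • T i := by
  simp [hypL, LinearMap.sum_apply]

/-- The linear map which sends the coordinates on the standard scroll to those on `ℙᴺ`. -/
noncomputable def tmap (N k l : ℕ) : (Fin (N + 1) → Pair (k + 1) (l + 1)) →ₗ[ℂ]
    (Pair (k + 1) (l + 1) →ₗ[ℂ] (Fin (N + 1) → ℂ)) :=
  LinearMap.mk₂ ℂ (fun T v i => (T i).1 ⬝ᵥ v.1 + (T i).2 ⬝ᵥ v.2)
    (fun T T' v => by ext i; simp [add_dotProduct]; ring)
    (fun r T v => by ext i; simp [mul_add])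
    (fun T v v' => by ext i; simp [dotProduct_add]; ring)
    (fun r T v => by ext i; simp [mul_add])

/-- The image of the map is not contained in a scroll of smaller span. -/
def NonDeg (T : Fin (N + 1) → Pair (k + 1) (l + 1)) : Prop := Function.Injective (tmap N k l T)

theorem NonDeg.eventually {V : Type*} [AddCommGroup V] [Module ℂ V] {v : V}
    {T : V → Fin (N + 1) → Pair (k + 1) (l + 1)} (hT : IsPolyMap T) (hv : NonDeg (T v)) :
    ∀ᶠ w in zn v, NonDeg (T w) :=
  eventually_injective (hT.linear (tmap N k l)) hv

/-- The coordinates of the parameter space. -/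
abbrev Amb (N k l d e : ℕ) : Type :=
  (Fin (N + 1) → Pair (k + 1) (l + 1)) × Sec k l d × Sec k l e

/-- A map onto a scroll with two marked sections such that the residual section of the pull-back of
the hyperplane is `G`, with prescribed contacts and with prescribed coincidences of `G`, `C`
and `D`. -/
def Config (hh : ℕ) (h : Fin (N + 1) → ℂ) (μ : Fin m → ℕ) (ν : Fin m ⊕ Fin n → ℕ)
    (c₁ c₂ c₃ : Prop) (x : Amb N k l d e) : Prop :=
  NonDeg x.1 ∧ Irr x.2.1 ∧ Irr x.2.2 ∧ ∃ p : Fin m ⊕ Fin n → Fin 2 → ℂ, (∀ i, p i ≠ 0) ∧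
    (∀ i j, i ≠ j → Indep (p i) (p j)) ∧ ∃ G : Sec k l hh, Irr G ∧
    form (hypL N k l h x.1).1 = linProd (fun i => p (.inl i)) μ * form G.1 ∧
    form (hypL N k l h x.1).2 = linProd (fun i => p (.inl i)) μ * form G.2 ∧
    (contact G x.2.1 = 0 ↔ c₁) ∧ (contact G x.2.2 = 0 ↔ c₂) ∧ (contact x.2.1 x.2.2 = 0 ↔ c₃) ∧
    (contact x.2.1 x.2.2 ≠ 0 → ∃ Q, contact x.2.1 x.2.2 = linProd p ν * Q ∧
      ∀ i, ν i ≠ 0 → eval (p i) Q ≠ 0)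

theorem isPolyMap_eval_at {V : Type*} [AddCommGroup V] [Module ℂ V] {p : V → Fin 2 → ℂ}
    {Q : V → MvPolynomial (Fin 2) ℂ} (hp : IsPolyMap p) (hQ : IsPolyMap Q) :
    IsPolyMap fun v => eval (p v) (Q v) := by
  induction hQ using Submodule.span_induction with
  | mem G hG =>
    obtain ⟨f, hf, w, rfl⟩ := hG
    simp only [smul_eval]
    exact (IsPolyMap.of_mem' hf).mul ((isPolyMap_eval w).comp hp)
  | zero => simpa using IsPolyMap.const (V := V) (0 : ℂ)
  | add x y _ _ hx hy => simpa using hx.add hy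
  | smul a x _ hx => simpa using (IsPolyMap.const a).mul hx

/-- All inequalities in the definition of a configuration are open. The closed conditions remain as
hypotheses, since they hold identically on the charts to which this is applied. -/
theorem Config.eventually (hkl : k ≤ l) {V : Type*} [AddCommGroup V] [Module ℂ V]
    {T : V → Fin (N + 1) → Pair (k + 1) (l + 1)} {C : V → Sec k l d} {D : V → Sec k l e}
    {G : V → Sec k l hh} {p : V → Fin m ⊕ Fin n → Fin 2 → ℂ} {Q : V → MvPolynomial (Fin 2) ℂ}
    (hT : IsPolyMap T) (hC : IsPolyMap C) (hD : IsPolyMap D) (hG : IsPolyMap G) (hp : IsPolyMap p)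
    (hQ : IsPolyMap Q) {h : Fin (N + 1) → ℂ} {μ : Fin m → ℕ} {ν : Fin m ⊕ Fin n → ℕ}
    {c₁ c₂ c₃ : Prop} {v : V} (hTv : NonDeg (T v)) (hCv : Irr (C v)) (hDv : Irr (D v))
    (hGv : Irr (G v)) (hpv : ∀ i, p v i ≠ 0) (hpv' : ∀ i j, i ≠ j → Indep (p v i) (p v j))
    (h₁ : ¬ c₁ → contact (G v) (C v) ≠ 0) (h₂ : ¬ c₂ → contact (G v) (D v) ≠ 0)
    (h₃ : ¬ c₃ → contact (C v) (D v) ≠ 0) (hQv : ¬ c₃ → ∀ i, ν i ≠ 0 → eval (p v i) (Q v) ≠ 0) :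
    ∀ᶠ w in zn v,
      form (hypL N k l h (T w)).1 = linProd (fun i => p w (.inl i)) μ * form (G w).1 →
      form (hypL N k l h (T w)).2 = linProd (fun i => p w (.inl i)) μ * form (G w).2 →
      (c₁ → contact (G w) (C w) = 0) → (c₂ → contact (G w) (D w) = 0) →
      (c₃ → contact (C w) (D w) = 0) → (¬ c₃ → contact (C w) (D w) = linProd (p w) ν * Q w) →
      Config hh h μ ν c₁ c₂ c₃ (T w, C w, D w) := by
  have e1 := NonDeg.eventually hT hTv
  have e2 := (hC.tendsto v).eventually (hCv.eventually hkl)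
  have e3 := (hD.tendsto v).eventually (hDv.eventually hkl)
  have e4 := (hG.tendsto v).eventually (hGv.eventually hkl)
  have e5 : ∀ᶠ w in zn v, ∀ i, p w i ≠ 0 :=
    Filter.eventually_all.2 fun i => eventually_ne_zero' (hp.apply i) (hpv i)
  have e6 : ∀ᶠ w in zn v, ∀ i j, i ≠ j → Indep (p w i) (p w j) := by
    refine Filter.eventually_all.2 fun i => Filter.eventually_all.2 fun j => ?_
    by_cases hij : i = j
    · exact Filter.Eventually.of_forall fun w hw => absurd hij hw
    have hc : ∀ i (a : Fin 2), IsPolyMap fun w => p w i a := fun i a => (hp.apply i).apply a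
    have := eventually_ne_zero (v := v) (((hc j 1).mul (hc i 0)).sub ((hc j 0).mul (hc i 1)))
      (hpv' i j hij)
    filter_upwards [this] with w hw _ using hw
  have e7 : ∀ᶠ w in zn v, ¬ c₁ → contact (G w) (C w) ≠ 0 := by
    by_cases hc : c₁
    · exact Filter.Eventually.of_forall fun w hw => absurd hc hw
    · filter_upwards [eventually_ne_zero' (isPolyMap_contact hG hC) (h₁ hc)] with w hw _ using hw
  have e8 : ∀ᶠ w in zn v, ¬ c₂ → contact (G w) (D w) ≠ 0 := by
    by_cases hc : c₂
    · exact Filter.Eventually.of_forall fun w hw => absurd hc hw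
    · filter_upwards [eventually_ne_zero' (isPolyMap_contact hG hD) (h₂ hc)] with w hw _ using hw
  have e9 : ∀ᶠ w in zn v, ¬ c₃ → contact (C w) (D w) ≠ 0 := by
    by_cases hc : c₃
    · exact Filter.Eventually.of_forall fun w hw => absurd hc hw
    · filter_upwards [eventually_ne_zero' (isPolyMap_contact hC hD) (h₃ hc)] with w hw _ using hw
  have e10 : ∀ᶠ w in zn v, ¬ c₃ → ∀ i, ν i ≠ 0 → eval (p w i) (Q w) ≠ 0 := by
    by_cases hc : c₃
    · exact Filter.Eventually.of_forall fun w hw => absurd hc hw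
    · have : ∀ᶠ w in zn v, ∀ i, ν i ≠ 0 → eval (p w i) (Q w) ≠ 0 := by
        refine Filter.eventually_all.2 fun i => ?_
        by_cases hi : ν i = 0
        · exact Filter.Eventually.of_forall fun w hw => absurd hi hw
        · filter_upwards [eventually_ne_zero (isPolyMap_eval_at (hp.apply i) hQ) (hQv hc i hi)]
            with w hw _ using hw
      filter_upwards [this] with w hw _ using hw
  filter_upwards [e1, e2, e3, e4, e5, e6, e7, e8, e9, e10] with w f1 f2 f3 f4 f5 f6 f7 f8 f9 f10
    g1 g2 g3 g4 g5 g6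
  exact ⟨f1, f2, f3, p w, f5, f6, G w, f4, g1, g2, ⟨fun hz => by_contra fun hc => f7 hc hz, g3⟩,
    ⟨fun hz => by_contra fun hc => f8 hc hz, g4⟩, ⟨fun hz => by_contra fun hc => f9 hc hz, g5⟩,
    fun hne => ⟨Q w, g6 fun hc => hne (g5 hc), f10 fun hc => hne (g5 hc)⟩⟩

/-- The points of a configuration may be taken in standard charts. -/
theorem Config.exists_chart {h : Fin (N + 1) → ℂ} {μ : Fin m → ℕ} {ν : Fin m ⊕ Fin n → ℕ}
    {c₁ c₂ c₃ : Prop} {x : Amb N k l d e} (hx : Config hh h μ ν c₁ c₂ c₃ x) :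
    ∃ (σ : Fin m ⊕ Fin n → Bool) (s : Fin m ⊕ Fin n → ℂ),
    (∀ i j, i ≠ j → Indep (pt (σ i) (s i)) (pt (σ j) (s j))) ∧ ∃ G : Sec k l hh, Irr G ∧
    form (hypL N k l h x.1).1
      = linProd (fun i => pt (σ (.inl i)) (s (.inl i))) μ * form G.1 ∧
    form (hypL N k l h x.1).2
      = linProd (fun i => pt (σ (.inl i)) (s (.inl i))) μ * form G.2 ∧
    (contact G x.2.1 = 0 ↔ c₁) ∧ (contact G x.2.2 = 0 ↔ c₂) ∧ (contact x.2.1 x.2.2 = 0 ↔ c₃) ∧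
    (contact x.2.1 x.2.2 ≠ 0 → ∃ Q, contact x.2.1 x.2.2 = linProd (fun i => pt (σ i) (s i)) ν * Q ∧
      ∀ i, ν i ≠ 0 → eval (pt (σ i) (s i)) Q ≠ 0) := by
  obtain ⟨-, -, -, p, hp, hind, G, hG, h1, h2, h3, h4, h5, h6⟩ := hx
  choose σ s c hc hpt using fun i => exists_eq_smul_pt (hp i)
  have hprod : ∀ {M : Type} [Fintype M] (f : M → Fin m ⊕ Fin n) (ν : M → ℕ),
      ∃ r : ℂ, r ≠ 0 ∧ linProd (fun i => p (f i)) ν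
        = C r * linProd (fun i => pt (σ (f i)) (s (f i))) ν := by
    intro M _ f ν
    refine ⟨∏ i, c (f i) ^ ν i, Finset.prod_ne_zero_iff.2 fun i _ => pow_ne_zero _ (hc _), ?_⟩
    rw [linProd, linProd, map_prod, ← Finset.prod_mul_distrib]
    refine Finset.prod_congr rfl fun i _ => ?_
    rw [hpt (f i), lin_smul, mul_pow, C_pow]
  refine ⟨σ, s, fun i j hij => ?_, ?_⟩
  · have := hind i j hij
    rw [hpt i, hpt j] at this
    intro h0
    apply this
    simp only [Pi.smul_apply, smul_eq_mul]
    linear_combination (c i * c j) * h0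
  · obtain ⟨r, hr, hP⟩ := hprod Sum.inl μ
    obtain ⟨r', hr', hP'⟩ := hprod id ν
    simp only [id] at hP'
    -- The scalar factors produced by moving the points into charts are absorbed in `G` and in the
    -- residual contact form.
    refine ⟨r • G, hG.smul hr, ?_, ?_, ?_, ?_, h5, fun hne => ?_⟩
    · rw [h1, hP, Prod.smul_fst, ← formL_apply (r • G.1), map_smul, smul_eq_C_mul, formL_apply]
      ring
    · rw [h2, hP, Prod.smul_snd, ← formL_apply (r • G.2), map_smul, smul_eq_C_mul, formL_apply]
      ring
    · rw [contact_smul_left, smul_eq_zero_iff_right hr, h3]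
    · rw [contact_smul_left, smul_eq_zero_iff_right hr, h4]
    · obtain ⟨Q, hQ, hQe⟩ := h6 hne
      refine ⟨C r' * Q, ?_, fun i hi => ?_⟩
      · rw [hQ, hP']; ring
      · have := hQe i hi
        intro h0
        apply this
        rw [map_mul, eval_C] at h0
        have h0 := (mul_eq_zero.1 h0).resolve_left hr'
        -- Homogeneity of `Q` is needed to pass from a representative in a chart to the original
        -- multiple of it.
        have hQform : ∃ n, Q.IsHomogeneous n := by
          have hcf := contact_isForm rfl x.2.1 x.2.2
          rw [hQ] at hcf
          exact ⟨_, (IsForm.of_mul (linProd_isHomogeneous p ν) (linProd_ne_zero ν hp) hcf).isHomogeneous⟩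
        obtain ⟨n', hn'⟩ := hQform
        rw [hpt i, eval_smul_of_isHomogeneous hn', h0, mul_zero]

/-- The product of a form with a pair of forms. -/
noncomputable def mulPair (k l : ℕ) {a b : ℕ} (P : MvPolynomial (Fin 2) ℂ) (G : Pair a b) :
    Pair (k + 1) (l + 1) := (vecL (k + 1) (P * form G.1), vecL (l + 1) (P * form G.2))

theorem isPolyMap_vecL_mul {V : Type*} [AddCommGroup V] [Module ℂ V] {a r : ℕ}
    {P : V → MvPolynomial (Fin 2) ℂ} {G : V → Fin a → ℂ} (hP : IsPolyMap P) (hG : IsPolyMap G) :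
    IsPolyMap fun v => vecL r (P v * form (G v)) :=
  (hP.mul (isPolyMap_form hG)).linear _

theorem isPolyMap_mulPair {V : Type*} [AddCommGroup V] [Module ℂ V] {a b : ℕ}
    {P : V → MvPolynomial (Fin 2) ℂ} {G : V → Pair a b} (hP : IsPolyMap P) (hG : IsPolyMap G) :
    IsPolyMap fun v => mulPair k l (P v) (G v) :=
  (isPolyMap_vecL_mul hP hG.fst).prodMk (isPolyMap_vecL_mul hP hG.snd)

theorem form_mulPair {M : Type} [Fintype M] {μ : M → ℕ}
    (hs : hh + ∑ i, μ i = k + l) (p : M → Fin 2 → ℂ) (G : Sec k l hh) :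
    form (mulPair k l (linProd p μ) G).1 = linProd p μ * form G.1 ∧
    form (mulPair k l (linProd p μ) G).2 = linProd p μ * form G.2 :=
  ⟨(linProd_isForm p μ (form_isForm G.1) fun _ => by omega).form_vecL,
    (linProd_isForm p μ (form_isForm G.2) fun _ => by omega).form_vecL⟩

theorem pair_ext {a b : ℕ} {U W : Pair a b} (h1 : form U.1 = form W.1) (h2 : form U.2 = form W.2) :
    U = W := Prod.ext (form_injective h1) (form_injective h2)

/-- The pull-back map is split surjective because some coefficient of the hyperplane is nonzero; its
kernel supplies the summand `N * (k + l + 2)` of every dimension. -/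
theorem exists_section {h : Fin (N + 1) → ℂ} (hne : h ≠ 0) :
    (∃ S : Pair (k + 1) (l + 1) →ₗ[ℂ] (Fin (N + 1) → Pair (k + 1) (l + 1)),
      ∀ v, hypL N k l h (S v) = v) ∧
    finrank ℂ (LinearMap.ker (hypL N k l h)) = N * (k + l + 2) := by
  obtain ⟨i, hi⟩ := Function.ne_iff.1 hne
  have hsurj : Function.Surjective (hypL N k l h) := by
    intro v
    refine ⟨Pi.single i ((h i)⁻¹ • v), ?_⟩
    rw [hypL_apply, Finset.sum_eq_single i]
    · rw [Pi.single_eq_same, smul_smul, mul_inv_cancel₀ hi, one_smul]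
    · intro j _ hj; rw [Pi.single_eq_of_ne hj, smul_zero]
    · simp
  constructor
  · obtain ⟨S, hS⟩ := (hypL N k l h).exists_rightInverse_of_surjective
      (LinearMap.range_eq_top.2 hsurj)
    exact ⟨S, LinearMap.congr_fun hS⟩
  · have := (hypL N k l h).finrank_range_add_finrank_ker
    rw [LinearMap.range_eq_top.2 hsurj, finrank_top, finrank_pi_fintype] at this
    simp only [finrank_prod, finrank_fin_fun, Finset.sum_const, Finset.card_univ,
      Fintype.card_fin, smul_eq_mul] at this
    nlinarith

/-- The values of the parameters of the points are among finitely many. -/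
theorem finite_params {M : Type} [Finite M] (σ : M → Bool) {p : M → MvPolynomial (Fin 2) ℂ}
    (hp : ∀ i, ∃ a, (p i).IsHomogeneous a) (hp0 : ∀ i, p i ≠ 0) :
    {s : M → ℂ | ∀ i, eval (pt (σ i) (s i)) (p i) = 0}.Finite := by
  exact Set.Finite.pi' fun i => by
    obtain ⟨a, ha⟩ := hp i
    exact finite_zeros ha (hp0 i) (σ i)

/-- One of the two forms of `v` is nonzero, and it is divisible by every common factor `P'`; this
bounds the possible positions of fibres in the hyperplane. -/
theorem exists_hyp_form {G : Sec k l hh} (hG : Irr G) {P : MvPolynomial (Fin 2) ℂ} (hP : P ≠ 0)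
    {v : Pair (k + 1) (l + 1)} (h1 : form v.1 = P * form G.1) (h2 : form v.2 = P * form G.2) :
    ∃ A : MvPolynomial (Fin 2) ℂ, (∃ a, A.IsHomogeneous a) ∧ A ≠ 0 ∧
      ∀ (P' : MvPolynomial (Fin 2) ℂ) (G' : Sec k l hh) (t : Fin 2 → ℂ), form v.1 = P' * form G'.1 →
        form v.2 = P' * form G'.2 → eval t P' = 0 → eval t A = 0 := by
  by_cases h0 : form G.1 = 0
  · have h3 : form G.2 ≠ 0 := fun h3 => hG.ne_zero
      (Prod.ext (form_eq_zero_iff.1 h0) (form_eq_zero_iff.1 h3))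
    refine ⟨form v.2, ⟨_, (form_isForm v.2).isHomogeneous⟩, h2 ▸ mul_ne_zero hP h3, ?_⟩
    intro P' G' t _ h h'; simp only [h, map_mul, h', zero_mul]
  · refine ⟨form v.1, ⟨_, (form_isForm v.1).isHomogeneous⟩, h1 ▸ mul_ne_zero hP h0, ?_⟩
    intro P' G' t h _ h'; simp only [h, map_mul, h', zero_mul]

/-- Irreducible sections without contact form are equal. -/
theorem Irr.exists_eq_smul {i j : ℕ} {U : Sec k l i} {W : Sec k l j} (hU : Irr U)
    (hW : Irr W) (h : contact U W = 0) :
    i = j ∧ ∃ c : ℂ, c ≠ 0 ∧ form W.1 = C c * form U.1 ∧ form W.2 = C c * form U.2 := by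
  obtain ⟨K, hK1, hK2⟩ := hU.exists_eq_mul (sub_eq_zero.1 h)
  -- A zero of `K` would be a common zero of both forms of `W`. So `K` has no zeros, and its degree
  -- must be zero.
  have hKne : ∀ t : Fin 2 → ℂ, t ≠ 0 → eval t K ≠ 0 := by
    intro t ht h0
    have := hW t ht
    simp [hK1, hK2, h0] at this
  have hK : IsForm (j + 1 - i) K := by
    by_cases hU1 : form U.1 = 0
    · obtain ⟨hb, c, hc, hU2⟩ := hU.of_fst_eq_zero hU1
      have h2 := form_isForm W.2
      rw [hK2, mul_comm, hU2] at h2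
      have := IsForm.of_mul (isHomogeneous_C (Fin 2) c) (by simpa using hc) h2
      rwa [show j + 1 - k - 0 = j + 1 - i by omega] at this
    · have h2 := form_isForm W.1
      rw [hK1, mul_comm] at h2
      have := IsForm.of_mul (form_isForm U.1).isHomogeneous hU1 h2
      have hpos := (form_isForm U.1).pos hU1
      rwa [show j + 1 - l - (i + 1 - l - 1) = j + 1 - i by omega] at this
  have hK0 : K ≠ 0 := fun h0 => hKne ![1, 0] (by simp) (by rw [h0, map_zero])
  have hpos := hK.pos hK0
  have hone : j + 1 - i = 1 := by
    by_contra hne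
    obtain ⟨a, ha⟩ : ∃ a, j + 1 - i = a + 2 := ⟨j + 1 - i - 2, by omega⟩
    rw [ha] at hK
    obtain ⟨v, hv, h0⟩ := exists_zero_of_isHomogeneous (isForm_succ.1 hK)
    exact hKne v hv h0
  rw [hone] at hK
  obtain ⟨c, rfl⟩ := eval_eq_of_isHomogeneous_zero (isForm_succ.1 hK)
  exact ⟨by omega, c, by simpa using hK0, hK1, hK2⟩

theorem Irr.exists_eq_smul' {i : ℕ} {U W : Sec k l i} (hU : Irr U)
    (hW : Irr W) (h : contact U W = 0) : ∃ c : ℂ, c ≠ 0 ∧ W = c • U := by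
  obtain ⟨-, c, hc, h1, h2⟩ := hU.exists_eq_smul hW h
  refine ⟨c, hc, pair_ext ?_ ?_⟩
  · rw [h1, Prod.smul_fst, ← formL_apply (c • U.1), map_smul, smul_eq_C_mul, formL_apply]
  · rw [h2, Prod.smul_snd, ← formL_apply (c • U.2), map_smul, smul_eq_C_mul, formL_apply]

end Config

end Scroll

/-! ### Dimensions of the spaces of configurations -/

namespace Scroll

section Dim

open MvPolynomial Module

variable {N k l d e hh m n : ℕ}

/-- The second part records that the subtraction of the contact orders is not truncated when the
contact form is nonzero. -/
theorem residual_isForm {i j : ℕ} {U : Sec k l i} {W : Sec k l j} {M : Type} [Fintype M]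
    {p : M → Fin 2 → ℂ} (hp : ∀ i, p i ≠ 0) {ν : M → ℕ} {Q : MvPolynomial (Fin 2) ℂ}
    (h : contact U W = linProd p ν * Q) :
    IsForm (i + j + 1 - k - l - ∑ i, ν i) Q ∧ (contact U W ≠ 0 →
      ∑ i, ν i + (i + j + 1 - k - l - ∑ i, ν i) = i + j + 1 - k - l) := by
  have hc := contact_isForm (e := i + j + 1 - k - l) rfl U W
  rw [h] at hc
  have hQ := IsForm.of_mul (linProd_isHomogeneous p ν) (linProd_ne_zero ν hp) hc
  refine ⟨hQ, fun hne => ?_⟩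
  rw [h] at hne
  have := hQ.pos (right_ne_zero_of_mul hne)
  omega

variable {h : Fin (N + 1) → ℂ} {μ : Fin m → ℕ} {ν : Fin m ⊕ Fin n → ℕ}

/-- The splitting of the parameters of the map into the pull-back of the hyperplane and the
rest. -/
theorem add_section_injective
    {S : Pair (k + 1) (l + 1) →ₗ[ℂ] (Fin (N + 1) → Pair (k + 1) (l + 1))}
    (hS : ∀ v, hypL N k l h (S v) = v) {κ κ' : LinearMap.ker (hypL N k l h)}
    {v v' : Pair (k + 1) (l + 1)} (heq : (κ : Fin (N + 1) → Pair (k + 1) (l + 1)) + S v = κ' + S v') :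
    κ = κ' ∧ v = v' := by
  have h1 := congrArg (hypL N k l h) heq
  rw [map_add, map_add, κ.2, κ'.2, hS, hS, zero_add, zero_add] at h1
  subst h1
  exact ⟨Subtype.ext (add_right_cancel heq), rfl⟩

theorem exists_add_section
    {S : Pair (k + 1) (l + 1) →ₗ[ℂ] (Fin (N + 1) → Pair (k + 1) (l + 1))}
    (hS : ∀ v, hypL N k l h (S v) = v) (T : Fin (N + 1) → Pair (k + 1) (l + 1)) :
    ∃ κ : LinearMap.ker (hypL N k l h), (κ : Fin (N + 1) → Pair (k + 1) (l + 1))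
      + S (hypL N k l h T) = T :=
  ⟨⟨T - S (hypL N k l h T), by rw [LinearMap.mem_ker, map_sub, hS, sub_self]⟩, by simp⟩

theorem mulPair_cancel {M : Type} [Fintype M] {μ : M → ℕ}
    (hs : hh + ∑ i, μ i = k + l) {p : M → Fin 2 → ℂ} (hp : ∀ i, p i ≠ 0) {G G' : Sec k l hh}
    (heq : mulPair k l (linProd p μ) G = mulPair k l (linProd p μ) G') : G = G' := by
  have h1 := form_mulPair hs p G
  have h2 := form_mulPair hs p G'
  rw [heq] at h1
  exact pair_ext (mul_left_cancel₀ (linProd_ne_zero μ hp) (h1.1.symm.trans h2.1))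
    (mul_left_cancel₀ (linProd_ne_zero μ hp) (h1.2.symm.trans h2.2))

/-- Since all `μ i` are positive, each point is a zero of the common factor, hence of one fixed
nonzero form. This makes the set of possible points finite. -/
theorem exists_form_of_mulPair {M : Type} [Fintype M] {μ : M → ℕ} (hμ : ∀ i, 1 ≤ μ i)
    (hs : hh + ∑ i, μ i = k + l) {p : M → Fin 2 → ℂ} (hp : ∀ i, p i ≠ 0) {G : Sec k l hh}
    (hG : Irr G) : ∃ A : MvPolynomial (Fin 2) ℂ, (∃ a, A.IsHomogeneous a) ∧ A ≠ 0 ∧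
      ∀ (p' : M → Fin 2 → ℂ) (G' : Sec k l hh),
        mulPair k l (linProd p' μ) G' = mulPair k l (linProd p μ) G → ∀ i, eval (p' i) A = 0 := by
  obtain ⟨A, hA, hA0, hAz⟩ := exists_hyp_form hG (linProd_ne_zero μ hp)
    (form_mulPair hs _ G).1 (form_mulPair hs _ G).2
  refine ⟨A, hA, hA0, fun p' G' heq i => ?_⟩
  have hf := form_mulPair hs p' G'
  rw [heq] at hf
  exact hAz _ G' _ hf.1 hf.2 (eval_linProd_eq_zero _ (by have := hμ i; omega))

set_option maxHeartbeats 1000000 in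
-- The parameters are a tuple with zero pull-back, `G`, the points, `C`, `D` and the residual
-- contact form `R`, subject only to the contact equation. Forgetting the points, `G` and `R` is
-- finite-to-one.
theorem hasDim_distinct (hkl : k ≤ l) (hne : h ≠ 0) (hμ : ∀ i, 1 ≤ μ i)
    (hν : ∀ j : Fin n, 1 ≤ ν (.inr j)) (hs : hh + ∑ i, μ i = k + l)
    (hX : {x : Amb N k l d e | Config hh h μ ν False False False x}.Nonempty) :
    ∃ a : ℕ, HasDim {x : Amb N k l d e | Config hh h μ ν False False False x} a ∧
      (a : ℤ) = N * (k + l + 2) + ((hh + 1 - l) + (hh + 1 - k) : ℕ)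
        + (m + n + ((d + 1 - l) + (d + 1 - k) : ℕ) + ((e + 1 - l) + (e + 1 - k) : ℕ)
          - ∑ i, (ν i : ℤ)) := by
  obtain ⟨⟨S, hS⟩, hrank⟩ := exists_section (k := k) (l := l) hne
  set r := d + e + 1 - k - l - ∑ i, ν i with hr
  let K := LinearMap.ker (hypL N k l h)
  let W₀ := K × Sec k l hh × ((Fin m ⊕ Fin n → ℂ) × Sec k l d × Sec k l e × (Fin r → ℂ))
  let P : (Fin m ⊕ Fin n → Bool) → (Fin m ⊕ Fin n → ℂ) → MvPolynomial (Fin 2) ℂ := fun σ s =>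
    linProd (fun i => pt (σ (.inl i)) (s (.inl i))) μ
  let Z : (Fin m ⊕ Fin n → Bool) → Set W₀ := fun σ => {z | contact z.2.2.2.1 z.2.2.2.2.1
    = linProd (fun i => pt (σ i) (z.2.2.1 i)) ν * form z.2.2.2.2.2}
  let T : (Fin m ⊕ Fin n → Bool) → W₀ → (Fin (N + 1) → Pair (k + 1) (l + 1)) := fun σ z =>
    z.1 + S (mulPair k l (P σ z.2.2.1) z.2.1)
  let π : (Fin m ⊕ Fin n → Bool) → W₀ → Amb N k l d e := fun σ z =>
    (T σ z, z.2.2.2.1, z.2.2.2.2.1)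
  have hpts : ∀ σ : Fin m ⊕ Fin n → Bool, IsPolyMap fun (z : W₀) i => pt (σ i) (z.2.2.1 i) :=
    fun σ => (isPolyMap_pts σ).comp (by fun_prop)
  have hP : ∀ σ, IsPolyMap fun z : W₀ => P σ z.2.2.1 := fun σ =>
    isPolyMap_linProd (IsPolyMap.pi fun i => (hpts σ).apply (.inl i)) μ
  have hT : ∀ σ, IsPolyMap (T σ) := fun σ =>
    ((IsPolyMap.id (V := W₀)).fst.linear K.subtype).add
      ((isPolyMap_mulPair (hP σ) (by fun_prop)).linear S)
  have hπ : ∀ σ, IsPolyMap (π σ) := fun σ => (hT σ).prodMk (by fun_prop)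
  obtain ⟨x₀, hx₀⟩ := hX
  have hsum : ∑ i, ν i + r = d + e + 1 - k - l := by
    obtain ⟨σ, s, hind, G, hG, h1, h2, h3, h4, h5, h6⟩ := hx₀.exists_chart
    obtain ⟨Q, hQ, -⟩ := h6 (fun h0 => h5.1 h0)
    exact (residual_isForm (fun i => pt_ne_zero _ _) hQ).2 (fun h0 => h5.1 h0)
  -- The number of parameters minus the number of contact equations. By `hsum`, `r` differs from the
  -- latter by the sum of the `ν i`.
  set α := m + n + ((d + 1 - l) + (d + 1 - k)) + ((e + 1 - l) + (e + 1 - k)) + r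
    - (d + e + 1 - k - l) with hα
  have hlift : ∀ x : Amb N k l d e, Config hh h μ ν False False False x →
      ∃ σ, ∃ z ∈ Z σ, LocalParamAt (Z σ) z
        (N * (k + l + 2) + (((hh + 1 - l) + (hh + 1 - k)) + α)) ∧ π σ z = x ∧ Irr z.2.1 ∧
        (∀ i j, i ≠ j → Indep (pt (σ i) (z.2.2.1 i)) (pt (σ j) (z.2.2.1 j))) ∧
        (∀ i, ν i ≠ 0 → eval (pt (σ i) (z.2.2.1 i)) (form z.2.2.2.2.2) ≠ 0) ∧
        contact z.2.1 x.2.1 ≠ 0 ∧ contact z.2.1 x.2.2 ≠ 0 ∧ contact x.2.1 x.2.2 ≠ 0 := by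
    intro x hx
    obtain ⟨σ, s, hind, G, hG, h1, h2, h3, h4, h5, h6⟩ := hx.exists_chart
    have hne' : contact x.2.1 x.2.2 ≠ 0 := fun h0 => h5.1 h0
    obtain ⟨Q, hQ, hQe⟩ := h6 hne'
    have hQf := (residual_isForm (fun i => pt_ne_zero _ _) hQ).1.form_vecL
    obtain ⟨κ, hκ⟩ := exists_add_section hS x.1
    have hhyp : hypL N k l h x.1 = mulPair k l (P σ s) G := by
      have hf := form_mulPair (k := k) (l := l) hs
        (fun i => pt (σ (.inl i)) (s (.inl i))) G
      exact pair_ext (h1.trans hf.1.symm) (h2.trans hf.2.symm)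
    have hQ' : contact x.2.1 x.2.2 = linProd (fun i => pt (σ i) (s i)) ν * form (vecL r Q) := by
      rw [hQf, hQ]
    refine ⟨σ, (κ, G, s, x.2.1, x.2.2, vecL r Q), hQ', ?_, ?_, hG, hind, ?_, fun h0 => h3.1 h0,
      fun h0 => h4.1 h0, hne'⟩
    · have := ((contact_localParam hkl rfl σ ν hsum hQ' hx.2.1 hx.2.2.1 hne' (α := α)
        (by simp only [Fintype.card_sum, Fintype.card_fin]; omega)).prod_free G).prod_free κ
      rw [hrank, finrank_prod, finrank_fin_fun, finrank_fin_fun] at this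
      exact this
    · refine Prod.ext ?_ rfl
      change (κ : Fin (N + 1) → Pair (k + 1) (l + 1)) + S (mulPair k l (P σ s) G) = x.1
      rw [← hhyp, hκ]
    · intro i hi
      change eval _ (form (vecL r Q)) ≠ 0
      rw [hQf]; exact hQe i hi
  refine ⟨N * (k + l + 2) + (((hh + 1 - l) + (hh + 1 - k)) + α), HasDim.of_charts (Z := Z) hπ ?_ ?_, ?_⟩
  · intro x hx
    obtain ⟨σ, z, hz, hl, hzx, -⟩ := hlift x hx
    exact ⟨σ, z, hz, hl, hzx⟩
  · obtain ⟨σ, z, hz, hl, hzx, hG, hind, hQe, hc1, hc2, hc3⟩ := hlift x₀ hx₀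
    have hx : Config hh h μ ν False False False (π σ z) := hzx ▸ hx₀
    rw [← hzx] at hc1 hc2 hc3
    refine ⟨σ, z, hl, ?_, ?_⟩
    · have hev := Config.eventually hkl (hh := hh) (h := h) (μ := μ) (ν := ν)
        (c₁ := False) (c₂ := False) (c₃ := False) (hT σ)
        (C := fun z : W₀ => z.2.2.2.1) (D := fun z : W₀ => z.2.2.2.2.1) (G := fun z : W₀ => z.2.1)
        (p := fun z i => pt (σ i) (z.2.2.1 i)) (Q := fun z => form z.2.2.2.2.2)
        (by fun_prop) (by fun_prop) (by fun_prop) (hpts σ) (isPolyMap_form (by fun_prop))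
        (v := z) hx.1 hx.2.1 hx.2.2.1 hG (fun i => pt_ne_zero _ _) hind (fun _ => hc1)
        (fun _ => hc2) (fun _ => hc3) (fun _ => hQe)
      filter_upwards [hev] with y hy hyZ
      have hhyp : hypL N k l h (T σ y) = mulPair k l (P σ y.2.2.1) y.2.1 := by
        rw [map_add, y.1.2, hS, zero_add]
      have hf := form_mulPair (k := k) (l := l) hs
        (fun i => pt (σ (.inl i)) (y.2.2.1 (.inl i))) y.2.1
      exact hy (by rw [hhyp]; exact hf.1) (by rw [hhyp]; exact hf.2) False.elim False.elim
        False.elim (fun _ => hyZ)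
    -- In a fibre the first `m` points are zeros of the form `A`, and the last `n` are zeros of the
    -- contact form because there `ν` is positive.
    · obtain ⟨A, hA, hA0, hAz⟩ := exists_form_of_mulPair hμ hs
        (fun i => pt_ne_zero (σ (.inl i)) (z.2.2.1 (.inl i))) hG
      have hfin := finite_params σ (p := Sum.elim (fun _ => A)
        (fun _ => contact z.2.2.2.1 z.2.2.2.2.1))
        (by rintro (i | i); exacts [hA, ⟨_, (contact_isForm rfl _ _).isHomogeneous⟩])
        (by rintro (i | i); exacts [hA0, hc3])
      refine Set.Finite.of_finite_image (f := fun y : W₀ => y.2.2.1) (hfin.subset ?_) ?_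
      · rintro _ ⟨y, ⟨hyZ, hy⟩, rfl⟩
        obtain ⟨hyT, hyC, hyD⟩ : T σ y = T σ z ∧ y.2.2.2.1 = z.2.2.2.1 ∧
          y.2.2.2.2.1 = z.2.2.2.2.1 := by simpa [π, Prod.ext_iff] using hy
        have hm := (add_section_injective hS hyT).2
        rintro (i | i)
        · exact hAz _ _ hm i
        · change eval _ (contact z.2.2.2.1 z.2.2.2.2.1) = 0
          rw [← hyC, ← hyD, hyZ, map_mul, eval_linProd_eq_zero
            (p := fun i => pt (σ i) (y.2.2.1 i)) (by have := hν i; omega), zero_mul]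
      -- Once the points are known, `G` and `R` are determined by cancelling the products of linear
      -- forms.
      · rintro ⟨κ, G, s, C, D, R⟩ ⟨hyZ, hy⟩ ⟨κ', G', s', C', D', R'⟩ ⟨hyZ', hy'⟩ hss
        obtain rfl : s = s' := hss
        obtain ⟨hyT, hyC, hyD⟩ : T σ (κ, G, s, C, D, R) = T σ (κ', G', s, C', D', R') ∧ C = C' ∧
          D = D' := by simpa [π, Prod.ext_iff] using hy.trans hy'.symm
        subst hyC hyD
        obtain ⟨rfl, hm⟩ := add_section_injective hS hyT
        obtain rfl := mulPair_cancel hs (fun i => pt_ne_zero _ _) hm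
        have hR : form R = form R' := mul_left_cancel₀
          (linProd_ne_zero ν fun i => pt_ne_zero (σ i) (s i)) (Eq.trans hyZ.symm hyZ')
        rw [form_injective hR]
  · have : ∑ i, (ν i : ℤ) = ((∑ i, ν i : ℕ) : ℤ) := by push_cast; rfl
    rw [this]
    have hα' : α + (d + e + 1 - k - l) = m + n + ((d + 1 - l) + (d + 1 - k))
      + ((e + 1 - l) + (e + 1 - k)) + r := by omega
    push_cast
    omega

end Dim

end Scroll

namespace Scroll

section Dim

open MvPolynomial Module

variable {N k l d e hh m n : ℕ}
variable {h : Fin (N + 1) → ℂ} {μ : Fin m → ℕ} {ν : Fin m ⊕ Fin n → ℕ}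

set_option maxHeartbeats 1000000 in
-- As in the distinct case, but `C` is a multiple of `G`: a single scalar replaces a second section,
-- and the contact equation is imposed on `G` and `D`.
theorem hasDim_fst_eq (hkl : k ≤ l) (hne : h ≠ 0) (hμ : ∀ i, 1 ≤ μ i)
    (hν : ∀ j : Fin n, 1 ≤ ν (.inr j)) (hs : hh + ∑ i, μ i = k + l)
    (hX : {x : Amb N k l hh e | Config hh h μ ν True False False x}.Nonempty) :
    ∃ a : ℕ, HasDim {x : Amb N k l hh e | Config hh h μ ν True False False x} a ∧
      (a : ℤ) = N * (k + l + 2) + 1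
        + (m + n + ((hh + 1 - l) + (hh + 1 - k) : ℕ) + ((e + 1 - l) + (e + 1 - k) : ℕ)
          - ∑ i, (ν i : ℤ)) := by
  obtain ⟨⟨S, hS⟩, hrank⟩ := exists_section (k := k) (l := l) hne
  set r := hh + e + 1 - k - l - ∑ i, ν i with hr
  let K := LinearMap.ker (hypL N k l h)
  let W₀ := K × ℂ × ((Fin m ⊕ Fin n → ℂ) × Sec k l hh × Sec k l e × (Fin r → ℂ))
  let P : (Fin m ⊕ Fin n → Bool) → (Fin m ⊕ Fin n → ℂ) → MvPolynomial (Fin 2) ℂ := fun σ s =>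
    linProd (fun i => pt (σ (.inl i)) (s (.inl i))) μ
  let Z : (Fin m ⊕ Fin n → Bool) → Set W₀ := fun σ => {z | contact z.2.2.2.1 z.2.2.2.2.1
    = linProd (fun i => pt (σ i) (z.2.2.1 i)) ν * form z.2.2.2.2.2}
  let T : (Fin m ⊕ Fin n → Bool) → W₀ → (Fin (N + 1) → Pair (k + 1) (l + 1)) := fun σ z =>
    z.1 + S (mulPair k l (P σ z.2.2.1) z.2.2.2.1)
  let π : (Fin m ⊕ Fin n → Bool) → W₀ → Amb N k l hh e := fun σ z =>
    (T σ z, z.2.1 • z.2.2.2.1, z.2.2.2.2.1)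
  have hpts : ∀ σ : Fin m ⊕ Fin n → Bool, IsPolyMap fun (z : W₀) i => pt (σ i) (z.2.2.1 i) :=
    fun σ => (isPolyMap_pts σ).comp (by fun_prop)
  have hP : ∀ σ, IsPolyMap fun z : W₀ => P σ z.2.2.1 := fun σ =>
    isPolyMap_linProd (IsPolyMap.pi fun i => (hpts σ).apply (.inl i)) μ
  have hT : ∀ σ, IsPolyMap (T σ) := fun σ =>
    ((IsPolyMap.id (V := W₀)).fst.linear K.subtype).add
      ((isPolyMap_mulPair (hP σ) (by fun_prop)).linear S)
  have hπ : ∀ σ, IsPolyMap (π σ) := fun σ => (hT σ).prodMk (by fun_prop)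
  obtain ⟨x₀, hx₀⟩ := hX
  have hsum : ∑ i, ν i + r = hh + e + 1 - k - l := by
    obtain ⟨σ, s, hind, G, hG, h1, h2, h3, h4, h5, h6⟩ := hx₀.exists_chart
    obtain ⟨Q, hQ, -⟩ := h6 (fun h0 => h5.1 h0)
    exact (residual_isForm (fun i => pt_ne_zero _ _) hQ).2 (fun h0 => h5.1 h0)
  set α := m + n + ((hh + 1 - l) + (hh + 1 - k)) + ((e + 1 - l) + (e + 1 - k)) + r
    - (hh + e + 1 - k - l) with hα
  have hlift : ∀ x : Amb N k l hh e, Config hh h μ ν True False False x →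
      ∃ σ, ∃ z ∈ Z σ, LocalParamAt (Z σ) z (N * (k + l + 2) + (1 + α)) ∧ π σ z = x ∧
        Irr z.2.2.2.1 ∧ z.2.1 ≠ 0 ∧
        (∀ i j, i ≠ j → Indep (pt (σ i) (z.2.2.1 i)) (pt (σ j) (z.2.2.1 j))) ∧
        (∀ i, ν i ≠ 0 → eval (pt (σ i) (z.2.2.1 i)) (form z.2.2.2.2.2) ≠ 0) ∧
        contact z.2.2.2.1 z.2.2.2.2.1 ≠ 0 := by
    intro x hx
    obtain ⟨σ, s, hind, G, hG, h1, h2, h3, h4, h5, h6⟩ := hx.exists_chart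
    obtain ⟨c, hc, hcG⟩ := hG.exists_eq_smul' hx.2.1 (h3.2 trivial)
    obtain ⟨Q, hQ, hQe⟩ := h6 (fun h0 => h5.1 h0)
    have hne' : contact G x.2.2 ≠ 0 := fun h0 => h4.1 h0
    -- The contact form of `C = c • G` is `c` times that of `G`, so the residual form is divided by
    -- `c`.
    have hQ' : contact G x.2.2 = linProd (fun i => pt (σ i) (s i)) ν * (c⁻¹ • Q) := by
      rw [mul_smul_comm, ← hQ, hcG, contact_smul_left, smul_smul, inv_mul_cancel₀ hc, one_smul]
    have hQf := (residual_isForm (fun i => pt_ne_zero _ _) hQ').1.form_vecL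
    obtain ⟨κ, hκ⟩ := exists_add_section hS x.1
    have hhyp : hypL N k l h x.1 = mulPair k l (P σ s) G := by
      have hf := form_mulPair (k := k) (l := l) hs
        (fun i => pt (σ (.inl i)) (s (.inl i))) G
      exact pair_ext (h1.trans hf.1.symm) (h2.trans hf.2.symm)
    have hR : contact G x.2.2 = linProd (fun i => pt (σ i) (s i)) ν * form (vecL r (c⁻¹ • Q)) := by
      rw [hQf, hQ']
    refine ⟨σ, (κ, c, s, G, x.2.2, vecL r (c⁻¹ • Q)), hR, ?_, ?_, hG, hc, hind, ?_, hne'⟩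
    · have := ((contact_localParam hkl rfl σ ν hsum hR hG hx.2.2.1 hne' (α := α)
        (by simp only [Fintype.card_sum, Fintype.card_fin]; omega)).prod_free c).prod_free κ
      rw [hrank, finrank_self] at this
      exact this
    · refine Prod.ext ?_ (Prod.ext hcG.symm rfl)
      change (κ : Fin (N + 1) → Pair (k + 1) (l + 1)) + S (mulPair k l (P σ s) G) = x.1
      rw [← hhyp, hκ]
    · intro i hi
      change eval _ (form (vecL r (c⁻¹ • Q))) ≠ 0
      rw [hQf, smul_eval]; exact mul_ne_zero (inv_ne_zero hc) (hQe i hi)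
  refine ⟨N * (k + l + 2) + (1 + α), HasDim.of_charts (Z := Z) hπ ?_ ?_, ?_⟩
  · intro x hx
    obtain ⟨σ, z, hz, hl, hzx, -⟩ := hlift x hx
    exact ⟨σ, z, hz, hl, hzx⟩
  · obtain ⟨σ, z, hz, hl, hzx, hG, hc0, hind, hQe, hcon⟩ := hlift x₀ hx₀
    have hx : Config hh h μ ν True False False (π σ z) := hzx ▸ hx₀
    have hcon' : contact (z.2.1 • z.2.2.2.1) z.2.2.2.2.1 ≠ 0 := by
      rw [contact_smul_left]; exact smul_ne_zero hc0 hcon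
    refine ⟨σ, z, hl, ?_, ?_⟩
    · have hev := Config.eventually hkl (hh := hh) (h := h) (μ := μ) (ν := ν)
        (c₁ := True) (c₂ := False) (c₃ := False) (hT σ)
        (C := fun z : W₀ => z.2.1 • z.2.2.2.1) (D := fun z : W₀ => z.2.2.2.2.1)
        (G := fun z : W₀ => z.2.2.2.1)
        (p := fun z i => pt (σ i) (z.2.2.1 i)) (Q := fun z => z.2.1 • form z.2.2.2.2.2)
        (by fun_prop) (by fun_prop) (by fun_prop) (hpts σ)
        (IsPolyMap.smul (by fun_prop) (isPolyMap_form (by fun_prop)))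
        (v := z) hx.1 hx.2.1 hx.2.2.1 hG (fun i => pt_ne_zero _ _) hind
        (fun hf => absurd trivial hf) (fun _ => hcon) (fun _ => hcon')
        (fun _ i hi => by rw [smul_eval]; exact mul_ne_zero hc0 (hQe i hi))
      filter_upwards [hev] with y hy hyZ
      have hhyp : hypL N k l h (T σ y) = mulPair k l (P σ y.2.2.1) y.2.2.2.1 := by
        rw [map_add, y.1.2, hS, zero_add]
      have hf := form_mulPair (k := k) (l := l) hs
        (fun i => pt (σ (.inl i)) (y.2.2.1 (.inl i))) y.2.2.2.1
      exact hy (by rw [hhyp]; exact hf.1) (by rw [hhyp]; exact hf.2)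
        (fun _ => by rw [contact_smul_right, contact_self, smul_zero]) False.elim
        False.elim (fun _ => by
          rw [contact_smul_left, mul_smul_comm]; exact congrArg (y.2.1 • ·) hyZ)
    · obtain ⟨A, hA, hA0, hAz⟩ := exists_form_of_mulPair hμ hs
        (fun i => pt_ne_zero (σ (.inl i)) (z.2.2.1 (.inl i))) hG
      have hfin := finite_params σ (p := Sum.elim (fun _ => A)
        (fun _ => contact (z.2.1 • z.2.2.2.1) z.2.2.2.2.1))
        (by rintro (i | i); exacts [hA, ⟨_, (contact_isForm rfl _ _).isHomogeneous⟩])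
        (by rintro (i | i); exacts [hA0, hcon'])
      refine Set.Finite.of_finite_image (f := fun y : W₀ => y.2.2.1) (hfin.subset ?_) ?_
      · rintro _ ⟨y, ⟨hyZ, hy⟩, rfl⟩
        obtain ⟨hyT, hyC, hyD⟩ : T σ y = T σ z ∧ y.2.1 • y.2.2.2.1 = z.2.1 • z.2.2.2.1 ∧
          y.2.2.2.2.1 = z.2.2.2.2.1 :=
          ⟨congrArg Prod.fst hy, congrArg (fun w => w.2.1) hy, congrArg (fun w => w.2.2) hy⟩
        have hm := (add_section_injective hS hyT).2
        rintro (i | i)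
        · exact hAz _ _ hm i
        · change eval _ (contact (z.2.1 • z.2.2.2.1) z.2.2.2.2.1) = 0
          rw [← hyC, ← hyD, contact_smul_left, hyZ, smul_eval, map_mul, eval_linProd_eq_zero
            (p := fun i => pt (σ i) (y.2.2.1 i)) (by have := hν i; omega), zero_mul, mul_zero]
      · rintro ⟨κ, c, s, G, D, R⟩ ⟨hyZ, hy⟩ ⟨κ', c', s', G', D', R'⟩ ⟨hyZ', hy'⟩ hss
        obtain rfl : s = s' := hss
        have hyy := hy.trans hy'.symm
        have hyT : T σ (κ, c, s, G, D, R) = T σ (κ', c', s, G', D', R') := congrArg Prod.fst hyy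
        have hyC : c • G = c' • G' := congrArg (fun w => w.2.1) hyy
        obtain rfl : D = D' := congrArg (fun w => w.2.2) hyy
        have hG0 : c • G ≠ 0 := by
          rw [show c • G = z.2.1 • z.2.2.2.1 from congrArg (fun w => w.2.1) hy]
          exact smul_ne_zero hc0 hG.ne_zero
        obtain ⟨rfl, hm⟩ := add_section_injective hS hyT
        obtain rfl := mulPair_cancel hs (fun i => pt_ne_zero _ _) hm
        obtain rfl := smul_left_injective ℂ (right_ne_zero_of_smul hG0) hyC
        have hR : form R = form R' := mul_left_cancel₀
          (linProd_ne_zero ν fun i => pt_ne_zero (σ i) (s i)) (Eq.trans hyZ.symm hyZ')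
        rw [form_injective hR]
  · have : ∑ i, (ν i : ℤ) = ((∑ i, ν i : ℕ) : ℤ) := by push_cast; rfl
    rw [this]
    have hα' : α + (hh + e + 1 - k - l) = m + n + ((hh + 1 - l) + (hh + 1 - k))
      + ((e + 1 - l) + (e + 1 - k)) + r := by omega
    push_cast
    omega

end Dim

end Scroll

namespace Scroll

section Dim

open MvPolynomial Module

variable {N k l d e hh m n : ℕ}
variable {h : Fin (N + 1) → ℂ} {μ : Fin m → ℕ} {ν : Fin m ⊕ Fin n → ℕ}

set_option maxHeartbeats 1000000 in
-- Here `D` is a multiple of `C`, so there is no contact condition and the parameter space is a full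
-- vector space. Only the `m` points in the hyperplane matter.
theorem hasDim_eq (hkl : k ≤ l) (hne : h ≠ 0) (hμ : ∀ i, 1 ≤ μ i)
    (hs : hh + ∑ i, μ i = k + l)
    (hX : {x : Amb N k l d d | Config hh h μ ν False False True x}.Nonempty) :
    ∃ a : ℕ, HasDim {x : Amb N k l d d | Config hh h μ ν False False True x} a ∧
      (a : ℤ) = N * (k + l + 2) + (m + ((hh + 1 - l) + (hh + 1 - k) : ℕ)
        + ((d + 1 - l) + (d + 1 - k) : ℕ) + 1) := by
  obtain ⟨⟨S, hS⟩, hrank⟩ := exists_section (k := k) (l := l) hne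
  let K := LinearMap.ker (hypL N k l h)
  let W₀ := K × (Fin m → ℂ) × Sec k l hh × Sec k l d × ℂ
  let P : (Fin m ⊕ Fin n → Bool) → (Fin m → ℂ) → MvPolynomial (Fin 2) ℂ := fun σ s =>
    linProd (fun i => pt (σ (.inl i)) (s i)) μ
  let T : (Fin m ⊕ Fin n → Bool) → W₀ → (Fin (N + 1) → Pair (k + 1) (l + 1)) := fun σ z =>
    z.1 + S (mulPair k l (P σ z.2.1) z.2.2.1)
  let π : (Fin m ⊕ Fin n → Bool) → W₀ → Amb N k l d d := fun σ z =>
    (T σ z, z.2.2.2.1, z.2.2.2.2 • z.2.2.2.1)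
  have hpts : ∀ σ : Fin m ⊕ Fin n → Bool, IsPolyMap fun (z : W₀) i => pt (σ (.inl i)) (z.2.1 i) :=
    fun σ => (isPolyMap_pts fun i => σ (.inl i)).comp (by fun_prop)
  have hP : ∀ σ, IsPolyMap fun z : W₀ => P σ z.2.1 := fun σ =>
    isPolyMap_linProd (hpts σ) μ
  have hT : ∀ σ, IsPolyMap (T σ) := fun σ =>
    ((IsPolyMap.id (V := W₀)).fst.linear K.subtype).add
      ((isPolyMap_mulPair (hP σ) (by fun_prop)).linear S)
  have hπ : ∀ σ, IsPolyMap (π σ) := fun σ => (hT σ).prodMk (by fun_prop)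
  obtain ⟨x₀, hx₀⟩ := hX
  have hlift : ∀ x : Amb N k l d d, Config hh h μ ν False False True x →
      ∃ σ, ∃ z : W₀, π σ z = x ∧
        Irr z.2.2.1 ∧ z.2.2.2.2 ≠ 0 ∧
        (∃ s : Fin n → ℂ, ∀ i j, i ≠ j → Indep (pt (σ i) ((Sum.elim z.2.1 s : _ → ℂ) i))
          (pt (σ j) ((Sum.elim z.2.1 s : _ → ℂ) j))) ∧
        contact z.2.2.1 z.2.2.2.1 ≠ 0 := by
    intro x hx
    obtain ⟨σ, s, hind, G, hG, h1, h2, h3, h4, h5, -⟩ := hx.exists_chart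
    obtain ⟨c, hc, hcC⟩ := hx.2.1.exists_eq_smul' hx.2.2.1 (h5.2 trivial)
    obtain ⟨κ, hκ⟩ := exists_add_section hS x.1
    have hhyp : hypL N k l h x.1 = mulPair k l (P σ fun i => s (.inl i)) G := by
      have hf := form_mulPair (k := k) (l := l) hs
        (fun i => pt (σ (.inl i)) (s (.inl i))) G
      exact pair_ext (h1.trans hf.1.symm) (h2.trans hf.2.symm)
    refine ⟨σ, (κ, fun i => s (.inl i), G, x.2.1, c), ?_, hG, hc, ⟨fun j => s (.inr j), ?_⟩,
      fun h0 => h3.1 h0⟩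
    · refine Prod.ext ?_ (Prod.ext rfl hcC.symm)
      change (κ : Fin (N + 1) → Pair (k + 1) (l + 1))
        + S (mulPair k l (P σ fun i => s (.inl i)) G) = x.1
      rw [← hhyp, hκ]
    · rw [show (Sum.elim (fun i => s (.inl i)) fun j => s (.inr j)) = s from
        Sum.elim_comp_inl_inr s]
      exact hind
  have hloc : ∀ z : W₀, LocalParamAt Set.univ z (N * (k + l + 2) + (m +
      (((hh + 1 - l) + (hh + 1 - k)) + (((d + 1 - l) + (d + 1 - k)) + 1)))) := fun z => by
    have := LocalParamAt.univ (Z := Set.univ) (fun _ => Set.mem_univ _) z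
    simpa only [W₀, K, finrank_prod, finrank_fin_fun, finrank_self, hrank] using this
  refine ⟨N * (k + l + 2) + (m +
      (((hh + 1 - l) + (hh + 1 - k)) + (((d + 1 - l) + (d + 1 - k)) + 1))),
    HasDim.of_charts (Z := fun _ : Fin m ⊕ Fin n → Bool => (Set.univ : Set W₀)) hπ ?_ ?_, ?_⟩
  · intro x hx
    obtain ⟨σ, z, hzx, -⟩ := hlift x hx
    exact ⟨σ, z, Set.mem_univ _, hloc z, hzx⟩
  · obtain ⟨σ, z, hzx, hG, hc0, ⟨s, hind⟩, hcon⟩ := hlift x₀ hx₀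
    have hx : Config hh h μ ν False False True (π σ z) := hzx ▸ hx₀
    refine ⟨σ, z, hloc z, ?_, ?_⟩
    -- The other `n` points carry no condition; they are kept fixed, and near the base point they
    -- remain distinct from the moving ones.
    · have hpp : IsPolyMap fun (y : W₀) i => pt (σ i) ((Sum.elim y.2.1 s : _ → ℂ) i) :=
        (isPolyMap_pts σ).comp (IsPolyMap.pi fun i => by
          rcases i with i | i
          · exact ((IsPolyMap.id (V := W₀)).snd.fst).apply i
          · exact IsPolyMap.const _)
      have hev := Config.eventually hkl (hh := hh) (h := h) (μ := μ) (ν := ν)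
        (c₁ := False) (c₂ := False) (c₃ := True) (hT σ)
        (C := fun z : W₀ => z.2.2.2.1) (D := fun z : W₀ => z.2.2.2.2 • z.2.2.2.1)
        (G := fun z : W₀ => z.2.2.1)
        (p := fun y i => pt (σ i) ((Sum.elim y.2.1 s : _ → ℂ) i)) (Q := fun _ => 0)
        (by fun_prop) (by fun_prop) (by fun_prop) hpp (IsPolyMap.const _)
        (v := z) hx.1 hx.2.1 hx.2.2.1 hG (fun i => pt_ne_zero _ _) hind
        (fun _ => hcon) (fun _ => by rw [contact_smul_right]; exact smul_ne_zero hc0 hcon)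
        (fun hf => absurd trivial hf) (fun hf => absurd trivial hf)
      filter_upwards [hev] with y hy _
      have hhyp : hypL N k l h (T σ y) = mulPair k l (P σ y.2.1) y.2.2.1 := by
        rw [map_add, y.1.2, hS, zero_add]
      have hf := form_mulPair (k := k) (l := l) hs
        (fun i => pt (σ (.inl i)) (y.2.1 i)) y.2.2.1
      exact hy (by rw [hhyp]; exact hf.1) (by rw [hhyp]; exact hf.2) False.elim False.elim
        (fun _ => by rw [contact_smul_right, contact_self, smul_zero])
        (fun hf => absurd trivial hf)
    · obtain ⟨A, hA, hA0, hAz⟩ := exists_form_of_mulPair hμ hs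
        (fun i => pt_ne_zero (σ (.inl i)) (z.2.1 i)) hG
      have hfin := finite_params (fun i => σ (.inl i)) (p := fun _ => A)
        (fun _ => hA) (fun _ => hA0)
      refine Set.Finite.of_finite_image (f := fun y : W₀ => y.2.1) (hfin.subset ?_) ?_
      · rintro _ ⟨y, ⟨-, hy⟩, rfl⟩
        have hyT : T σ y = T σ z := congrArg Prod.fst hy
        exact hAz _ _ (add_section_injective hS hyT).2
      · rintro ⟨κ, s, G, C, c⟩ ⟨-, hy⟩ ⟨κ', s', G', C', c'⟩ ⟨-, hy'⟩ hss
        obtain rfl : s = s' := hss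
        have hyy := hy.trans hy'.symm
        have hyT : T σ (κ, s, G, C, c) = T σ (κ', s, G', C', c') := congrArg Prod.fst hyy
        obtain rfl : C = C' := congrArg (fun w => w.2.1) hyy
        have hyD : c • C = c' • C := congrArg (fun w => w.2.2) hyy
        have hC0 : C ≠ 0 := by
          rw [show C = z.2.2.2.1 from congrArg (fun w => w.2.1) hy]
          exact hx.2.1.ne_zero
        obtain ⟨rfl, hm⟩ := add_section_injective hS hyT
        obtain rfl := mulPair_cancel hs (fun i => pt_ne_zero _ _) hm
        rw [smul_left_injective ℂ hC0 hyD]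
  · push_cast
    ring

set_option maxHeartbeats 1000000 in
-- Both sections are multiples of `G`, so two scalars are the only parameters besides those of the
-- map.
theorem hasDim_all_eq (hkl : k ≤ l) (hne : h ≠ 0) (hμ : ∀ i, 1 ≤ μ i)
    (hs : hh + ∑ i, μ i = k + l)
    (hX : {x : Amb N k l hh hh | Config hh h μ ν True True True x}.Nonempty) :
    ∃ a : ℕ, HasDim {x : Amb N k l hh hh | Config hh h μ ν True True True x} a ∧
      (a : ℤ) = N * (k + l + 2) + (m + ((hh + 1 - l) + (hh + 1 - k) : ℕ) + 2) := by
  obtain ⟨⟨S, hS⟩, hrank⟩ := exists_section (k := k) (l := l) hne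
  let K := LinearMap.ker (hypL N k l h)
  let W₀ := K × (Fin m → ℂ) × Sec k l hh × ℂ × ℂ
  let P : (Fin m ⊕ Fin n → Bool) → (Fin m → ℂ) → MvPolynomial (Fin 2) ℂ := fun σ s =>
    linProd (fun i => pt (σ (.inl i)) (s i)) μ
  let T : (Fin m ⊕ Fin n → Bool) → W₀ → (Fin (N + 1) → Pair (k + 1) (l + 1)) := fun σ z =>
    z.1 + S (mulPair k l (P σ z.2.1) z.2.2.1)
  let π : (Fin m ⊕ Fin n → Bool) → W₀ → Amb N k l hh hh := fun σ z =>
    (T σ z, z.2.2.2.1 • z.2.2.1, z.2.2.2.2 • z.2.2.1)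
  have hpts : ∀ σ : Fin m ⊕ Fin n → Bool, IsPolyMap fun (z : W₀) i => pt (σ (.inl i)) (z.2.1 i) :=
    fun σ => (isPolyMap_pts fun i => σ (.inl i)).comp (by fun_prop)
  have hP : ∀ σ, IsPolyMap fun z : W₀ => P σ z.2.1 := fun σ =>
    isPolyMap_linProd (hpts σ) μ
  have hT : ∀ σ, IsPolyMap (T σ) := fun σ =>
    ((IsPolyMap.id (V := W₀)).fst.linear K.subtype).add
      ((isPolyMap_mulPair (hP σ) (by fun_prop)).linear S)
  have hπ : ∀ σ, IsPolyMap (π σ) := fun σ => (hT σ).prodMk (by fun_prop)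
  obtain ⟨x₀, hx₀⟩ := hX
  have hlift : ∀ x : Amb N k l hh hh, Config hh h μ ν True True True x →
      ∃ σ, ∃ z : W₀, π σ z = x ∧
        Irr z.2.2.1 ∧ z.2.2.2.1 ≠ 0 ∧ z.2.2.2.2 ≠ 0 ∧
        (∃ s : Fin n → ℂ, ∀ i j, i ≠ j → Indep (pt (σ i) ((Sum.elim z.2.1 s : _ → ℂ) i))
          (pt (σ j) ((Sum.elim z.2.1 s : _ → ℂ) j))) := by
    intro x hx
    obtain ⟨σ, s, hind, G, hG, h1, h2, h3, h4, h5, -⟩ := hx.exists_chart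
    obtain ⟨c, hc, hcC⟩ := hG.exists_eq_smul' hx.2.1 (h3.2 trivial)
    obtain ⟨c', hc', hcD⟩ := hG.exists_eq_smul' hx.2.2.1 (h4.2 trivial)
    obtain ⟨κ, hκ⟩ := exists_add_section hS x.1
    have hhyp : hypL N k l h x.1 = mulPair k l (P σ fun i => s (.inl i)) G := by
      have hf := form_mulPair (k := k) (l := l) hs
        (fun i => pt (σ (.inl i)) (s (.inl i))) G
      exact pair_ext (h1.trans hf.1.symm) (h2.trans hf.2.symm)
    refine ⟨σ, (κ, fun i => s (.inl i), G, c, c'), ?_, hG, hc, hc', ⟨fun j => s (.inr j), ?_⟩⟩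
    · refine Prod.ext ?_ (Prod.ext hcC.symm hcD.symm)
      change (κ : Fin (N + 1) → Pair (k + 1) (l + 1))
        + S (mulPair k l (P σ fun i => s (.inl i)) G) = x.1
      rw [← hhyp, hκ]
    · rw [show (Sum.elim (fun i => s (.inl i)) fun j => s (.inr j)) = s from
        Sum.elim_comp_inl_inr s]
      exact hind
  have hloc : ∀ z : W₀, LocalParamAt Set.univ z (N * (k + l + 2) + (m +
      (((hh + 1 - l) + (hh + 1 - k)) + (1 + 1)))) := fun z => by
    have := LocalParamAt.univ (Z := Set.univ) (fun _ => Set.mem_univ _) z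
    simpa only [W₀, K, finrank_prod, finrank_fin_fun, finrank_self, hrank] using this
  refine ⟨N * (k + l + 2) + (m + (((hh + 1 - l) + (hh + 1 - k)) + (1 + 1))),
    HasDim.of_charts (Z := fun _ : Fin m ⊕ Fin n → Bool => (Set.univ : Set W₀)) hπ ?_ ?_, ?_⟩
  · intro x hx
    obtain ⟨σ, z, hzx, -⟩ := hlift x hx
    exact ⟨σ, z, Set.mem_univ _, hloc z, hzx⟩
  · obtain ⟨σ, z, hzx, hG, hc0, hc0', ⟨s, hind⟩⟩ := hlift x₀ hx₀
    have hx : Config hh h μ ν True True True (π σ z) := hzx ▸ hx₀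
    refine ⟨σ, z, hloc z, ?_, ?_⟩
    · have hpp : IsPolyMap fun (y : W₀) i => pt (σ i) ((Sum.elim y.2.1 s : _ → ℂ) i) :=
        (isPolyMap_pts σ).comp (IsPolyMap.pi fun i => by
          rcases i with i | i
          · exact ((IsPolyMap.id (V := W₀)).snd.fst).apply i
          · exact IsPolyMap.const _)
      have hev := Config.eventually hkl (hh := hh) (h := h) (μ := μ) (ν := ν)
        (c₁ := True) (c₂ := True) (c₃ := True) (hT σ)
        (C := fun z : W₀ => z.2.2.2.1 • z.2.2.1) (D := fun z : W₀ => z.2.2.2.2 • z.2.2.1)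
        (G := fun z : W₀ => z.2.2.1)
        (p := fun y i => pt (σ i) ((Sum.elim y.2.1 s : _ → ℂ) i)) (Q := fun _ => 0)
        (by fun_prop) (by fun_prop) (by fun_prop) hpp (IsPolyMap.const _)
        (v := z) hx.1 hx.2.1 hx.2.2.1 hG (fun i => pt_ne_zero _ _) hind
        (fun hf => absurd trivial hf) (fun hf => absurd trivial hf)
        (fun hf => absurd trivial hf) (fun hf => absurd trivial hf)
      filter_upwards [hev] with y hy _
      have hhyp : hypL N k l h (T σ y) = mulPair k l (P σ y.2.1) y.2.2.1 := by
        rw [map_add, y.1.2, hS, zero_add]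
      have hf := form_mulPair (k := k) (l := l) hs
        (fun i => pt (σ (.inl i)) (y.2.1 i)) y.2.2.1
      exact hy (by rw [hhyp]; exact hf.1) (by rw [hhyp]; exact hf.2)
        (fun _ => by rw [contact_smul_right, contact_self, smul_zero])
        (fun _ => by rw [contact_smul_right, contact_self, smul_zero])
        (fun _ => by rw [contact_smul_right, contact_smul_left, contact_self, smul_zero, smul_zero])
        (fun hf => absurd trivial hf)
    · obtain ⟨A, hA, hA0, hAz⟩ := exists_form_of_mulPair hμ hs
        (fun i => pt_ne_zero (σ (.inl i)) (z.2.1 i)) hG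
      have hfin := finite_params (fun i => σ (.inl i)) (p := fun _ => A)
        (fun _ => hA) (fun _ => hA0)
      refine Set.Finite.of_finite_image (f := fun y : W₀ => y.2.1) (hfin.subset ?_) ?_
      · rintro _ ⟨y, ⟨-, hy⟩, rfl⟩
        have hyT : T σ y = T σ z := congrArg Prod.fst hy
        exact hAz _ _ (add_section_injective hS hyT).2
      · rintro ⟨κ, s, G, c, c'⟩ ⟨-, hy⟩ ⟨κ', s', G', b, b'⟩ ⟨-, hy'⟩ hss
        obtain rfl : s = s' := hss
        have hyy := hy.trans hy'.symm
        have hyT : T σ (κ, s, G, c, c') = T σ (κ', s, G', b, b') := congrArg Prod.fst hyy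
        have hyC : c • G = b • G' := congrArg (fun w => w.2.1) hyy
        have hyD : c' • G = b' • G' := congrArg (fun w => w.2.2) hyy
        have hG0 : c • G ≠ 0 := by
          rw [show c • G = z.2.2.2.1 • z.2.2.1 from congrArg (fun w => w.2.1) hy]
          exact smul_ne_zero hc0 hG.ne_zero
        obtain ⟨rfl, hm⟩ := add_section_injective hS hyT
        obtain rfl := mulPair_cancel hs (fun i => pt_ne_zero _ _) hm
        rw [smul_left_injective ℂ (right_ne_zero_of_smul hG0) hyC,
          smul_left_injective ℂ (right_ne_zero_of_smul hG0) hyD]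
  · push_cast
    ring

/-- Exchanging the two sections. -/
def swapAmb (N k l d e : ℕ) : Amb N k l d e ≃ₗ[ℂ] Amb N k l e d :=
  (LinearEquiv.refl ℂ _).prodCongr (LinearEquiv.prodComm ℂ _ _)

theorem Config.swap {c₁ c₂ c₃ : Prop} {x : Amb N k l d e} (hx : Config hh h μ ν c₁ c₂ c₃ x) :
    Config hh h μ ν c₂ c₁ c₃ (swapAmb N k l d e x) := by
  obtain ⟨h1, h2, h3, p, hp, hind, G, hG, h4, h5, h6, h7, h8, h9⟩ := hx
  have hsw := contact_swap x.2.1 x.2.2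
  refine ⟨h1, h3, h2, p, hp, hind, G, hG, h4, h5, h7, h6, ?_, fun hne => ?_⟩
  · change contact x.2.2 x.2.1 = 0 ↔ c₃
    rw [hsw, neg_eq_zero, h8]
  · change contact x.2.2 x.2.1 ≠ 0 at hne
    obtain ⟨Q, hQ, hQe⟩ := h9 (by rwa [hsw, neg_ne_zero] at hne)
    refine ⟨-Q, ?_, fun i hi => by rw [map_neg, neg_ne_zero]; exact hQe i hi⟩
    change contact x.2.2 x.2.1 = _
    rw [hsw, hQ, mul_neg]

theorem config_swap_image (c₁ c₂ c₃ : Prop) :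
    swapAmb N k l d e '' {x | Config hh h μ ν c₁ c₂ c₃ x} = {x | Config hh h μ ν c₂ c₁ c₃ x} := by
  ext x
  constructor
  · rintro ⟨y, hy, rfl⟩
    exact hy.swap
  · intro hx
    exact ⟨swapAmb N k l e d x, hx.swap, rfl⟩

theorem hasDim_snd_eq (hkl : k ≤ l) (hne : h ≠ 0) (hμ : ∀ i, 1 ≤ μ i)
    (hν : ∀ j : Fin n, 1 ≤ ν (.inr j)) (hs : hh + ∑ i, μ i = k + l)
    (hX : {x : Amb N k l d hh | Config hh h μ ν False True False x}.Nonempty) :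
    ∃ a : ℕ, HasDim {x : Amb N k l d hh | Config hh h μ ν False True False x} a ∧
      (a : ℤ) = N * (k + l + 2) + 1
        + (m + n + ((hh + 1 - l) + (hh + 1 - k) : ℕ) + ((d + 1 - l) + (d + 1 - k) : ℕ)
          - ∑ i, (ν i : ℤ)) := by
  obtain ⟨a, ha, haz⟩ := hasDim_fst_eq (N := N) (e := d) hkl hne hμ hν hs
    (by rw [← config_swap_image]; exact hX.image _)
  exact ⟨a, config_swap_image (N := N) (k := k) (l := l) (d := hh) (e := d) (h := h) (μ := μ)
    (ν := ν) (hh := hh) True False False ▸ ha.image_equiv (swapAmb N k l hh d), haz⟩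

end Dim

end Scroll

namespace Scroll

/-! ## Marked maps -/

section Marked

open MvPolynomial Module

variable {N k l d e hh m n : ℕ}

/-- The coordinates of a datum. -/
def toAmb (N k l d e : ℕ) : (Idx N k l d e → ℂ) ≃ₗ[ℂ] Amb N k l d e where
  toFun x := (fun i => (fun j => x (.inl (i, .inl j)), fun j => x (.inl (i, .inr j))),
    (fun j => x (.inr (.inl (.inl j))), fun j => x (.inr (.inl (.inr j)))),
    (fun j => x (.inr (.inr (.inl j))), fun j => x (.inr (.inr (.inr j)))))
  invFun y := Sum.elim (fun i => Sum.elim (y.1 i.1).1 (y.1 i.1).2 i.2)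
    (Sum.elim (Sum.elim y.2.1.1 y.2.1.2) (Sum.elim y.2.2.1 y.2.2.2))
  map_add' _ _ := rfl
  map_smul' _ _ := rfl
  left_inv x := by
    ext i
    rcases i with ⟨i, j | j⟩ | (j | j) | (j | j) <;> rfl
  right_inv _ := rfl

theorem form_hypL (h : Fin (N + 1) → ℂ) (x : Idx N k l d e → ℂ) :
    form (hypL N k l h (toAmb N k l d e x).1).1 = ∑ i, C (h i) * secA x i ∧
    form (hypL N k l h (toAmb N k l d e x).1).2 = ∑ i, C (h i) * secB x i := by
  rw [hypL_apply, Prod.fst_sum, Prod.snd_sum, ← formL_apply, ← formL_apply, map_sum, map_sum]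
  constructor <;>
  · refine Finset.sum_congr rfl fun i _ => ?_
    simp only [Prod.smul_fst, Prod.smul_snd, map_smul, smul_eq_C_mul]
    rfl

theorem eval_form_eq_dotProduct {n : ℕ} (c : Fin (n + 1) → ℂ) (t : Fin 2 → ℂ) :
    eval t (form c) = c ⬝ᵥ veronese n t := by
  simp [form, dotProduct, veronese, mul_assoc]

/-- The vector which spans the point of the standard scroll with given coordinates. -/
def scrollPt (k l : ℕ) (z : Coord) : Pair (k + 1) (l + 1) :=
  (z.x • veronese k z.t, z.y • veronese l z.t)

/-- The map is the standard scroll followed by the linear map `tmap`, so that questions about the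
image become linear algebra. -/
theorem values_eq (x : Idx N k l d e → ℂ) (z : Coord) :
    values x z = tmap N k l (toAmb N k l d e x).1 (scrollPt k l z) := by
  ext i
  change eval z.t (secA x i) * z.x + eval z.t (secB x i) * z.y
    = ((toAmb N k l d e x).1 i).1 ⬝ᵥ (z.x • veronese k z.t)
      + ((toAmb N k l d e x).1 i).2 ⬝ᵥ (z.y • veronese l z.t)
  rw [dotProduct_smul, dotProduct_smul, secA, secB, eval_form_eq_dotProduct,
    eval_form_eq_dotProduct, smul_eq_mul, smul_eq_mul, mul_comm, mul_comm z.y]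
  rfl

theorem dotProduct_values (h : Fin (N + 1) → ℂ) (x : Idx N k l d e → ℂ) (z : Coord) :
    h ⬝ᵥ values x z = eval z.t (form (hypL N k l h (toAmb N k l d e x).1).1) * z.x
      + eval z.t (form (hypL N k l h (toAmb N k l d e x).1).2) * z.y := by
  rw [(form_hypL h x).1, (form_hypL h x).2, map_sum, map_sum, Finset.sum_mul, Finset.sum_mul,
    ← Finset.sum_add_distrib]
  refine Finset.sum_congr rfl fun i _ => ?_
  simp only [map_mul, eval_C, values]
  ring

theorem veronese_ne_zero (n : ℕ) {t : Fin 2 → ℂ} (ht : t ≠ 0) : veronese n t ≠ 0 := by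
  obtain ⟨R, hR⟩ := exists_form_eval_ne_zero (Nat.succ_pos n) ht
  rw [eval_form_eq_dotProduct] at hR
  intro h0
  rw [h0, dotProduct_zero] at hR
  exact hR rfl

theorem scrollPt_ne_zero (k l : ℕ) (z : Coord) : scrollPt k l z ≠ 0 := by
  intro h0
  rcases z.fibre_ne with h | h
  · exact smul_ne_zero h (veronese_ne_zero k z.base_ne) (congrArg Prod.fst h0)
  · exact smul_ne_zero h (veronese_ne_zero l z.base_ne) (congrArg Prod.snd h0)

theorem eq_zero_of_eval_eq_zero {p : MvPolynomial (Fin 2) ℂ}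
    (h : ∀ t : Fin 2 → ℂ, t ≠ 0 → eval t p = 0) : p = 0 := by
  -- The hypothesis does not cover the origin; the factor `X 0` vanishes there and is cancelled
  -- afterwards.
  have h1 : p * X 0 = 0 := by
    refine MvPolynomial.funext fun t => ?_
    rw [map_mul, eval_X, map_zero]
    by_cases ht : t = 0
    · simp [ht]
    · rw [h t ht, zero_mul]
  exact (mul_eq_zero.1 h1).resolve_right (X_ne_zero 0)

theorem eq_zero_of_dotProduct_scrollPt {c : Pair (k + 1) (l + 1)}
    (h : ∀ z, c.1 ⬝ᵥ (scrollPt k l z).1 + c.2 ⬝ᵥ (scrollPt k l z).2 = 0) : c = 0 := by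
  have h1 : form c.1 = 0 := eq_zero_of_eval_eq_zero fun t ht => by
    have := h ⟨t, 1, 0, ht, Or.inl one_ne_zero⟩
    simpa [scrollPt, eval_form_eq_dotProduct] using this
  have h2 : form c.2 = 0 := eq_zero_of_eval_eq_zero fun t ht => by
    have := h ⟨t, 0, 1, ht, Or.inr one_ne_zero⟩
    simpa [scrollPt, eval_form_eq_dotProduct] using this
  exact Prod.ext (form_eq_zero_iff.1 h1) (form_eq_zero_iff.1 h2)

/-- A functional that vanishes on the scroll consists of the coefficients of two binary forms that
vanish at every nonzero vector. -/
theorem span_scrollPt (k l : ℕ) : Submodule.span ℂ (Set.range (scrollPt k l)) = ⊤ := by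
  by_contra hne
  obtain ⟨f, hf0, hf⟩ := Submodule.exists_le_ker_of_lt_top _ (lt_top_iff_ne_top.2 hne)
  apply hf0
  let c : Pair (k + 1) (l + 1) := (fun i => f (Pi.single i 1, 0), fun i => f (0, Pi.single i 1))
  have hc : ∀ v : Pair (k + 1) (l + 1), f v = c.1 ⬝ᵥ v.1 + c.2 ⬝ᵥ v.2 := by
    intro v
    have h1 : v = ∑ i, v.1 i • ((Pi.single i 1, 0) : Pair (k + 1) (l + 1))
        + ∑ i, v.2 i • ((0, Pi.single i 1) : Pair (k + 1) (l + 1)) := by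
      refine Prod.ext ?_ ?_
      · simp [Prod.fst_sum, ← Pi.single_smul, Finset.univ_sum_single]
      · simp [Prod.snd_sum, ← Pi.single_smul, Finset.univ_sum_single]
    conv_lhs => rw [h1]
    simp only [map_add, map_sum, map_smul, smul_eq_mul, dotProduct, c, mul_comm]
  have hc0 : c = 0 := eq_zero_of_dotProduct_scrollPt fun z => by
    rw [← hc]
    exact hf (Submodule.subset_span ⟨z, rfl⟩)
  ext v <;> simp [hc, hc0]

theorem values_ne_zero {x : Idx N k l d e → ℂ} (hx : NonDeg (toAmb N k l d e x).1) (z : Coord) :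
    values x z ≠ 0 := by
  rw [values_eq, Ne, map_eq_zero_iff _ hx]
  exact scrollPt_ne_zero k l z

/-- Every scroll in the statement spans a space of dimension `k + l + 2`. It lies in the range of
`tmap`, whose source has this dimension, so `tmap` is injective. -/
theorem nonDeg_of_isScroll {x : Idx N k l d e → ℂ} {M : MarkedMap (l - k) N}
    (hM : Represents x M) (hS : IsScroll k l (Set.range M.π)) : NonDeg (toAmb N k l d e x).1 := by
  obtain ⟨T, hT, hST⟩ := hS
  have hle : LinearMap.range T ≤ LinearMap.range (tmap N k l (toAmb N k l d e x).1) := by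
    rw [LinearMap.range_eq_map, ← span_scrollPt, Submodule.map_span_le]
    rintro _ ⟨z, rfl⟩
    have hne : T (scrollPt k l z) ≠ 0 := by
      rw [Ne, map_eq_zero_iff _ hT]; exact scrollPt_ne_zero k l z
    have hmem : Projectivization.mk ℂ _ hne ∈ Set.range M.π := hST ▸ ⟨z, rfl⟩
    obtain ⟨P, hP⟩ := hmem
    obtain ⟨z', rfl⟩ := Quotient.exists_rep P
    obtain ⟨hz', hv⟩ := hM.1 z'
    have := hP.symm.trans hv
    obtain ⟨a, ha⟩ := (Projectivization.mk_eq_mk_iff' ℂ _ _ _ _).1 this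
    exact ⟨a • scrollPt k l z', by rw [map_smul, ← values_eq, ha]⟩
  have h1 := Submodule.finrank_mono hle
  rw [LinearMap.finrank_range_of_inj hT] at h1
  have h2 := (tmap N k l (toAmb N k l d e x).1).finrank_range_add_finrank_ker
  have h3 : finrank ℂ (LinearMap.ker (tmap N k l (toAmb N k l d e x).1)) = 0 := by
    change finrank ℂ (Pair (k + 1) (l + 1)) ≤ _ at h1
    omega
  exact LinearMap.ker_eq_bot.1 (Submodule.finrank_eq_zero.1 h3)

/-- The weight `l - k` of `x` makes up for the difference of the degrees of the two rational normal
curves; hence maps are well defined on points. -/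
theorem scrollPt_smul (hkl : k ≤ l) {z z' : Coord} {a b : ℂ} (ht : z'.t = a • z.t)
    (hx : z'.x = b * a ^ (l - k) * z.x) (hy : z'.y = b * z.y) :
    scrollPt k l z' = (b * a ^ l) • scrollPt k l z := by
  have hv : ∀ n, veronese n z'.t = a ^ n • veronese n z.t := by
    intro n
    ext i
    have hi : a ^ n = a ^ (i : ℕ) * a ^ (n - (i : ℕ)) := by
      rw [← pow_add]; congr 1; have := i.2; omega
    simp only [veronese, ht, Pi.smul_apply, smul_eq_mul, mul_pow, hi]
    ring
  refine Prod.ext ?_ ?_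
  · simp only [scrollPt, hv, hx, Prod.smul_fst, smul_smul]
    congr 1
    rw [show l = (l - k) + k by omega, pow_add, Nat.add_sub_cancel]
    ring
  · simp only [scrollPt, hv, hy, Prod.smul_snd, smul_smul]
    congr 1
    ring

/-- The marked map of a datum. -/
theorem exists_represents (hkl : k ≤ l) {x : Idx N k l d e → ℂ}
    (hx : NonDeg (toAmb N k l d e x).1) : ∃ M : MarkedMap (l - k) N, Represents x M := by
  refine ⟨⟨Quotient.lift (fun z => Projectivization.mk ℂ (values x z) (values_ne_zero hx z)) ?_,
    _, _⟩, fun z => ⟨values_ne_zero hx z, rfl⟩, rfl, rfl⟩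
  rintro z z' ⟨a, b, ha, hb, ht, hxx, hy⟩
  rw [eq_comm, Projectivization.mk_eq_mk_iff']
  exact ⟨b * a ^ l, by rw [values_eq, values_eq, scrollPt_smul hkl ht hxx hy, map_smul]⟩

theorem Represents.isScroll {x : Idx N k l d e → ℂ} {M : MarkedMap (l - k) N}
    (hM : Represents x M) (hx : NonDeg (toAmb N k l d e x).1) : IsScroll k l (Set.range M.π) := by
  refine ⟨tmap N k l (toAmb N k l d e x).1, hx, Set.ext fun Q => ⟨?_, ?_⟩⟩
  · rintro ⟨P, rfl⟩
    obtain ⟨z, rfl⟩ := Quotient.exists_rep P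
    obtain ⟨hz, h⟩ := hM.1 z
    refine ⟨z, ?_⟩
    rw [show M.π ⟦z⟧ = _ from h, Projectivization.submodule_mk, values_eq]
    rfl
  · rintro ⟨z, hz⟩
    obtain ⟨hv, h⟩ := hM.1 z
    refine ⟨Hirzebruch.mk (l - k) z, Projectivization.submodule_injective ?_⟩
    rw [h, Projectivization.submodule_mk, values_eq, hz]
    rfl

/-! ### Curves -/

theorem eval_curve_smul {j : ℕ} (hkl : k ≤ l) (U : Sec k l j) {z z' : Coord} {a b : ℂ}
    (ht : z'.t = a • z.t) (hx : z'.x = b * a ^ (l - k) * z.x) (hy : z'.y = b * z.y) :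
    eval z'.t (form U.1) * z'.x + eval z'.t (form U.2) * z'.y
      = b * a ^ (j - k) * (eval z.t (form U.1) * z.x + eval z.t (form U.2) * z.y) := by
  have h1 : eval z'.t (form U.1) * a ^ (l - k) = a ^ (j - k) * eval z.t (form U.1) := by
    by_cases h0 : form U.1 = 0
    · simp [h0]
    · have := (form_isForm U.1).pos h0
      rw [ht, eval_smul_of_isHomogeneous (form_isForm U.1).isHomogeneous, mul_right_comm, ← pow_add]
      congr 2
      omega
  have h2 : eval z'.t (form U.2) = a ^ (j - k) * eval z.t (form U.2) := by
    rw [ht, eval_smul_of_isHomogeneous (form_isForm U.2).isHomogeneous]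
    congr 2
    omega
  rw [hx, hy, h2]
  linear_combination b * z.x * h1

theorem mk_mem_curve {j : ℕ} (hkl : k ≤ l) (U : Sec k l j) (z : Coord) :
    Hirzebruch.mk (l - k) z ∈ curve (l - k) (form U.1) (form U.2) ↔
      eval z.t (form U.1) * z.x + eval z.t (form U.2) * z.y = 0 := by
  constructor
  · rintro ⟨z', hz', h⟩
    obtain ⟨a, b, ha, hb, ht, hx, hy⟩ := Quotient.exact hz'
    rw [eval_curve_smul hkl U ht hx hy, h, mul_zero]
  · exact fun h => ⟨z, rfl, h⟩

/-- The point of an irreducible section on a given fibre. -/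
noncomputable def Irr.coord {a b : ℕ} {U : Pair a b} (hU : Irr U) {t : Fin 2 → ℂ} (ht : t ≠ 0) :
    Coord :=
  ⟨t, eval t (form U.2), - eval t (form U.1), ht, (hU t ht).symm.imp_right neg_ne_zero.2⟩

theorem Irr.coord_mem {j : ℕ} {U : Sec k l j} (hU : Irr U) {t : Fin 2 → ℂ} (ht : t ≠ 0) :
    Hirzebruch.mk (l - k) (hU.coord ht) ∈ curve (l - k) (form U.1) (form U.2) :=
  ⟨hU.coord ht, rfl, by simp only [Irr.coord]; ring⟩

/-- Along the parametrization `t ↦ (t; U₂(t), -U₁(t))` of the first curve the equation of the second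
is the contact form. -/
theorem contact_eq_zero_of_curve_subset {i j : ℕ} (hkl : k ≤ l) {U : Sec k l i} (hU : Irr U)
    {W : Sec k l j} (h : curve (l - k) (form U.1) (form U.2) ⊆ curve (l - k) (form W.1) (form W.2)) :
    contact U W = 0 := by
  refine eq_zero_of_eval_eq_zero fun t ht => ?_
  have := (mk_mem_curve hkl W _).1 (h (hU.coord_mem ht))
  simp only [Irr.coord] at this
  simp only [contact, map_sub, map_mul]
  linear_combination this

theorem curve_eq_iff {i j : ℕ} (hkl : k ≤ l) {U : Sec k l i} (hU : Irr U)
    {W : Sec k l j} (hW : Irr W) :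
    curve (l - k) (form U.1) (form U.2) = curve (l - k) (form W.1) (form W.2) ↔
      contact U W = 0 := by
  refine ⟨fun h => contact_eq_zero_of_curve_subset hkl hU h.le, fun h => ?_⟩
  obtain ⟨-, c, hc, h1, h2⟩ := hU.exists_eq_smul hW h
  ext P
  obtain ⟨z, rfl⟩ := Quotient.exists_rep P
  have := (mk_mem_curve hkl U z).trans (Iff.trans ?_ (mk_mem_curve hkl W z).symm)
  · exact this
  · rw [h1, h2]
    simp only [map_mul, eval_C, mul_assoc, ← mul_add]
    exact (mul_eq_zero_iff_left hc).symm

/-- If `k < l`, a section of degree `k` has no `x` term, so up to a scalar its equation is `y = 0`.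
Conversely, equal irreducible sections have equal degrees. -/
theorem isDirectrix_iff {j : ℕ} (hkl : k ≤ l) {U : Sec k l j} (hU : Irr U) :
    IsDirectrix (curve (l - k) (form U.1) (form U.2)) ↔ k < l ∧ j = k := by
  have key : k < l → ∃ E : Sec k l k, Irr E ∧ form E.1 = 0 ∧ form E.2 = 1 := by
    intro hlt
    have h1 : IsForm (k + 1 - k) (1 : MvPolynomial (Fin 2) ℂ) := by
      rw [show k + 1 - k = 1 by omega]
      exact isForm_succ.2 (isHomogeneous_one _ _)
    have h0 : form (0 : Fin (k + 1 - l) → ℂ) = 0 := form_eq_zero_iff.2 rfl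
    exact ⟨(0, vecL _ 1), fun t ht => by simp [h1.form_vecL], h0, h1.form_vecL⟩
  constructor
  · rintro ⟨hr, h⟩
    have hlt : k < l := by omega
    obtain ⟨E, hE, hE1, hE2⟩ := key hlt
    rw [← hE1, ← hE2, curve_eq_iff hkl hU hE] at h
    exact ⟨hlt, (hU.exists_eq_smul hE h).1⟩
  · rintro ⟨hlt, rfl⟩
    refine ⟨by omega, ?_⟩
    obtain ⟨E, hE, hE1, hE2⟩ := key hlt
    rw [← hE1, ← hE2, curve_eq_iff hkl hU hE]
    have hU1 : form U.1 = 0 := by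
      by_contra hne
      have := (form_isForm U.1).pos hne
      omega
    rw [contact, hE1, hU1]; ring

/-- The hyperplane pulls back to `P` times the equation of `G`. Along the curve of `U` this is `P`
times a contact form, and the nonzero factor `P` cancels. -/
theorem liesIn_iff {j : ℕ} (hkl : k ≤ l) {x : Idx N k l d e → ℂ} {M : MarkedMap (l - k) N}
    (hM : Represents x M) {h : Fin (N + 1) → ℂ} {P : MvPolynomial (Fin 2) ℂ} (hP : P ≠ 0)
    {G : Sec k l hh} (hG : Irr G)
    (h1 : form (hypL N k l h (toAmb N k l d e x).1).1 = P * form G.1)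
    (h2 : form (hypL N k l h (toAmb N k l d e x).1).2 = P * form G.2)
    {U : Sec k l j} (hU : Irr U) :
    M.LiesIn h (curve (l - k) (form U.1) (form U.2)) ↔ contact G U = 0 := by
  have hz : ∀ z, h ⬝ᵥ (M.π (Hirzebruch.mk (l - k) z)).rep = 0 ↔
      eval z.t P * (eval z.t (form G.1) * z.x + eval z.t (form G.2) * z.y) = 0 := by
    intro z
    obtain ⟨hv, hz⟩ := hM.1 z
    obtain ⟨a, ha⟩ := Projectivization.exists_smul_eq_mk_rep ℂ _ hv
    have ha' : (a : ℂ) • values x z = (Projectivization.mk ℂ (values x z) hv).rep := ha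
    rw [hz, ← ha', dotProduct_smul, smul_eq_zero_iff_right a.ne_zero, dotProduct_values, h1, h2,
      map_mul, map_mul]
    ring_nf
  constructor
  · intro hL
    rw [contact_swap, neg_eq_zero]
    refine (mul_eq_zero.1 (eq_zero_of_eval_eq_zero (p := P * contact U G) fun t ht => ?_)).resolve_left hP
    have := (hz _).1 (hL _ (hU.coord_mem ht))
    simp only [Irr.coord] at this
    simp only [contact, map_sub, map_mul]
    linear_combination this
  · intro h0 Q hQ
    rw [← (curve_eq_iff hkl hG hU).2 h0] at hQ
    obtain ⟨z, rfl⟩ := Quotient.exists_rep Q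
    exact (hz z).2 (by rw [(mk_mem_curve hkl G z).1 hQ, mul_zero])

end Marked

end Scroll

/-! ### Orders of vanishing, and the loci as sets of configurations -/

namespace Scroll

section Locus

open MvPolynomial Module

variable {N k l d e hh m n : ℕ}

theorem emultiplicity_lin_eq_zero {v : Fin 2 → ℂ} {t : ℕ} {p : MvPolynomial (Fin 2) ℂ}
    (hp : p.IsHomogeneous t) (hv : v ≠ 0) (h : eval v p ≠ 0) : emultiplicity (lin v) p = 0 :=
  emultiplicity_eq_zero.2 fun hd => h ((lin_dvd_iff hp hv).1 hd)

theorem emultiplicity_lin_linProd {M : Type} [Fintype M] {p : M → Fin 2 → ℂ} {ν : M → ℕ}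
    (hp : ∀ i, p i ≠ 0) (hind : ∀ i j, i ≠ j → Indep (p i) (p j)) (i : M) :
    emultiplicity (lin (p i)) (linProd p ν) = ν i := by
  classical
  rw [linProd, Finset.emultiplicity_prod (lin_prime (hp i)), Finset.sum_eq_single i]
  · have hf : ¬ IsUnit (lin (p i)) := (lin_prime (hp i)).not_isUnit
    exact emultiplicity_pow_self (lin_ne_zero (hp i)) hf _
  · intro j _ hj
    refine emultiplicity_lin_eq_zero ((lin_isHomogeneous _).pow _) (hp i) ?_
    rw [map_pow, eval_lin]
    exact pow_ne_zero _ (hind i j hj.symm)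
  · simp

theorem emultiplicity_lin_linProd_eq_zero {M : Type} [Fintype M] {p : M → Fin 2 → ℂ} {ν : M → ℕ}
    {v : Fin 2 → ℂ} (hv : v ≠ 0) (hind : ∀ i, Indep v (p i)) :
    emultiplicity (lin v) (linProd p ν) = 0 := by
  refine emultiplicity_lin_eq_zero (linProd_isHomogeneous p ν) hv ?_
  rw [linProd, map_prod]
  refine Finset.prod_ne_zero_iff.2 fun j _ => ?_
  rw [map_pow, eval_lin]
  exact pow_ne_zero _ (hind j)

theorem linProd_dvd {M : Type} [Fintype M] {p : M → Fin 2 → ℂ} {ν : M → ℕ}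
    (hp : ∀ i, p i ≠ 0) (hind : ∀ i j, i ≠ j → Indep (p i) (p j)) {a : MvPolynomial (Fin 2) ℂ}
    (h : ∀ i, (ν i : ℕ∞) ≤ emultiplicity (lin (p i)) a) : linProd p ν ∣ a :=
  Fintype.prod_dvd_of_isRelPrime (fun i j hij => (hind i j hij).isRelPrime (hp i) _ _)
    fun i => pow_dvd_of_le_emultiplicity (h i)

theorem indep_rep {q q' : Projectivization ℂ (Fin 2 → ℂ)} (h : q ≠ q') : Indep q.rep q'.rep := by
  intro h0
  apply h
  rw [← q.mk_rep, ← q'.mk_rep, Projectivization.mk_eq_mk_iff']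
  obtain ⟨i, hi⟩ := Function.ne_iff.1 q'.rep_nonzero
  refine ⟨q.rep i / q'.rep i, ?_⟩
  rw [Pi.zero_apply] at hi
  ext j
  rw [Pi.smul_apply, smul_eq_mul, div_mul_eq_mul_div, div_eq_iff hi]
  fin_cases i <;> fin_cases j <;> simp <;>
    first | linear_combination h0 | linear_combination -h0

theorem mk_ne_mk {v w : Fin 2 → ℂ} (hv : v ≠ 0) (hw : w ≠ 0) (h : Indep v w) :
    Projectivization.mk ℂ v hv ≠ Projectivization.mk ℂ w hw := by
  intro heq
  obtain ⟨a, rfl⟩ := (Projectivization.mk_eq_mk_iff' ℂ _ _ _ _).1 heq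
  apply h
  simp only [Pi.smul_apply, smul_eq_mul]
  ring

theorem emultiplicity_linearForm_mk {v : Fin 2 → ℂ} (hv : v ≠ 0) (a : MvPolynomial (Fin 2) ℂ) :
    emultiplicity (linearForm (Projectivization.mk ℂ v hv)) a = emultiplicity (lin v) a := by
  obtain ⟨c, hc⟩ := Projectivization.exists_smul_eq_mk_rep ℂ v hv
  have hc' : (c : ℂ) • v = (Projectivization.mk ℂ v hv).rep := hc
  rw [linearForm_eq_lin, ← hc', lin_smul]
  have hassoc : Associated (lin v) (C (c : ℂ) * lin v) :=
    ⟨Units.map (C : ℂ →+* MvPolynomial (Fin 2) ℂ).toMonoidHom c, mul_comm _ _⟩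
  exact emultiplicity_eq_of_associated_left hassoc

/-- The order of a multiple of an irreducible section along a fibre. -/
theorem fibreOrder_mul {G : Sec k l hh} (hG : Irr G) {P : MvPolynomial (Fin 2) ℂ}
    (q : Projectivization ℂ (Fin 2 → ℂ)) :
    fibreOrder (P * form G.1) (P * form G.2) q = emultiplicity (linearForm q) P := by
  have hpr : Prime (linearForm q) := lin_prime q.rep_nonzero
  rw [fibreOrder, emultiplicity_mul hpr, emultiplicity_mul hpr, min_add_add_left]
  rcases hG q.rep q.rep_nonzero with h | h
  · rw [linearForm_eq_lin,
      emultiplicity_lin_eq_zero (form_isForm G.1).isHomogeneous q.rep_nonzero h]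
    simp
  · rw [linearForm_eq_lin,
      emultiplicity_lin_eq_zero (form_isForm G.2).isHomogeneous q.rep_nonzero h]
    simp

variable {μ : Fin m → ℕ}

/-- The residual section of the pull-back of the hyperplane. -/
theorem exists_residual (hs : ∑ i, μ i ≤ k + l → hh + ∑ i, μ i = k + l)
    {v : Pair (k + 1) (l + 1)} {p : Fin m → Projectivization ℂ (Fin 2 → ℂ)}
    (hp : Function.Injective p) (h1 : ∀ i, fibreOrder (form v.1) (form v.2) (p i) = μ i)
    (h0 : ∀ q, (∀ i, q ≠ p i) → fibreOrder (form v.1) (form v.2) q = 0) :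
    ∑ i, μ i ≤ k + l ∧ ∃ G : Sec k l hh, Irr G ∧
      form v.1 = linProd (fun i => (p i).rep) μ * form G.1 ∧
      form v.2 = linProd (fun i => (p i).rep) μ * form G.2 := by
  have hp0 : ∀ i, (p i).rep ≠ 0 := fun i => (p i).rep_nonzero
  have hind : ∀ i j, i ≠ j → Indep (p i).rep (p j).rep := fun i j hij => indep_rep (hp.ne hij)
  -- Finite orders along all fibres exclude that the pull-back of the hyperplane is identically
  -- zero.
  have hfin : ∀ q, fibreOrder (form v.1) (form v.2) q ≠ ⊤ := by
    intro q
    by_cases hq : ∀ i, q ≠ p i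
    · rw [h0 q hq]; exact ENat.zero_ne_top
    · push Not at hq
      obtain ⟨i, rfl⟩ := hq
      rw [h1 i]; exact ENat.natCast_ne_top _
  have hv0 : form v.1 ≠ 0 ∨ form v.2 ≠ 0 := by
    by_contra hcon
    push Not at hcon
    apply hfin (Projectivization.mk ℂ ![1, 0] (by simp))
    rw [fibreOrder, hcon.1, hcon.2, emultiplicity_zero, min_self]
  obtain ⟨a, ha⟩ : linProd (fun i => (p i).rep) μ ∣ form v.1 :=
    linProd_dvd hp0 hind fun i => (h1 i).symm.le.trans (min_le_left _ _)
  obtain ⟨b, hb⟩ : linProd (fun i => (p i).rep) μ ∣ form v.2 :=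
    linProd_dvd hp0 hind fun i => (h1 i).symm.le.trans (min_le_right _ _)
  have hL := linProd_isHomogeneous (fun i => (p i).rep) μ
  have hL0 := linProd_ne_zero μ hp0
  have ha' := IsForm.of_mul hL hL0 (ha ▸ form_isForm v.1)
  have hb' := IsForm.of_mul hL hL0 (hb ▸ form_isForm v.2)
  have hle : ∑ i, μ i ≤ k + l := by
    rcases hv0 with hne | hne
    · have := ha'.pos (right_ne_zero_of_mul (ha ▸ hne)); omega
    · have := hb'.pos (right_ne_zero_of_mul (hb ▸ hne)); omega
  have hs' := hs hle
  rw [show k + 1 - ∑ i, μ i = hh + 1 - l by omega] at ha'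
  rw [show l + 1 - ∑ i, μ i = hh + 1 - k by omega] at hb'
  refine ⟨hle, (vecL _ a, vecL _ b), ?_, ?_, ?_⟩
  · rw [Irr, ha'.form_vecL, hb'.form_vecL]
    intro t ht
    by_contra hcon
    push Not at hcon
    have hda : lin t ∣ a := (lin_dvd_iff ha'.isHomogeneous ht).2 hcon.1
    have hdb : lin t ∣ b := (lin_dvd_iff hb'.isHomogeneous ht).2 hcon.2
    set q := Projectivization.mk ℂ t ht with hq
    have hpr : Prime (linearForm q) := lin_prime q.rep_nonzero
    -- A common zero of `a` and `b` would raise the order along that fibre by one above the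
    -- prescribed value.
    have hge : emultiplicity (linearForm q) (linProd (fun i => (p i).rep) μ) + 1
        ≤ fibreOrder (form v.1) (form v.2) q := by
      rw [fibreOrder, ha, hb, emultiplicity_mul hpr, emultiplicity_mul hpr, min_add_add_left]
      gcongr
      rw [hq, emultiplicity_linearForm_mk, emultiplicity_linearForm_mk]
      refine le_min ?_ ?_
      · exact le_emultiplicity_of_pow_dvd (k := 1) (by simpa using hda)
      · exact le_emultiplicity_of_pow_dvd (k := 1) (by simpa using hdb)
    by_cases hqp : ∀ i, q ≠ p i
    · rw [h0 q hqp] at hge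
      simp at hge
    · push Not at hqp
      obtain ⟨i, hi⟩ := hqp
      rw [hi, h1 i, linearForm_eq_lin, emultiplicity_lin_linProd hp0 hind i] at hge
      have : μ i + 1 ≤ μ i := by exact_mod_cast hge
      omega
  · rw [ha'.form_vecL]; exact ha
  · rw [hb'.form_vecL]; exact hb

/-- At distinct points the linear forms are coprime, so prescribed orders mean divisibility by their
product with a quotient that is nonzero where `ν i ≠ 0`. Points with `ν i = 0` contribute the factor
1 and no condition. -/
theorem exists_contact_residual {i j : ℕ} {U : Sec k l i} {W : Sec k l j} {M : Type} [Fintype M]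
    {p : M → Fin 2 → ℂ} {ν : M → ℕ} (hp : ∀ i, p i ≠ 0)
    (hind : ∀ i j, i ≠ j → Indep (p i) (p j)) :
    (∀ i, ν i ≠ 0 → emultiplicity (lin (p i)) (contact U W) = ν i) ↔
      ∃ Q, contact U W = linProd p ν * Q ∧ ∀ i, ν i ≠ 0 → eval (p i) Q ≠ 0 := by
  constructor
  · intro h
    obtain ⟨Q, hQ⟩ : linProd p ν ∣ contact U W := linProd_dvd hp hind fun i => by
      by_cases hi : ν i = 0
      · simp [hi]
      · exact (h i hi).ge
    refine ⟨Q, hQ, fun i hi h0 => ?_⟩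
    have hd : lin (p i) ∣ Q := (lin_dvd_iff (residual_isForm hp hQ).1.isHomogeneous (hp i)).2 h0
    have h1 := h i hi
    rw [hQ, emultiplicity_mul (lin_prime (hp i)), emultiplicity_lin_linProd hp hind] at h1
    have h2 : (1 : ℕ∞) ≤ emultiplicity (lin (p i)) Q :=
      le_emultiplicity_of_pow_dvd (k := 1) (by simpa using hd)
    have h3 : (ν i : ℕ∞) + 1 ≤ ν i := by
      conv_rhs => rw [← h1]
      gcongr
    have : ν i + 1 ≤ ν i := by exact_mod_cast h3
    omega
  · rintro ⟨Q, hQ, hQe⟩ i hi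
    rw [hQ, emultiplicity_mul (lin_prime (hp i)), emultiplicity_lin_linProd hp hind,
      emultiplicity_lin_eq_zero (residual_isForm hp hQ).1.isHomogeneous (hp i) (hQe i hi), add_zero]

variable {ν : Fin m ⊕ Fin n → ℕ} {h : Fin (N + 1) → ℂ}

theorem sum_le_of_mem_locus {Q : MarkedMap (l - k) N → Prop} {x : Idx N k l d e → ℂ}
    (hx : x ∈ locus N k l d e h μ ν Q) : ∑ i, μ i ≤ k + l := by
  obtain ⟨M, hM, hS, hC, hD, hQ, p, hp, h1, h0, h2⟩ := hx
  simp only [hyperplaneContact, ← (form_hypL h x).1, ← (form_hypL h x).2] at h1 h0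
  exact (exists_residual (hh := k + l - ∑ i, μ i) (by omega)
    (hp.comp Sum.inl_injective) h1 h0).1

/-- The coincidences of the residual section `G`, and the sections `C` and `D`, in terms of the
marked map. -/
theorem locus_eq_config (hkl : k ≤ l) (hs : hh + ∑ i, μ i = k + l)
    {Q : MarkedMap (l - k) N → Prop} {c₁ c₂ c₃ : Prop}
    (hQ : ∀ (M : MarkedMap (l - k) N) (G : Sec k l hh) (C : Sec k l d) (D : Sec k l e), Irr G →
      Irr C → Irr D → M.C = curve (l - k) (form C.1) (form C.2) →
      M.D = curve (l - k) (form D.1) (form D.2) →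
      (M.LiesIn h M.C ↔ contact G C = 0) → (M.LiesIn h M.D ↔ contact G D = 0) →
      (Q M ↔ ((contact G C = 0 ↔ c₁) ∧ (contact G D = 0 ↔ c₂) ∧ (contact C D = 0 ↔ c₃)))) :
    locus N k l d e h μ ν Q = toAmb N k l d e ⁻¹' {y | Config hh h μ ν c₁ c₂ c₃ y} := by
  ext x
  constructor
  · rintro ⟨M, hM, hS, hC, hD, hQM, p, hp, h1, h0, h2⟩
    have hnd := nonDeg_of_isScroll hM hS
    simp only [hyperplaneContact, ← (form_hypL h x).1, ← (form_hypL h x).2] at h1 h0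
    obtain ⟨-, G, hG, hG1, hG2⟩ := exists_residual (hh := hh) (fun _ => hs)
      (hp.comp Sum.inl_injective) h1 h0
    have hp0 : ∀ i, (p i).rep ≠ 0 := fun i => (p i).rep_nonzero
    have hind : ∀ i j, i ≠ j → Indep (p i).rep (p j).rep := fun i j hij => indep_rep (hp.ne hij)
    have hL0 := linProd_ne_zero μ fun i => hp0 (.inl i)
    have hC' : Irr (toAmb N k l d e x).2.1 := hC
    have hD' : Irr (toAmb N k l d e x).2.2 := hD
    have hMC : M.C = curve (l - k) (form (toAmb N k l d e x).2.1.1) (form (toAmb N k l d e x).2.1.2) :=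
      hM.2.1
    have hMD : M.D = curve (l - k) (form (toAmb N k l d e x).2.2.1) (form (toAmb N k l d e x).2.2.2) :=
      hM.2.2
    have hLC : M.LiesIn h M.C ↔ contact G (toAmb N k l d e x).2.1 = 0 := by
      rw [hMC]; exact liesIn_iff hkl hM hL0 hG hG1 hG2 hC'
    have hLD : M.LiesIn h M.D ↔ contact G (toAmb N k l d e x).2.2 = 0 := by
      rw [hMD]; exact liesIn_iff hkl hM hL0 hG hG1 hG2 hD'
    obtain ⟨q1, q2, q3⟩ := (hQ M G _ _ hG hC' hD' hMC hMD hLC hLD).1 hQM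
    refine ⟨hnd, hC', hD', fun i => (p i).rep, hp0, hind, G, hG, hG1, hG2, q1, q2, q3, ?_⟩
    intro hne
    refine (exists_contact_residual hp0 hind).1 (h2 ?_)
    rw [hMC, hMD]
    exact fun heq => hne ((curve_eq_iff hkl hC' hD').1 heq)
  -- Conversely, nondegeneracy yields a marked map with image a scroll, and irreducibility of `G`
  -- makes the powers of the linear forms the exact orders of contact.
  · rintro ⟨hnd, hC, hD, p, hp0, hind, G, hG, hG1, hG2, q1, q2, q3, q4⟩
    obtain ⟨M, hM⟩ := exists_represents hkl hnd
    have hL0 := linProd_ne_zero μ fun i => hp0 (.inl i)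
    have hMC : M.C = curve (l - k) (form (toAmb N k l d e x).2.1.1) (form (toAmb N k l d e x).2.1.2) :=
      hM.2.1
    have hMD : M.D = curve (l - k) (form (toAmb N k l d e x).2.2.1) (form (toAmb N k l d e x).2.2.2) :=
      hM.2.2
    have hLC : M.LiesIn h M.C ↔ contact G (toAmb N k l d e x).2.1 = 0 := by
      rw [hMC]; exact liesIn_iff hkl hM hL0 hG hG1 hG2 hC
    have hLD : M.LiesIn h M.D ↔ contact G (toAmb N k l d e x).2.2 = 0 := by
      rw [hMD]; exact liesIn_iff hkl hM hL0 hG hG1 hG2 hD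
    refine ⟨M, hM, hM.isScroll hnd, hC, hD,
      (hQ M G _ _ hG hC hD hMC hMD hLC hLD).2 ⟨q1, q2, q3⟩,
      fun i => Projectivization.mk ℂ (p i) (hp0 i), ?_, ?_, ?_, ?_⟩
    · intro i j hij
      by_contra hne
      exact mk_ne_mk (hp0 i) (hp0 j) (hind i j hne) hij
    · intro i
      rw [hyperplaneContact, ← (form_hypL h x).1, ← (form_hypL h x).2, hG1, hG2, fibreOrder_mul hG,
        emultiplicity_linearForm_mk]
      exact emultiplicity_lin_linProd (p := fun i => p (.inl i)) (fun i => hp0 _)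
        (fun i j hij => hind _ _ (Sum.inl_injective.ne hij)) i
    · intro q hq
      rw [hyperplaneContact, ← (form_hypL h x).1, ← (form_hypL h x).2, hG1, hG2, fibreOrder_mul hG]
      refine emultiplicity_lin_linProd_eq_zero q.rep_nonzero fun i h0 => ?_
      have hne := indep_rep (hq i)
      obtain ⟨c, hc⟩ := Projectivization.exists_smul_eq_mk_rep ℂ (p (.inl i)) (hp0 (.inl i))
      have hc' : (c : ℂ) • p (.inl i) = _ := hc
      rw [← hc'] at hne
      apply hne
      simp only [Pi.smul_apply, smul_eq_mul]
      linear_combination (c : ℂ) * h0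
    · intro hne i hi
      rw [hMC, hMD] at hne
      have hne' : contact (toAmb N k l d e x).2.1 (toAmb N k l d e x).2.2 ≠ 0 :=
        fun h0 => hne ((curve_eq_iff hkl hC hD).2 h0)
      rw [contactOrder, emultiplicity_linearForm_mk]
      exact (exists_contact_residual hp0 hind).2 (q4 hne') i hi

end Locus

end Scroll

namespace Scroll

/-! ## Automorphisms -/

section Transform

open MvPolynomial Module

variable {N k l d e hh m n : ℕ}

/-- The coefficients of an automorphism of a ruled surface. -/
@[ext] structure RuledData (r : ℕ) where
  g : Matrix (Fin 2) (Fin 2) ℂ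
  a : ℂ
  b : ℂ
  c : ℂ
  f : Fin (r + 1) → ℂ
  c_eq_zero : 0 < r → c = 0

/-- The coefficients define an automorphism. -/
def RuledData.Valid {r : ℕ} (γ : RuledData r) : Prop :=
  γ.g.det ≠ 0 ∧ γ.a * γ.b - γ.c * γ.f 0 ≠ 0

/-- A linear substitution. -/
noncomputable def substL (g : Matrix (Fin 2) (Fin 2) ℂ) :
    MvPolynomial (Fin 2) ℂ →ₐ[ℂ] MvPolynomial (Fin 2) ℂ :=
  aeval fun i => C (g i 0) * X 0 + C (g i 1) * X 1

theorem eval_substL (g : Matrix (Fin 2) (Fin 2) ℂ) (t : Fin 2 → ℂ) (p : MvPolynomial (Fin 2) ℂ) :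
    eval t (substL g p) = eval (g.mulVec t) p := by
  have h : (eval t).comp (substL g : MvPolynomial (Fin 2) ℂ →+* MvPolynomial (Fin 2) ℂ)
      = eval (g.mulVec t) := by
    refine MvPolynomial.ringHom_ext (fun r => ?_) fun i => ?_
    · simp [substL]
    · simp [substL]; fin_cases i <;> rfl
  exact RingHom.congr_fun h p

theorem substL_isForm {n : ℕ} {p : MvPolynomial (Fin 2) ℂ} (hp : IsForm n p)
    (g : Matrix (Fin 2) (Fin 2) ℂ) : IsForm n (substL g p) := by
  rcases n with - | n
  · rw [hp.eq_zero, map_zero]; exact IsForm.zero 0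
  · rw [isForm_succ] at hp ⊢
    have hX : ∀ i, (C (g i 0) * X 0 + C (g i 1) * X 1 : MvPolynomial (Fin 2) ℂ).IsHomogeneous 1 := by
      intro i
      have h := fun (c : ℂ) (i : Fin 2) => (isHomogeneous_C (Fin 2) c).mul (isHomogeneous_X ℂ i)
      exact (h _ _).add (h _ _)
    have := hp.aeval (fun i => C (g i 0) * X 0 + C (g i 1) * X 1) hX
    rwa [one_mul] at this

theorem mulVec_ne_zero {g : Matrix (Fin 2) (Fin 2) ℂ} (hg : g.det ≠ 0) {t : Fin 2 → ℂ}
    (ht : t ≠ 0) : g.mulVec t ≠ 0 := fun h0 => ht (Matrix.eq_zero_of_mulVec_eq_zero hg h0)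

theorem substL_eq_zero_iff {g : Matrix (Fin 2) (Fin 2) ℂ} (hg : g.det ≠ 0)
    {p : MvPolynomial (Fin 2) ℂ} : substL g p = 0 ↔ p = 0 := by
  refine ⟨fun h => eq_zero_of_eval_eq_zero fun t ht => ?_, fun h => by rw [h, map_zero]⟩
  have := congrArg (eval (g⁻¹.mulVec t)) h
  rwa [eval_substL, Matrix.mulVec_mulVec, Matrix.mul_nonsing_inv _ (isUnit_iff_ne_zero.2 hg),
    Matrix.one_mulVec, map_zero] at this

theorem substL_lin (g : Matrix (Fin 2) (Fin 2) ℂ) (v : Fin 2 → ℂ) :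
    substL g (lin (g.mulVec v)) = C g.det * lin v := by
  refine MvPolynomial.funext fun t => ?_
  rw [eval_substL, eval_lin, map_mul, eval_lin, eval_C, Matrix.det_fin_two]
  simp only [Matrix.mulVec, dotProduct, Fin.sum_univ_two]
  ring

theorem substL_linProd {M : Type} [Fintype M] (g : Matrix (Fin 2) (Fin 2) ℂ) (p : M → Fin 2 → ℂ)
    (ν : M → ℕ) : substL g (linProd (fun i => g.mulVec (p i)) ν)
      = C (g.det ^ ∑ i, ν i) * linProd p ν := by
  rw [linProd, linProd, map_prod, ← Finset.prod_pow_eq_pow_sum, map_prod,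
    ← Finset.prod_mul_distrib]
  refine Finset.prod_congr rfl fun i _ => ?_
  rw [map_pow, substL_lin, mul_pow, C_pow]

/-- The sizes of pairs of forms on which the automorphisms of `F_r` act. -/
def Compat (r a b : ℕ) : Prop := (r = 0 → a = b) ∧ (0 < a → b = a + r)

theorem compat_sec (hkl : k ≤ l) (j : ℕ) : Compat (l - k) (j + 1 - l) (j + 1 - k) := by
  constructor <;> omega

theorem compat_map (hkl : k ≤ l) : Compat (l - k) (k + 1) (l + 1) := by
  constructor <;> omega

variable {r a b a' b' : ℕ}

/-- The pull-back of a section under an automorphism. -/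
noncomputable def RuledData.act (γ : RuledData r) (U : Pair a b) : Pair a b :=
  (vecL a (C γ.a * substL γ.g (form U.1) + C γ.c * substL γ.g (form U.2)),
    vecL b (form γ.f * substL γ.g (form U.1) + C γ.b * substL γ.g (form U.2)))

/-- Either `c = 0` or `f` has degree zero; so the determinant `a b - c f` of the fibre
transformation is constant on the base. -/
theorem RuledData.c_mul_form (γ : RuledData r) : C γ.c * form γ.f = C (γ.c * γ.f 0) := by
  rcases Nat.eq_zero_or_pos r with rfl | hr
  · simp [form]
  · simp [γ.c_eq_zero hr]

namespace RuledData

variable (γ : RuledData r)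

theorem form_act (h : Compat r a b) (U : Pair a b) :
    form (γ.act U).1 = C γ.a * substL γ.g (form U.1) + C γ.c * substL γ.g (form U.2) ∧
    form (γ.act U).2 = form γ.f * substL γ.g (form U.1) + C γ.b * substL γ.g (form U.2) := by
  have h1 := substL_isForm (form_isForm U.1) γ.g
  have h2 := substL_isForm (form_isForm U.2) γ.g
  constructor
  · refine IsForm.form_vecL ((h1.C_mul _).add ?_)
    rcases Nat.eq_zero_or_pos r with hr | hr
    · have hab := h.1 hr
      subst hab
      exact h2.C_mul _
    · rw [γ.c_eq_zero hr, C_0, zero_mul]; exact IsForm.zero _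
  · refine IsForm.form_vecL (IsForm.add ?_ (h2.C_mul _))
    refine (form_isForm γ.f).mul_of_le h1 fun _ hp => ?_
    have := h.2 (h1.pos hp)
    omega

theorem eval_act (h : Compat r a b) (U : Pair a b) (t : Fin 2 → ℂ) (x y : ℂ) :
    eval t (form (γ.act U).1) * x + eval t (form (γ.act U).2) * y
      = eval (γ.g.mulVec t) (form U.1) * (γ.a * x + eval t (form γ.f) * y)
        + eval (γ.g.mulVec t) (form U.2) * (γ.c * x + γ.b * y) := by
  rw [(γ.form_act h U).1, (γ.form_act h U).2]
  simp only [map_add, map_mul, eval_C, eval_substL]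
  ring

theorem act_add (U W : Pair a b) : γ.act (U + W) = γ.act U + γ.act W := by
  simp only [act, ← formL_apply, Prod.fst_add, Prod.snd_add, map_add, mul_add]
  ext i <;> simp <;> ring

theorem act_smul (s : ℂ) (U : Pair a b) : γ.act (s • U) = s • γ.act U := by
  simp only [act, ← formL_apply, Prod.smul_fst, Prod.smul_snd, map_smul, mul_smul_comm, ← smul_add]
  rfl

/-- The action as a linear map. -/
noncomputable def actL : Pair a b →ₗ[ℂ] Pair a b where
  toFun := γ.act
  map_add' := γ.act_add
  map_smul' := γ.act_smul

/-- The contact form is a determinant of two pairs, so it is multiplied by the determinant of the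
fibre transformation. -/
theorem contact_act (h : Compat r a b) (h' : Compat r a' b') (U : Pair a b) (W : Pair a' b') :
    contact (γ.act U) (γ.act W)
      = C (γ.a * γ.b - γ.c * γ.f 0) * substL γ.g (contact U W) := by
  rw [contact, contact, (γ.form_act h U).1, (γ.form_act h U).2, (γ.form_act h' W).1,
    (γ.form_act h' W).2, C_sub, ← γ.c_mul_form, C_mul, map_sub, map_mul, map_mul]
  ring

variable {γ}

theorem Valid.contact_act_eq_zero_iff (hγ : γ.Valid) (h : Compat r a b) (h' : Compat r a' b')
    {U : Pair a b} {W : Pair a' b'} : contact (γ.act U) (γ.act W) = 0 ↔ contact U W = 0 := by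
  rw [γ.contact_act h h', mul_eq_zero, substL_eq_zero_iff hγ.1, C_eq_zero, or_iff_right hγ.2]

theorem Valid.fibre_ne (hγ : γ.Valid) (t : Fin 2 → ℂ) {x y : ℂ} (h : x ≠ 0 ∨ y ≠ 0) :
    γ.a * x + eval t (form γ.f) * y ≠ 0 ∨ γ.c * x + γ.b * y ≠ 0 := by
  by_contra hcon
  push Not at hcon
  have hc := congrArg (eval t) γ.c_mul_form
  rw [map_mul, eval_C, eval_C] at hc
  have h1 : (γ.a * γ.b - γ.c * γ.f 0) * x = 0 := by
    rw [← hc]; linear_combination γ.b * hcon.1 - eval t (form γ.f) * hcon.2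
  have h2 : (γ.a * γ.b - γ.c * γ.f 0) * y = 0 := by
    rw [← hc]; linear_combination γ.a * hcon.2 - γ.c * hcon.1
  rcases h with h | h
  · exact h ((mul_eq_zero.1 h1).resolve_left hγ.2)
  · exact h ((mul_eq_zero.1 h2).resolve_left hγ.2)

theorem Valid.irr_act (hγ : γ.Valid) (h : Compat r a b) {U : Pair a b} (hU : Irr U) :
    Irr (γ.act U) := by
  intro t ht
  by_contra hcon
  push Not at hcon
  -- The columns of the adjugate of the fibre matrix are inserted; they isolate each form of `U`,
  -- multiplied by the determinant.
  have h1 := γ.eval_act h U t γ.b (-γ.c)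
  have h2 := γ.eval_act h U t (- eval t (form γ.f)) γ.a
  rw [hcon.1, hcon.2] at h1 h2
  have hc := congrArg (eval t) γ.c_mul_form
  rw [map_mul, eval_C, eval_C] at hc
  rcases hU _ (mulVec_ne_zero hγ.1 ht) with h0 | h0
  · refine mul_ne_zero h0 hγ.2 ?_
    linear_combination -h1 + eval (γ.g.mulVec t) (form U.1) * hc
  · refine mul_ne_zero h0 hγ.2 ?_
    linear_combination -h2 + eval (γ.g.mulVec t) (form U.2) * hc

/-- The action on homogeneous coordinates. -/
noncomputable def Valid.coord (hγ : γ.Valid) (z : Coord) : Coord :=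
  ⟨γ.g.mulVec z.t, γ.a * z.x + eval z.t (form γ.f) * z.y, γ.c * z.x + γ.b * z.y,
    mulVec_ne_zero hγ.1 z.base_ne, hγ.fibre_ne z.t z.fibre_ne⟩

theorem Valid.coord_rel (hγ : γ.Valid) {z z' : Coord} (h : (coordSetoid r).r z z') :
    (coordSetoid r).r (hγ.coord z) (hγ.coord z') := by
  obtain ⟨a, b, ha, hb, ht, hx, hy⟩ := h
  have hf : eval z'.t (form γ.f) = a ^ r * eval z.t (form γ.f) := by
    rw [ht, eval_smul_of_isHomogeneous (form_isForm γ.f).isHomogeneous, Nat.add_sub_cancel]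
  refine ⟨a, b, ha, hb, ?_, ?_, ?_⟩
  · simp only [Valid.coord, ht, Matrix.mulVec_smul]
  · simp only [Valid.coord, hf, hx, hy]; ring
  · simp only [Valid.coord, hx, hy]
    rcases Nat.eq_zero_or_pos r with hr | hr
    · simp only [hr, pow_zero]; ring
    · rw [γ.c_eq_zero hr]; ring

/-- The action on points. -/
noncomputable def Valid.map (hγ : γ.Valid) : Hirzebruch r → Hirzebruch r :=
  Quotient.map' hγ.coord fun _ _ => hγ.coord_rel

theorem Valid.map_mk (hγ : γ.Valid) (z : Coord) :
    hγ.map (Hirzebruch.mk r z) = Hirzebruch.mk r (hγ.coord z) := rfl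

/-- The coefficients of the inverse. -/
noncomputable def symm (γ : RuledData r) : RuledData r where
  g := γ.g⁻¹
  a := γ.b
  b := γ.a
  c := -γ.c
  f := vecL (r + 1) (- substL γ.g⁻¹ (form γ.f))
  c_eq_zero hr := by rw [γ.c_eq_zero hr, neg_zero]

theorem form_symm_f (γ : RuledData r) : form γ.symm.f = - substL γ.g⁻¹ (form γ.f) :=
  IsForm.form_vecL (substL_isForm (form_isForm γ.f) _).neg

theorem Valid.symm (hγ : γ.Valid) : γ.symm.Valid := by
  refine ⟨?_, ?_⟩
  · rw [RuledData.symm, Matrix.det_nonsing_inv, Ring.inverse_eq_inv']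
    exact inv_ne_zero hγ.1
  · intro h0
    apply hγ.2
    have h1 := γ.symm.c_mul_form
    have h2 : C γ.c * substL γ.g⁻¹ (form γ.f) = C (γ.c * γ.f 0) := by
      have := congrArg (substL γ.g⁻¹) γ.c_mul_form
      rw [map_mul] at this
      simpa [substL] using this
    rw [form_symm_f] at h1
    have h3 : C (γ.symm.c * γ.symm.f 0) = (C (γ.c * γ.f 0) : MvPolynomial (Fin 2) ℂ) := by
      rw [← h1, ← h2]; simp [RuledData.symm]
    rw [C_injective _ _ h3] at h0
    rw [← h0]
    simp only [RuledData.symm]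
    ring

theorem Valid.coord_symm_coord (hγ : γ.Valid) (z : Coord) :
    Hirzebruch.mk r (hγ.symm.coord (hγ.coord z)) = Hirzebruch.mk r z := by
  have hc := congrArg (eval z.t) γ.c_mul_form
  rw [map_mul, eval_C, eval_C] at hc
  -- The inverse is defined with the adjugate, so the composite multiplies the fibre coordinates by
  -- the determinant; this disappears in homogeneous coordinates.
  refine Quotient.sound ⟨1, (γ.a * γ.b - γ.c * γ.f 0)⁻¹, one_ne_zero, inv_ne_zero hγ.2, ?_, ?_, ?_⟩
  · simp only [Valid.coord, RuledData.symm, Matrix.mulVec_mulVec, Matrix.nonsing_inv_mul _ (isUnit_iff_ne_zero.2 hγ.1), Matrix.one_mulVec, one_smul]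
  · rw [one_pow, mul_one, eq_inv_mul_iff_mul_eq₀ hγ.2]
    simp only [Valid.coord, form_symm_f, map_neg, eval_substL, Matrix.mulVec_mulVec,
      Matrix.nonsing_inv_mul _ (isUnit_iff_ne_zero.2 hγ.1), Matrix.one_mulVec]
    simp only [RuledData.symm]
    linear_combination z.x * hc
  · rw [eq_inv_mul_iff_mul_eq₀ hγ.2]
    simp only [Valid.coord]
    simp only [RuledData.symm]
    linear_combination z.y * hc

theorem Valid.coord_coord_symm (hγ : γ.Valid) (z : Coord) :
    Hirzebruch.mk r (hγ.coord (hγ.symm.coord z)) = Hirzebruch.mk r z := by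
  have hc := congrArg (eval (γ.g⁻¹.mulVec z.t)) γ.c_mul_form
  rw [map_mul, eval_C, eval_C] at hc
  refine Quotient.sound ⟨1, (γ.a * γ.b - γ.c * γ.f 0)⁻¹, one_ne_zero, inv_ne_zero hγ.2, ?_, ?_, ?_⟩
  · simp only [Valid.coord, RuledData.symm, Matrix.mulVec_mulVec, Matrix.mul_nonsing_inv _ (isUnit_iff_ne_zero.2 hγ.1), Matrix.one_mulVec, one_smul]
  · rw [one_pow, mul_one, eq_inv_mul_iff_mul_eq₀ hγ.2]
    simp only [Valid.coord, form_symm_f, map_neg, eval_substL]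
    simp only [RuledData.symm]
    linear_combination z.x * hc
  · rw [eq_inv_mul_iff_mul_eq₀ hγ.2]
    simp only [Valid.coord, form_symm_f, map_neg, eval_substL]
    simp only [RuledData.symm]
    linear_combination z.y * hc

/-- The automorphism with given coefficients. -/
noncomputable def Valid.equiv (hγ : γ.Valid) : Hirzebruch r ≃ Hirzebruch r where
  toFun := hγ.map
  invFun := hγ.symm.map
  left_inv := by
    intro P
    obtain ⟨z, rfl⟩ := Quotient.exists_rep P
    exact hγ.coord_symm_coord z
  right_inv := by
    intro P
    obtain ⟨z, rfl⟩ := Quotient.exists_rep P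
    exact hγ.coord_coord_symm z

end RuledData

open RuledData

/-- The determinant is constant, so its nonvanishing on the whole base becomes one inequality in the
coefficients. -/
theorem isRuledAut_iff {φ : Hirzebruch r ≃ Hirzebruch r} :
    IsRuledAut φ ↔ ∃ (γ : RuledData r) (hγ : γ.Valid), ∀ z,
      φ (Hirzebruch.mk r z) = Hirzebruch.mk r (hγ.coord z) := by
  constructor
  · rintro ⟨g, a, b, c, f, hc, hdet, hφ⟩
    let γ : RuledData r := ⟨g, a, b, c, f, hc⟩
    have hγ : γ.Valid := by
      refine ⟨(Matrix.isUnit_iff_isUnit_det _).1 g.isUnit |>.ne_zero, ?_⟩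
      have h1 := hdet ![1, 0] (by simp)
      have hc := congrArg (eval ![1, 0]) γ.c_mul_form
      rw [map_mul, eval_C, eval_C] at hc
      rwa [show c * eval ![1, 0] (form f) = c * f 0 from hc] at h1
    exact ⟨γ, hγ, fun z => hφ z (hγ.coord z) rfl rfl rfl⟩
  · rintro ⟨γ, hγ, hφ⟩
    refine ⟨Matrix.GeneralLinearGroup.mkOfDetNeZero γ.g hγ.1, γ.a, γ.b, γ.c, γ.f, γ.c_eq_zero, ?_, ?_⟩
    · intro t _
      have hc := congrArg (eval t) γ.c_mul_form
      rw [map_mul, eval_C, eval_C] at hc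
      rw [hc]
      exact hγ.2
    · intro z z' ht hx hy
      rw [hφ z]
      congr 1
      obtain ⟨t, x, y, _, _⟩ := z'
      obtain rfl : t = _ := ht
      obtain rfl : x = _ := hx
      obtain rfl : y = _ := hy
      rfl

theorem IsRuledAut.symm {φ : Hirzebruch r ≃ Hirzebruch r} (h : IsRuledAut φ) :
    IsRuledAut φ.symm := by
  obtain ⟨γ, hγ, hφ⟩ := isRuledAut_iff.1 h
  refine isRuledAut_iff.2 ⟨γ.symm, hγ.symm, fun z => ?_⟩
  rw [Equiv.symm_apply_eq, hφ, hγ.coord_coord_symm]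

theorem RuledData.Valid.isRuledAut {γ : RuledData r} (hγ : γ.Valid) : IsRuledAut hγ.equiv :=
  isRuledAut_iff.2 ⟨γ, hγ, fun _ => rfl⟩

/-- The coefficients may be normalized. -/
theorem IsRuledAut.exists_normalized {φ : Hirzebruch r ≃ Hirzebruch r} (h : IsRuledAut φ) :
    ∃ (γ : RuledData r) (hγ : γ.Valid), (∃ i j, γ.g i j = 1) ∧ ∀ z,
      φ (Hirzebruch.mk r z) = Hirzebruch.mk r (hγ.coord z) := by
  obtain ⟨γ, hγ, hφ⟩ := isRuledAut_iff.1 h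
  obtain ⟨i, j, hij⟩ : ∃ i j, γ.g i j ≠ 0 := by
    by_contra hcon
    push Not at hcon
    exact hγ.1 (by simp [Matrix.det_fin_two, hcon])
  set s := (γ.g i j)⁻¹
  have hs : s ≠ 0 := inv_ne_zero hij
  -- Multiplying the base coordinates by `s` multiplies `x` by `s ^ r`. Scaling `a` and `f`
  -- accordingly leaves the automorphism unchanged.
  let γ' : RuledData r := ⟨s • γ.g, s ^ r * γ.a, γ.b, γ.c, s ^ r • γ.f, γ.c_eq_zero⟩
  have hγ' : γ'.Valid := by
    refine ⟨?_, ?_⟩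
    · rw [Matrix.det_smul]
      exact mul_ne_zero (pow_ne_zero _ hs) hγ.1
    · have : γ'.a * γ'.b - γ'.c * γ'.f 0 = s ^ r * (γ.a * γ.b - γ.c * γ.f 0) := by
        simp only [γ', Pi.smul_apply, smul_eq_mul]; ring
      rw [this]
      exact mul_ne_zero (pow_ne_zero _ hs) hγ.2
  refine ⟨γ', hγ', ⟨i, j, inv_mul_cancel₀ hij⟩, fun z => ?_⟩
  rw [hφ z]
  refine Quotient.sound ⟨s, 1, hs, one_ne_zero, ?_, ?_, ?_⟩
  · simp [Valid.coord, γ', Matrix.smul_mulVec]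
  · simp only [Valid.coord, γ', ← formL_apply, map_smul, smul_eval]; ring
  · simp [Valid.coord, γ']

end Transform

end Scroll

/-! ### Equivalence of data and orbits of automorphisms -/

namespace Scroll

section Orbit

open MvPolynomial Module RuledData

variable {N k l d e hh m n r : ℕ}

/-- The action of automorphisms on the coordinates of marked maps. -/
noncomputable def RuledData.actAmb (γ : RuledData r) (s s' : ℂ) (x : Amb N k l d e) :
    Amb N k l d e :=
  (fun i => γ.act (x.1 i), s • γ.act x.2.1, s' • γ.act x.2.2)

theorem RuledData.hypL_act (γ : RuledData r) (h : Fin (N + 1) → ℂ)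
    (T : Fin (N + 1) → Pair (k + 1) (l + 1)) :
    hypL N k l h (fun i => γ.act (T i)) = γ.act (hypL N k l h T) := by
  rw [hypL_apply, hypL_apply]
  change _ = γ.actL _
  rw [map_sum]
  exact Finset.sum_congr rfl fun i _ => (γ.act_smul _ _).symm

theorem tmap_apply_vec (T : Fin (N + 1) → Pair (k + 1) (l + 1)) (t : Fin 2 → ℂ) (x y : ℂ)
    (i : Fin (N + 1)) : tmap N k l T (x • veronese k t, y • veronese l t) i
      = eval t (form (T i).1) * x + eval t (form (T i).2) * y := by
  change (T i).1 ⬝ᵥ (x • veronese k t) + (T i).2 ⬝ᵥ (y • veronese l t) = _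
  rw [dotProduct_smul, dotProduct_smul, eval_form_eq_dotProduct, eval_form_eq_dotProduct,
    smul_eq_mul, smul_eq_mul, mul_comm x, mul_comm y]

theorem tmap_act (hkl : k ≤ l) (γ : RuledData (l - k)) (T : Fin (N + 1) → Pair (k + 1) (l + 1))
    (t : Fin 2 → ℂ) (x y : ℂ) :
    tmap N k l (fun i => γ.act (T i)) (x • veronese k t, y • veronese l t)
      = tmap N k l T ((γ.a * x + eval t (form γ.f) * y) • veronese k (γ.g.mulVec t),
        (γ.c * x + γ.b * y) • veronese l (γ.g.mulVec t)) := by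
  ext i
  rw [tmap_apply_vec, tmap_apply_vec, γ.eval_act (compat_map hkl)]

theorem tmap_act_scrollPt (hkl : k ≤ l) {γ : RuledData (l - k)} (hγ : γ.Valid)
    (T : Fin (N + 1) → Pair (k + 1) (l + 1)) (z : Coord) :
    tmap N k l (fun i => γ.act (T i)) (scrollPt k l z) = tmap N k l T (scrollPt k l (hγ.coord z)) :=
  tmap_act hkl γ T z.t z.x z.y

theorem smul_form_eval {a b : ℕ} (s : ℂ) (U : Pair a b) (t : Fin 2 → ℂ) :
    eval t (form (s • U).1) = s * eval t (form U.1) ∧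
    eval t (form (s • U).2) = s * eval t (form U.2) := by
  simp [← formL_apply]

theorem curve_act (hkl : k ≤ l) {γ : RuledData (l - k)} (hγ : γ.Valid) {j : ℕ} (U : Sec k l j)
    {s : ℂ} (hs : s ≠ 0) : curve (l - k) (form (s • γ.act U).1) (form (s • γ.act U).2)
      = hγ.map ⁻¹' curve (l - k) (form U.1) (form U.2) := by
  ext P
  obtain ⟨z, rfl⟩ : ∃ z, Hirzebruch.mk (l - k) z = P := Quotient.exists_rep P
  rw [Set.mem_preimage, hγ.map_mk, mk_mem_curve hkl, mk_mem_curve hkl, (smul_form_eval _ _ _).1, (smul_form_eval _ _ _).2,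
    mul_assoc, mul_assoc, ← mul_add, mul_eq_zero_iff_left hs, γ.eval_act (compat_sec hkl j)]
  rfl

/-- Data in one orbit are equivalent. -/
theorem equivalent_act (hkl : k ≤ l) {γ : RuledData (l - k)} (hγ : γ.Valid) {s s' : ℂ}
    (hs : s ≠ 0) (hs' : s' ≠ 0) {x y : Idx N k l d e → ℂ} (hx : NonDeg (toAmb N k l d e x).1)
    (hy : toAmb N k l d e y = γ.actAmb s s' (toAmb N k l d e x)) :
    Equivalent x y ∧ NonDeg (toAmb N k l d e y).1 := by
  obtain ⟨M, hM⟩ := exists_represents hkl hx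
  have hval : ∀ z, values y z = values x (hγ.coord z) := fun z => by
    rw [values_eq, values_eq, hy]
    exact tmap_act_scrollPt hkl hγ _ z
  let M' : MarkedMap (l - k) N := ⟨M.π ∘ hγ.equiv, curve (l - k) (eqnCA y) (eqnCB y),
    curve (l - k) (eqnDA y) (eqnDB y)⟩
  have hM' : Represents y M' := by
    refine ⟨fun z => ?_, rfl, rfl⟩
    obtain ⟨hz, h⟩ := hM.1 (hγ.coord z)
    refine ⟨by rw [hval]; exact hz, ?_⟩
    change M.π (Hirzebruch.mk (l - k) (hγ.coord z)) = _
    simp only [h, hval]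
  -- Reparametrization does not change the image, so nondegeneracy of `y` follows from the image
  -- being a scroll.
  have hrange : Set.range M'.π = Set.range M.π := hγ.equiv.surjective.range_comp M.π
  refine ⟨⟨M, M', hM, hM', hγ.equiv.symm, hγ.isRuledAut.symm, fun P => ?_, ?_, ?_⟩,
    nonDeg_of_isScroll hM' (hrange ▸ hM.isScroll hx)⟩
  · change M.π (hγ.equiv (hγ.equiv.symm P)) = _
    rw [Equiv.apply_symm_apply]
  · have h1 : M.C = curve (l - k) (form (toAmb N k l d e x).2.1.1) (form (toAmb N k l d e x).2.1.2) :=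
      hM.2.1
    have h2 : M'.C = curve (l - k) (form (toAmb N k l d e y).2.1.1)
      (form (toAmb N k l d e y).2.1.2) := hM'.2.1
    have h3 : (toAmb N k l d e y).2.1 = s • γ.act (toAmb N k l d e x).2.1 :=
      congrArg (fun U => U.2.1) hy
    rw [Equiv.image_symm_eq_preimage, h1, h2, h3, curve_act hkl hγ _ hs]
    rfl
  · have h1 : M.D = curve (l - k) (form (toAmb N k l d e x).2.2.1) (form (toAmb N k l d e x).2.2.2) :=
      hM.2.2
    have h2 : M'.D = curve (l - k) (form (toAmb N k l d e y).2.2.1)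
      (form (toAmb N k l d e y).2.2.2) := hM'.2.2
    have h3 : (toAmb N k l d e y).2.2 = s' • γ.act (toAmb N k l d e x).2.2 :=
      congrArg (fun U => U.2.2) hy
    rw [Equiv.image_symm_eq_preimage, h1, h2, h3, curve_act hkl hγ _ hs']
    rfl

theorem form_smul {a b : ℕ} (s : ℂ) (U : Pair a b) :
    form (s • U).1 = C s * form U.1 ∧ form (s • U).2 = C s * form U.2 := by
  simp [← formL_apply, smul_eq_C_mul]

/-- Configurations are invariant under automorphisms. -/
theorem Config.act (hkl : k ≤ l) {h : Fin (N + 1) → ℂ} {μ : Fin m → ℕ} {ν : Fin m ⊕ Fin n → ℕ}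
    {c₁ c₂ c₃ : Prop} {x : Amb N k l d e} (hx : Config hh h μ ν c₁ c₂ c₃ x)
    {γ : RuledData (l - k)} (hγ : γ.Valid) {s s' : ℂ} (hs : s ≠ 0) (hs' : s' ≠ 0)
    (hnd : NonDeg (γ.actAmb s s' x).1) : Config hh h μ ν c₁ c₂ c₃ (γ.actAmb s s' x) := by
  obtain ⟨-, hC, hD, p, hp, hind, G, hG, h1, h2, h3, h4, h5, h6⟩ := hx
  have hdet := hγ.1
  have hunit := isUnit_iff_ne_zero.2 hdet
  have hgp : ∀ i, γ.g.mulVec (γ.g⁻¹.mulVec (p i)) = p i := fun i => by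
    rw [Matrix.mulVec_mulVec, Matrix.mul_nonsing_inv _ hunit, Matrix.one_mulVec]
  have hdet' : γ.g⁻¹.det ≠ 0 := hγ.symm.1
  have hcon : ∀ {i j : ℕ} (U : Sec k l i) (W : Sec k l j),
      contact (γ.act U) (γ.act W) = 0 ↔ contact U W = 0 := fun U W =>
    hγ.contact_act_eq_zero_iff (compat_sec hkl _) (compat_sec hkl _)
  -- The points move by the inverse of `g`. Each linear form then acquires a factor `det g`, and `δ`
  -- collects these factors in the residual section.
  set δ := γ.g.det ^ ∑ i, μ i with hδ
  have hδ0 : δ ≠ 0 := pow_ne_zero _ hdet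
  have hsub : ∀ {M : Type} [Fintype M] (q : M → Fin m ⊕ Fin n) (ν : M → ℕ),
      substL γ.g (linProd (fun i => p (q i)) ν)
        = C (γ.g.det ^ ∑ i, ν i) * linProd (fun i => γ.g⁻¹.mulVec (p (q i))) ν := fun q ν => by
    rw [← substL_linProd]
    simp only [hgp]
  refine ⟨hnd, (hγ.irr_act (compat_sec hkl _) hC).smul hs,
    (hγ.irr_act (compat_sec hkl _) hD).smul hs', fun i => γ.g⁻¹.mulVec (p i),
    fun i => mulVec_ne_zero hdet' (hp i), ?_, δ • γ.act G,
    (hγ.irr_act (compat_sec hkl _) hG).smul hδ0, ?_, ?_, ?_, ?_, ?_, ?_⟩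
  · intro i j hij h0
    apply hind i j hij
    have h7 := congrArg (fun q => eval (γ.g⁻¹.mulVec (p i)) q) (substL_lin γ.g (γ.g⁻¹.mulVec (p j)))
    simp only [eval_substL, hgp, map_mul, eval_lin, eval_C] at h7
    rw [h7, h0, mul_zero]
  · change form (hypL N k l h (fun i => γ.act (x.1 i))).1 = _
    rw [γ.hypL_act, (γ.form_act (compat_map hkl) _).1, (form_smul _ _).1,
      (γ.form_act (compat_sec hkl _) _).1, h1, h2, map_mul, map_mul, hsub Sum.inl]
    ring
  · change form (hypL N k l h (fun i => γ.act (x.1 i))).2 = _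
    rw [γ.hypL_act, (γ.form_act (compat_map hkl) _).2, (form_smul _ _).2,
      (γ.form_act (compat_sec hkl _) _).2, h1, h2, map_mul, map_mul, hsub Sum.inl]
    ring
  · change contact (δ • γ.act G) (s • γ.act x.2.1) = 0 ↔ _
    rw [contact_smul_left, contact_smul_right, smul_eq_zero_iff_right hδ0,
      smul_eq_zero_iff_right hs, hcon, h3]
  · change contact (δ • γ.act G) (s' • γ.act x.2.2) = 0 ↔ _
    rw [contact_smul_left, contact_smul_right, smul_eq_zero_iff_right hδ0,
      smul_eq_zero_iff_right hs', hcon, h4]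
  · change contact (s • γ.act x.2.1) (s' • γ.act x.2.2) = 0 ↔ _
    rw [contact_smul_left, contact_smul_right, smul_eq_zero_iff_right hs,
      smul_eq_zero_iff_right hs', hcon, h5]
  · change contact (s • γ.act x.2.1) (s' • γ.act x.2.2) ≠ 0 → ∃ Q,
      contact (s • γ.act x.2.1) (s' • γ.act x.2.2) = _ ∧ _
    intro hne
    rw [contact_smul_left, contact_smul_right] at hne ⊢
    have hne' : contact x.2.1 x.2.2 ≠ 0 := fun h0 => hne (by rw [(hcon _ _).2 h0]; simp)
    obtain ⟨Q, hQ, hQe⟩ := h6 hne'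
    refine ⟨C (s * s' * (γ.a * γ.b - γ.c * γ.f 0) * γ.g.det ^ ∑ i, ν i) * substL γ.g Q, ?_, ?_⟩
    · rw [γ.contact_act (compat_sec hkl _) (compat_sec hkl _), hQ, map_mul,
        show substL γ.g (linProd p ν) = _ from hsub id ν, smul_eq_C_mul, smul_eq_C_mul]
      simp only [id, C_mul]
      ring
    · intro i hi
      rw [map_mul, eval_C, eval_substL, hgp]
      exact mul_ne_zero (mul_ne_zero (mul_ne_zero (mul_ne_zero hs hs') hγ.2)
        (pow_ne_zero _ hdet)) (hQe i hi)

/-! ### Proportional maps -/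

/-- The powers of the two variables are coprime, so `X 1 ^ n` divides `p`; the quotient has degree
zero. -/
theorem X_pow_mul_cancel {n : ℕ} {p q : MvPolynomial (Fin 2) ℂ} (hp : IsForm (n + 1) p)
    (h : X 0 ^ n * p = X 1 ^ n * q) : ∃ c : ℂ, p = C c * X 1 ^ n ∧ q = C c * X 0 ^ n := by
  have hdvd : (X 1 ^ n : MvPolynomial (Fin 2) ℂ) ∣ p := by
    have hrel : IsRelPrime (X 1 ^ n : MvPolynomial (Fin 2) ℂ) (X 0 ^ n) := by
      have h1 := Indep.isRelPrime (v := ![1, 0]) (w := ![0, 1]) (by simp [Indep]) (by simp) n n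
      have hX : lin ![1, 0] = - (X 1 : MvPolynomial (Fin 2) ℂ) := by simp [lin]
      have hX' : lin ![0, 1] = (X 0 : MvPolynomial (Fin 2) ℂ) := by simp [lin]
      rw [hX, hX', neg_pow] at h1
      exact h1.of_mul_left_right
    exact hrel.dvd_of_dvd_mul_left (Dvd.intro q h.symm)
  obtain ⟨K, rfl⟩ := hdvd
  have hX1 : (X 1 ^ n : MvPolynomial (Fin 2) ℂ) ≠ 0 := pow_ne_zero _ (X_ne_zero 1)
  have hK := IsForm.of_mul (isHomogeneous_X_pow (1 : Fin 2) n) hX1 hp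
  rw [show n + 1 - n = 0 + 1 by omega, isForm_succ] at hK
  obtain ⟨c, rfl⟩ := eval_eq_of_isHomogeneous_zero hK
  refine ⟨c, mul_comm _ _, mul_left_cancel₀ hX1 ?_⟩
  rw [← h]; ring

/-- The eigenvalue is constant along the curve `x = 0`: there the coordinates of the image are forms
of degree `l` proportional to the monomials, so coprimality of the extreme monomials fixes one
constant. On each fibre, linear independence of the two curve points, compared with their sum,
extends it to all points. -/
theorem eq_smul_of_scrollPt {L : Pair (k + 1) (l + 1) →ₗ[ℂ] Pair (k + 1) (l + 1)}
    (hL : ∀ z, ∃ s : ℂ, L (scrollPt k l z) = s • scrollPt k l z) :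
    ∃ c : ℂ, ∀ z, L (scrollPt k l z) = c • scrollPt k l z := by
  let F : Fin (l + 1) → MvPolynomial (Fin 2) ℂ := fun j => form fun i => (L (0, Pi.single i 1)).2 j
  have hF : ∀ t j, eval t (F j) = (L (0, veronese l t)).2 j := by
    intro t j
    have h1 : ((0, veronese l t) : Pair (k + 1) (l + 1))
        = ∑ i, veronese l t i • ((0, Pi.single i 1) : Pair (k + 1) (l + 1)) := by
      refine Prod.ext ?_ ?_
      · simp [Prod.fst_sum]
      · simp [Prod.snd_sum, ← Pi.single_smul, Finset.univ_sum_single]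
    rw [eval_form_eq_dotProduct, h1, map_sum, Prod.snd_sum, Finset.sum_apply]
    refine Finset.sum_congr rfl fun i _ => ?_
    rw [map_smul, Prod.smul_snd, Pi.smul_apply, smul_eq_mul, mul_comm]
  have hs : ∀ t : Fin 2 → ℂ, t ≠ 0 → ∃ s : ℂ,
      L (0, veronese l t) = s • ((0, veronese l t) : Pair (k + 1) (l + 1)) := by
    intro t ht
    obtain ⟨s, hs⟩ := hL ⟨t, 0, 1, ht, Or.inr one_ne_zero⟩
    exact ⟨s, by simpa [scrollPt] using hs⟩
  -- The first and last coordinates of the rational normal curve are the pure powers `t₁ˡ` and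
  -- `t₀ˡ`.
  obtain ⟨c, hc0, hcl⟩ : ∃ c : ℂ, F 0 = C c * X 1 ^ l ∧ F (Fin.last l) = C c * X 0 ^ l := by
    refine X_pow_mul_cancel (form_isForm _) ?_
    rw [← sub_eq_zero]
    refine eq_zero_of_eval_eq_zero fun t ht => ?_
    obtain ⟨s, hs⟩ := hs t ht
    simp only [map_sub, map_mul, map_pow, eval_X, hF, hs, Prod.smul_snd, Pi.smul_apply, veronese,
      Fin.val_zero, Fin.val_last, smul_eq_mul, Nat.sub_zero, Nat.sub_self, pow_zero]
    ring
  have hy : ∀ t : Fin 2 → ℂ, t ≠ 0 →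
      L (0, veronese l t) = c • ((0, veronese l t) : Pair (k + 1) (l + 1)) := by
    intro t ht
    obtain ⟨s, hs⟩ := hs t ht
    have e0 := hF t 0
    have el := hF t (Fin.last l)
    rw [hs, hc0] at e0
    rw [hs, hcl] at el
    simp only [map_mul, map_pow, eval_X, eval_C, Prod.smul_snd, Pi.smul_apply, veronese,
      Fin.val_zero, Fin.val_last, smul_eq_mul, Nat.sub_zero, Nat.sub_self, pow_zero, one_mul,
      mul_one] at e0 el
    have hcs : c = s := by
      obtain ⟨i, hi⟩ := Function.ne_iff.1 ht
      fin_cases i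
      · exact mul_right_cancel₀ (pow_ne_zero l hi) el
      · exact mul_right_cancel₀ (pow_ne_zero l hi) e0
    rw [hs, hcs]
  have hx : ∀ t : Fin 2 → ℂ, t ≠ 0 →
      L (veronese k t, 0) = c • ((veronese k t, 0) : Pair (k + 1) (l + 1)) := by
    intro t ht
    obtain ⟨s1, h1⟩ := hL ⟨t, 1, 0, ht, Or.inl one_ne_zero⟩
    obtain ⟨s3, h3⟩ := hL ⟨t, 1, 1, ht, Or.inl one_ne_zero⟩
    simp only [scrollPt, one_smul, zero_smul] at h1 h3
    have hadd : ((veronese k t, veronese l t) : Pair (k + 1) (l + 1))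
        = (veronese k t, 0) + (0, veronese l t) := by simp
    rw [hadd, map_add, h1, hy t ht] at h3
    have h4 : s1 • veronese k t = s3 • veronese k t := by simpa using congrArg Prod.fst h3
    have h5 : c • veronese l t = s3 • veronese l t := by simpa using congrArg Prod.snd h3
    rw [smul_left_injective ℂ (veronese_ne_zero l ht) h5,
      ← smul_left_injective ℂ (veronese_ne_zero k ht) h4, h1]
  refine ⟨c, fun z => ?_⟩
  have hz : scrollPt k l z = z.x • ((veronese k z.t, 0) : Pair (k + 1) (l + 1))
      + z.y • ((0, veronese l z.t) : Pair (k + 1) (l + 1)) := by simp [scrollPt]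
  rw [hz, map_add, map_smul, map_smul, hx _ z.base_ne, hy _ z.base_ne, smul_add, smul_comm c,
    smul_comm c]

/-- Maps that agree at every point of the surface have coefficient tuples proportional by one
constant: a left inverse of `tmap N k l T` reduces this to an endomorphism for which all scroll
points are eigenvectors. -/
theorem eq_smul_of_tmap {T T' : Fin (N + 1) → Pair (k + 1) (l + 1)} (hT : NonDeg T)
    (h : ∀ z, ∃ s : ℂ, tmap N k l T' (scrollPt k l z) = s • tmap N k l T (scrollPt k l z)) :
    ∃ c : ℂ, T' = c • T := by
  obtain ⟨R, hR⟩ := (tmap N k l T).exists_leftInverse_of_injective (LinearMap.ker_eq_bot.2 hT)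
  have hR' : ∀ v, R (tmap N k l T v) = v := LinearMap.congr_fun hR
  obtain ⟨c, hc⟩ := eq_smul_of_scrollPt (L := R ∘ₗ tmap N k l T') fun z => by
    obtain ⟨s, hs⟩ := h z
    exact ⟨s, by rw [LinearMap.comp_apply, hs, map_smul, hR']⟩
  refine ⟨c, ?_⟩
  rw [← sub_eq_zero]
  funext i
  refine eq_zero_of_dotProduct_scrollPt fun z => ?_
  obtain ⟨s, hs⟩ := h z
  have h1 := hc z
  rw [LinearMap.comp_apply, hs, map_smul, hR'] at h1
  rw [smul_left_injective ℂ (scrollPt_ne_zero k l z) h1] at hs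
  have h2 : tmap N k l (T' - c • T) (scrollPt k l z) = 0 := by
    rw [map_sub, map_smul, LinearMap.sub_apply, LinearMap.smul_apply, hs, sub_self]
  exact congrFun h2 i

/-- Multiplication of the fibre coordinates by a constant. -/
def RuledData.scale (γ : RuledData r) (s : ℂ) : RuledData r :=
  ⟨γ.g, s * γ.a, s * γ.b, s * γ.c, s • γ.f, fun hr => by rw [γ.c_eq_zero hr, mul_zero]⟩

theorem RuledData.act_scale (γ : RuledData r) (s : ℂ) {a b : ℕ} (U : Pair a b) :
    (γ.scale s).act U = s • γ.act U := by
  simp only [act, scale, C_mul, mul_assoc, ← mul_add, ← formL_apply, map_smul, smul_mul_assoc]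
  simp only [← smul_eq_C_mul, ← smul_add, map_smul]
  rfl

/-- Equivalent data lie in one orbit. -/
theorem exists_act_of_equivalent (hkl : k ≤ l) {x y : Idx N k l d e → ℂ}
    (hy : NonDeg (toAmb N k l d e y).1)
    (hxC : Irr (toAmb N k l d e x).2.1) (hxD : Irr (toAmb N k l d e x).2.2)
    (hyC : Irr (toAmb N k l d e y).2.1) (hyD : Irr (toAmb N k l d e y).2.2)
    (h : Equivalent x y) : ∃ (γ : RuledData (l - k)) (s s' : ℂ), (∃ i j, γ.g i j = 1) ∧
      toAmb N k l d e y = γ.actAmb s s' (toAmb N k l d e x) := by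
  obtain ⟨M, M', hM, hM', φ, hφ, hπ, hC, hD⟩ := h
  obtain ⟨γ, hγ, hg, hmap⟩ := hφ.symm.exists_normalized
  have hmap' : φ.symm = hγ.equiv := by
    refine Equiv.ext fun P => ?_
    obtain ⟨z, rfl⟩ := Quotient.exists_rep P
    exact hmap z
  -- Equality of the maps in projective space gives equality of tuples up to a constant, which is
  -- later absorbed by rescaling the fibre coordinates by `c⁻¹`.
  obtain ⟨c, hc⟩ := eq_smul_of_tmap (T' := fun i => γ.act ((toAmb N k l d e x).1 i)) hy
    fun z => by
      obtain ⟨h1, h2⟩ := hM'.1 z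
      obtain ⟨h3, h4⟩ := hM.1 (hγ.coord z)
      have h5 := hπ (φ.symm (Hirzebruch.mk (l - k) z))
      rw [φ.apply_symm_apply, h2, hmap z, h4] at h5
      obtain ⟨s, hs⟩ := (Projectivization.mk_eq_mk_iff' ℂ _ _ _ _).1 h5.symm
      refine ⟨s, ?_⟩
      rw [tmap_act_scrollPt hkl hγ, ← values_eq, ← values_eq, hs]
  have hc0 : c ≠ 0 := by
    rintro rfl
    obtain ⟨hz, -⟩ := hM.1 (hγ.coord ⟨![1, 0], 1, 0, by simp, Or.inl one_ne_zero⟩)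
    apply hz
    rw [values_eq, ← tmap_act_scrollPt hkl hγ, hc, zero_smul, map_zero, LinearMap.zero_apply]
  have hcurve : ∀ {j : ℕ} {U W : Sec k l j}, Irr U → Irr W →
      φ '' curve (l - k) (form U.1) (form U.2) = curve (l - k) (form W.1) (form W.2) →
      ∃ s : ℂ, W = s • (γ.scale c⁻¹).act U := by
    intro j U W hU hW himg
    have h1 := curve_act hkl hγ U one_ne_zero
    rw [one_smul] at h1
    have h2 : curve (l - k) (form (γ.act U).1) (form (γ.act U).2)
        = curve (l - k) (form W.1) (form W.2) := by
      rw [h1, ← himg, ← Equiv.symm_symm φ, hmap', Equiv.image_symm_eq_preimage]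
      rfl
    have hUa := hγ.irr_act (compat_sec hkl _) hU
    obtain ⟨s, -, hs⟩ := hUa.exists_eq_smul' hW ((curve_eq_iff hkl hUa hW).1 h2)
    refine ⟨s * c, ?_⟩
    rw [act_scale, smul_smul, mul_assoc, mul_inv_cancel₀ hc0, mul_one, hs]
  obtain ⟨s, hs⟩ := hcurve hxC hyC (by rw [hM.2.1, hM'.2.1] at hC; exact hC)
  obtain ⟨s', hs'⟩ := hcurve hxD hyD (by rw [hM.2.2, hM'.2.2] at hD; exact hD)
  refine ⟨γ.scale c⁻¹, s, s', hg, Prod.ext ?_ (Prod.ext hs hs')⟩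
  funext i
  change (toAmb N k l d e y).1 i = (γ.scale c⁻¹).act ((toAmb N k l d e x).1 i)
  rw [act_scale, show γ.act ((toAmb N k l d e x).1 i) = c • (toAmb N k l d e y).1 i from
    congrFun hc i, smul_smul, inv_mul_cancel₀ hc0, one_smul]

end Orbit

end Scroll

/-! ### Dimension of the equivalence classes -/

namespace Scroll

section OrbitDim

open MvPolynomial Module RuledData

variable {N k l d e hh m n r : ℕ}

theorem isPolyMap_C {V : Type*} [AddCommGroup V] [Module ℂ V] {f : V → ℂ} (hf : IsPolyMap f) :
    IsPolyMap fun v => (C (f v) : MvPolynomial (Fin 2) ℂ) :=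
  hf.linear (Algebra.linearMap ℂ (MvPolynomial (Fin 2) ℂ))

theorem isPolyMap_substL {V : Type*} [AddCommGroup V] [Module ℂ V]
    {g : V → Matrix (Fin 2) (Fin 2) ℂ} (hg : ∀ i j, IsPolyMap fun v => g v i j)
    (p : MvPolynomial (Fin 2) ℂ) : IsPolyMap fun v => substL (g v) p := by
  induction p using MvPolynomial.induction_on with
  | C a => simpa [substL] using IsPolyMap.const (V := V) (C a : MvPolynomial (Fin 2) ℂ)
  | add p q hp hq => simpa using hp.add hq
  | mul_X p i hp =>
    simp only [map_mul]
    refine hp.mul ?_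
    simp only [substL, aeval_X]
    exact ((isPolyMap_C (hg i 0)).mul (IsPolyMap.const _)).add
      ((isPolyMap_C (hg i 1)).mul (IsPolyMap.const _))

/-- The matrices with a given entry equal to one. -/
def chartMatrix (i : Fin 4) (u : Fin 3 → ℂ) : Matrix (Fin 2) (Fin 2) ℂ := fun a b =>
  (Fin.insertNth i 1 u : Fin 4 → ℂ) (finProdFinEquiv (a, b))

theorem isPolyMap_chartMatrix (i : Fin 4) (a b : Fin 2) :
    IsPolyMap fun u : Fin 3 → ℂ => chartMatrix i u a b := by
  simp only [chartMatrix]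
  rcases Fin.eq_self_or_eq_succAbove i (finProdFinEquiv (a, b)) with h | ⟨j, hj⟩
  · rw [h]
    simpa only [Fin.insertNth_apply_same] using IsPolyMap.const _
  · rw [hj]
    simpa only [Fin.insertNth_apply_succAbove] using (IsPolyMap.id (V := Fin 3 → ℂ)).apply j

theorem exists_chartMatrix {g : Matrix (Fin 2) (Fin 2) ℂ} (h : ∃ i j, g i j = 1) :
    ∃ i u, chartMatrix i u = g := by
  obtain ⟨a, b, hab⟩ := h
  let E : Fin 2 × Fin 2 ≃ Fin 4 := finProdFinEquiv
  let v : Fin 4 → ℂ := fun i => g (E.symm i).1 (E.symm i).2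
  refine ⟨E (a, b), fun j => v ((E (a, b)).succAbove j), ?_⟩
  ext a' b'
  have h1 : Fin.insertNth (E (a, b)) 1
      (fun j => v ((E (a, b)).succAbove j)) = v := by
    rw [show (1 : ℂ) = v (E (a, b)) by simp [v, hab]]
    exact Fin.insertNth_self_removeNth _ v
  exact (congrFun h1 (E (a', b'))).trans (by simp only [v, Equiv.symm_apply_apply])

/-- The parameters of automorphisms and of the equations of two sections. -/
abbrev OrbitParam (r : ℕ) : Type :=
  (Fin 3 → ℂ) × ℂ × ℂ × ({_u : Unit // r = 0} → ℂ) × (Fin (r + 1) → ℂ) × ℂ × ℂ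

open Classical in
/-- The coefficients given by parameters. -/
noncomputable def OrbitParam.data (i : Fin 4) (w : OrbitParam r) : RuledData r where
  g := chartMatrix i w.1
  a := w.2.1
  b := w.2.2.1
  c := if h : r = 0 then w.2.2.2.1 ⟨(), h⟩ else 0
  f := w.2.2.2.2.1
  c_eq_zero hr := dif_neg hr.ne'

theorem isPolyMap_data_c (i : Fin 4) : IsPolyMap fun w : OrbitParam r => (w.data i).c := by
  by_cases h : r = 0
  · simpa only [OrbitParam.data, dif_pos h] using
      (IsPolyMap.id (V := OrbitParam r)).snd.snd.snd.fst.apply ⟨(), h⟩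
  · simpa only [OrbitParam.data, dif_neg h] using IsPolyMap.const _

theorem isPolyMap_data_g (i : Fin 4) (a b : Fin 2) :
    IsPolyMap fun w : OrbitParam r => (w.data i).g a b :=
  (isPolyMap_chartMatrix i a b).comp (IsPolyMap.id (V := OrbitParam r)).fst

theorem isPolyMap_act {a b : ℕ} (i : Fin 4) (U : Pair a b) :
    IsPolyMap fun w : OrbitParam r => (w.data i).act U := by
  have hs := fun p => isPolyMap_substL (isPolyMap_data_g (r := r) i) p
  refine IsPolyMap.prodMk (IsPolyMap.linear (vecL a) (.add (.mul (isPolyMap_C ?_) (hs _))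
    (.mul (isPolyMap_C (isPolyMap_data_c i)) (hs _))))
    (IsPolyMap.linear (vecL b) (.add (.mul (isPolyMap_form ?_) (hs _))
    (.mul (isPolyMap_C ?_) (hs _))))
  · exact (IsPolyMap.id (V := OrbitParam r)).snd.fst
  · exact (IsPolyMap.id (V := OrbitParam r)).snd.snd.snd.snd.fst
  · exact (IsPolyMap.id (V := OrbitParam r)).snd.snd.fst

theorem OrbitParam.exists_data {γ : RuledData r} (hg : ∃ i j, γ.g i j = 1) (s s' : ℂ) :
    ∃ (i : Fin 4) (w : OrbitParam r), w.data i = γ ∧ w.2.2.2.2.2 = (s, s') := by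
  obtain ⟨i, u, hu⟩ := exists_chartMatrix hg
  refine ⟨i, (u, γ.a, γ.b, fun _ => γ.c, γ.f, s, s'), ?_, rfl⟩
  refine RuledData.ext hu rfl rfl ?_ rfl
  by_cases h : r = 0
  · exact dif_pos h
  · exact (dif_neg h).trans (γ.c_eq_zero (Nat.pos_of_ne_zero h)).symm

/-- The parameters of the identity. -/
noncomputable def OrbitParam.one (r : ℕ) : OrbitParam r := (![0, 0, 1], 1, 1, 0, 0, 1, 1)

theorem chartMatrix_zero (u : Fin 3 → ℂ) : chartMatrix 0 u = !![1, u 0; u 1, u 2] := by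
  ext a b
  fin_cases a <;> fin_cases b <;> rfl

theorem OrbitParam.one_g (r : ℕ) : ((OrbitParam.one r).data 0).g = 1 := by
  change chartMatrix 0 ![0, 0, 1] = 1
  rw [chartMatrix_zero, Matrix.one_fin_two]
  rfl

theorem OrbitParam.one_c (r : ℕ) : ((OrbitParam.one r).data 0).c = 0 := by
  simp [OrbitParam.data, OrbitParam.one]

theorem OrbitParam.one_f (r : ℕ) : ((OrbitParam.one r).data 0).f = 0 := rfl

theorem OrbitParam.one_valid (r : ℕ) : ((OrbitParam.one r).data 0).Valid := by
  refine ⟨by rw [OrbitParam.one_g]; simp, ?_⟩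
  rw [OrbitParam.one_c]
  simp [OrbitParam.data, OrbitParam.one]

theorem substL_one (p : MvPolynomial (Fin 2) ℂ) : substL 1 p = p :=
  MvPolynomial.funext fun t => by rw [eval_substL, Matrix.one_mulVec]

theorem OrbitParam.one_act {a b : ℕ} (U : Pair a b) : ((OrbitParam.one r).data 0).act U = U := by
  rw [RuledData.act, OrbitParam.one_g, OrbitParam.one_c, OrbitParam.one_f, substL_one, substL_one,
    form_eq_zero_iff.2 rfl]
  simp [OrbitParam.data, OrbitParam.one]

theorem eventually_valid {w : OrbitParam r} {i : Fin 4} (h : (w.data i).Valid) :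
    ∀ᶠ w' : OrbitParam r in zn w, (w'.data i).Valid := by
  have h1 : IsPolyMap fun w : OrbitParam r => (w.data i).g.det :=
    IsPolyMap.matrix_det (IsPolyMap.of_entries (isPolyMap_data_g i))
  have h2 : IsPolyMap fun w : OrbitParam r =>
      (w.data i).a * (w.data i).b - (w.data i).c * (w.data i).f 0 :=
    .sub (.mul (IsPolyMap.id (V := OrbitParam r)).snd.fst
      (IsPolyMap.id (V := OrbitParam r)).snd.snd.fst)
      (.mul (isPolyMap_data_c i)
        ((IsPolyMap.id (V := OrbitParam r)).snd.snd.snd.snd.fst.apply 0))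
  filter_upwards [eventually_ne_zero h1 h.1, eventually_ne_zero h2 h.2] with w' e1 e2 using ⟨e1, e2⟩

/-- Only the identity fixes a map. -/
theorem OrbitParam.eq_one (hkl : k ≤ l) (hl : 0 < l) {x : Amb N k l d e} (hT : NonDeg x.1)
    (hC : x.2.1 ≠ 0) (hD : x.2.2 ≠ 0) {w : OrbitParam (l - k)}
    (h : (w.data 0).actAmb w.2.2.2.2.2.1 w.2.2.2.2.2.2 x = x) : w = OrbitParam.one (l - k) := by
  set γ := w.data 0 with hγ
  -- Since `tmap` is injective, fixing the tuple means fixing the vectors of the standard scroll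
  -- themselves, not only the lines they span.
  have hvec : ∀ (t : Fin 2 → ℂ) (x y : ℂ),
      (γ.a * x + eval t (form γ.f) * y) • veronese k (γ.g.mulVec t) = x • veronese k t ∧
      (γ.c * x + γ.b * y) • veronese l (γ.g.mulVec t) = y • veronese l t := by
    intro t x' y
    have h1 := tmap_act hkl γ x.1 t x' y
    rw [show (fun i => γ.act (x.1 i)) = x.1 from congrArg Prod.fst h] at h1
    have h2 := hT h1
    exact ⟨(congrArg Prod.fst h2).symm, (congrArg Prod.snd h2).symm⟩
  obtain ⟨u, a, b, c, f, s, s'⟩ := w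
  have hg : γ.g = !![1, u 0; u 1, u 2] := chartMatrix_zero u
  -- The fixed vector on the curve of degree `l`, coordinate by coordinate. As `l > 0`, the
  -- monomials of exponents `l` and `l - 1` suffice to determine `b` and the matrix.
  have hb : ∀ (t : Fin 2 → ℂ) (j : ℕ), j ≤ l → b * (((t 0 + u 0 * t 1)) ^ j *
      (u 1 * t 0 + u 2 * t 1) ^ (l - j)) = t 0 ^ j * t 1 ^ (l - j) := by
    intro t j hj
    have h1 := congrFun (hvec t 0 1).2 ⟨j, by omega⟩
    rw [hg] at h1
    simpa [veronese, Matrix.mulVec, dotProduct, Fin.sum_univ_two, hγ, OrbitParam.data] using h1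
  have hb1 : b = 1 := by simpa using hb ![1, 0] l le_rfl
  subst hb1
  have hu1 : u 1 = 0 := by
    have := hb ![1, 0] (l - 1) (by omega)
    simpa [show l - (l - 1) = 1 by omega] using this
  have hu0 : u 0 = 0 := by
    have := hb ![0, 1] l le_rfl
    simpa [hl.ne'] using this
  have hu2 : u 2 = 1 := by
    have := hb ![1, 1] (l - 1) (by omega)
    simpa [show l - (l - 1) = 1 by omega, hu1, hu0] using this
  have hu : u = ![0, 0, 1] := by
    ext i; fin_cases i
    exacts [hu0, hu1, hu2]
  have hg1 : γ.g = 1 := by rw [hg, hu0, hu1, hu2, Matrix.one_fin_two]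
  have hf : form f = 0 := eq_zero_of_eval_eq_zero fun t ht => by
    have h1 := (hvec t 0 1).1
    rw [hg1, Matrix.one_mulVec, mul_zero, zero_add, mul_one, zero_smul] at h1
    exact (smul_eq_zero.1 h1).resolve_right (veronese_ne_zero k ht)
  have h10 : (![1, 0] : Fin 2 → ℂ) ≠ 0 := by simp
  have hc : γ.c = 0 := by
    have h1 := (hvec ![1, 0] 1 0).2
    rw [hg1, Matrix.one_mulVec, mul_zero, add_zero, mul_one, zero_smul] at h1
    exact (smul_eq_zero.1 h1).resolve_right (veronese_ne_zero l h10)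
  have ha : a = 1 := by
    have h1 := (hvec ![1, 0] 1 0).1
    rw [hg1, Matrix.one_mulVec, mul_zero, add_zero, mul_one] at h1
    exact smul_left_injective ℂ (veronese_ne_zero k h10) h1
  have hc' : c = 0 := by
    funext i
    obtain ⟨⟨⟩, hr⟩ := i
    have h1 : γ.c = c ⟨(), hr⟩ := by
      simp only [hγ, OrbitParam.data, dif_pos hr]
    exact h1.symm.trans hc
  obtain rfl : f = 0 := form_eq_zero_iff.1 hf
  subst ha hc' hu
  have hact : ∀ {a b : ℕ} (U : Pair a b), γ.act U = U := fun U => OrbitParam.one_act U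
  have hs : s • γ.act x.2.1 = x.2.1 := congrArg (fun x => x.2.1) h
  have hs' : s' • γ.act x.2.2 = x.2.2 := congrArg (fun x => x.2.2) h
  rw [hact] at hs hs'
  obtain rfl : s = 1 := smul_left_injective ℂ hC (hs.trans (one_smul ℂ _).symm)
  obtain rfl : s' = 1 := smul_left_injective ℂ hD (hs'.trans (one_smul ℂ _).symm)
  rfl

/-- Three free matrix entries, two for `a` and `b`, one for `c` present only if `r = 0`, `r + 1` for
`f`, and two scalars for the equations of the sections. -/
theorem finrank_orbitParam (r : ℕ) :
    finrank ℂ (OrbitParam r) = r + 8 + (if r = 0 then 1 else 0) := by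
  have h1 : finrank ℂ ({_u : Unit // r = 0} → ℂ) = if r = 0 then 1 else 0 := by
    rw [finrank_fintype_fun_eq_card]
    split_ifs with h <;> simp [h]
  rw [finrank_prod, finrank_prod, finrank_prod, finrank_prod, finrank_prod, finrank_prod, h1,
    finrank_fin_fun, finrank_fin_fun, finrank_self]
  omega

/-- The four charts, with one entry of the base matrix equal to one, cover the orbit; the scalar
freedom of the tuple is already contained in the fibre coordinates. Near the identity every
parameter gives an equivalent configuration, and triviality of the stabilizer makes the fibre a
single point. -/
theorem hasDim_orbit (hkl : k ≤ l) (hl : 0 < l) {h : Fin (N + 1) → ℂ} {μ : Fin m → ℕ}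
    {ν : Fin m ⊕ Fin n → ℕ} {c₁ c₂ c₃ : Prop} {x : Idx N k l d e → ℂ}
    (hx : Config hh h μ ν c₁ c₂ c₃ (toAmb N k l d e x)) :
    HasDim (toAmb N k l d e '' {y | Config hh h μ ν c₁ c₂ c₃ (toAmb N k l d e y) ∧ Equivalent x y})
      (l - k + 8 + (if k = l then 1 else 0)) := by
  have hif : (if k = l then 1 else 0) = if l - k = 0 then 1 else 0 :=
    if_congr (by omega) rfl rfl
  rw [hif, ← finrank_orbitParam]
  refine HasDim.of_charts (J := Fin 4) (W := OrbitParam (l - k)) (Z := fun _ => Set.univ)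
    (π := fun i w => (w.data i).actAmb w.2.2.2.2.2.1 w.2.2.2.2.2.2 (toAmb N k l d e x))
    ?_ ?_ ?_
  · intro i
    refine IsPolyMap.prodMk (IsPolyMap.pi fun _ => isPolyMap_act i _) (IsPolyMap.prodMk
      (IsPolyMap.smul ?_ (isPolyMap_act i _)) (IsPolyMap.smul ?_ (isPolyMap_act i _)))
    · exact (IsPolyMap.id (V := OrbitParam (l - k))).snd.snd.snd.snd.snd.fst
    · exact (IsPolyMap.id (V := OrbitParam (l - k))).snd.snd.snd.snd.snd.snd
  · rintro _ ⟨y, ⟨hy, hxy⟩, rfl⟩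
    obtain ⟨γ, s, s', hg, hγ⟩ := exists_act_of_equivalent hkl hy.1 hx.2.1 hx.2.2.1 hy.2.1 hy.2.2.1
      hxy
    obtain ⟨i, w, rfl, hw⟩ := OrbitParam.exists_data hg s s'
    exact ⟨i, w, Set.mem_univ _, LocalParamAt.univ Set.mem_univ w, by rw [hw, hγ]⟩
  · refine ⟨0, OrbitParam.one _, LocalParamAt.univ Set.mem_univ _, ?_, ?_⟩
    · have h1 := eventually_ne_zero (v := OrbitParam.one (l - k))
        (IsPolyMap.id (V := OrbitParam (l - k))).snd.snd.snd.snd.snd.fst one_ne_zero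
      have h2 := eventually_ne_zero (v := OrbitParam.one (l - k))
        (IsPolyMap.id (V := OrbitParam (l - k))).snd.snd.snd.snd.snd.snd one_ne_zero
      filter_upwards [h1, h2, eventually_valid (OrbitParam.one_valid (l - k))] with w e1 e2 e3 _
      obtain ⟨y, hy⟩ := (toAmb N k l d e).surjective
        ((w.data 0).actAmb w.2.2.2.2.2.1 w.2.2.2.2.2.2 (toAmb N k l d e x))
      obtain ⟨hxy, hnd⟩ := equivalent_act hkl e3 e1 e2 hx.1 hy
      refine ⟨y, ⟨?_, hxy⟩, hy⟩
      rw [hy] at hnd ⊢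
      exact hx.act hkl e3 e1 e2 hnd
    · refine (Set.finite_singleton (OrbitParam.one (l - k))).subset ?_
      rintro w ⟨-, hw⟩
      refine OrbitParam.eq_one hkl hl hx.1 hx.2.1.ne_zero hx.2.2.1.ne_zero (hw.trans ?_)
      refine Prod.ext (funext fun i => OrbitParam.one_act _) (Prod.ext ?_ ?_)
      · exact (one_smul ℂ _).trans (OrbitParam.one_act _)
      · exact (one_smul ℂ _).trans (OrbitParam.one_act _)

end OrbitDim

end Scroll

/-! ### Patterns of coincidence and the final count -/

namespace Scroll

section Assembly

open MvPolynomial Module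

variable {N k l d e hh m n : ℕ}

/-- The relations between the residual section `G` of the hyperplane and the two marked sections of
a marked map; `p₁`, `p₂`, `p₃` stand for the coincidences `G = C`, `G = D`, `C = D`. -/
structure Coincidence (k l d e hh : ℕ) (h : Fin (N + 1) → ℂ) (M : MarkedMap (l - k) N)
    (p₁ p₂ p₃ : Prop) : Prop where
  liesC : M.LiesIn h M.C ↔ p₁
  liesD : M.LiesIn h M.D ↔ p₂
  eq : M.C = M.D ↔ p₃
  dirC : IsDirectrix M.C ↔ k < l ∧ d = k
  dirD : IsDirectrix M.D ↔ k < l ∧ e = k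
  trans₃ : p₁ → p₂ → p₃
  trans₂ : p₁ → p₃ → p₂
  trans₁ : p₂ → p₃ → p₁
  deg₁ : p₁ → d = hh
  deg₂ : p₂ → e = hh
  deg₃ : p₃ → d = e
  dir₃ : k < l → d = k → e = k → p₃
  dir₁ : k < l → hh = k → d = k → p₁
  dir₂ : k < l → hh = k → e = k → p₂
  typeG : l ≤ hh ∨ hh = k ∧ k < l
  typeC : l ≤ d ∨ d = k ∧ k < l
  typeD : l ≤ e ∨ e = k ∧ k < l

/-- Lying in the hyperplane, being the directrix and equality are all equalities of curves.
Recording their consequences for the degrees reduces the case distinctions to propositional logic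
and linear arithmetic. -/
theorem coincidence (hkl : k ≤ l) {h : Fin (N + 1) → ℂ} {M : MarkedMap (l - k) N}
    {G : Sec k l hh} {C : Sec k l d} {D : Sec k l e} (hG : Irr G) (hC : Irr C) (hD : Irr D)
    (hMC : M.C = curve (l - k) (form C.1) (form C.2))
    (hMD : M.D = curve (l - k) (form D.1) (form D.2))
    (hLC : M.LiesIn h M.C ↔ contact G C = 0) (hLD : M.LiesIn h M.D ↔ contact G D = 0) :
    Coincidence k l d e hh h M (contact G C = 0) (contact G D = 0) (contact C D = 0) := by
  have e1 := curve_eq_iff hkl hG hC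
  have e2 := curve_eq_iff hkl hG hD
  have e3 := curve_eq_iff hkl hC hD
  have d1 := isDirectrix_iff hkl hC
  have d2 := isDirectrix_iff hkl hD
  have d0 := isDirectrix_iff hkl hG
  refine ⟨hLC, hLD, by rw [hMC, hMD, e3], by rw [hMC, d1], by rw [hMD, d2], ?_, ?_, ?_,
    fun h0 => (hG.exists_eq_smul hC h0).1.symm, fun h0 => (hG.exists_eq_smul hD h0).1.symm,
    fun h0 => (hC.exists_eq_smul hD h0).1, ?_, ?_, ?_, ?_, ?_, ?_⟩
  · exact fun h1 h2 => e3.1 ((e1.2 h1).symm.trans (e2.2 h2))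
  · exact fun h1 h3 => e2.1 ((e1.2 h1).trans (e3.2 h3))
  · exact fun h2 h3 => e1.1 ((e2.2 h2).trans (e3.2 h3).symm)
  · exact fun hlt hd he => e3.1 ((d1.2 ⟨hlt, hd⟩).2.trans (d2.2 ⟨hlt, he⟩).2.symm)
  · exact fun hlt h0 hd => e1.1 ((d0.2 ⟨hlt, h0⟩).2.trans (d1.2 ⟨hlt, hd⟩).2.symm)
  · exact fun hlt h0 he => e2.1 ((d0.2 ⟨hlt, h0⟩).2.trans (d2.2 ⟨hlt, he⟩).2.symm)
  · exact (hG.type_cases hkl).imp_right fun h => ⟨h.1, h.2.1⟩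
  · exact (hC.type_cases hkl).imp_right fun h => ⟨h.1, h.2.1⟩
  · exact (hD.type_cases hkl).imp_right fun h => ⟨h.1, h.2.1⟩

variable {μ : Fin m → ℕ} {ν : Fin m ⊕ Fin n → ℕ} {h : Fin (N + 1) → ℂ}

/-- A point of the locus provides an actual residual section; its existence bounds the total contact
order by `k + l` and so makes the degree `hh` meaningful. -/
theorem exists_coincidence (hkl : k ≤ l) (hs : ∑ i, μ i ≤ k + l → hh + ∑ i, μ i = k + l)
    {Q : MarkedMap (l - k) N → Prop} (hne : (locus N k l d e h μ ν Q).Nonempty) :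
    hh + ∑ i, μ i = k + l ∧ ∃ M p₁ p₂ p₃, Q M ∧ Coincidence k l d e hh h M p₁ p₂ p₃ := by
  obtain ⟨x, hx⟩ := hne
  have hs' := hs (sum_le_of_mem_locus hx)
  obtain ⟨M, hM, hS, hC, hD, hQM, p, hp, h1, h0, -⟩ := hx
  simp only [hyperplaneContact, ← (form_hypL h x).1, ← (form_hypL h x).2] at h1 h0
  obtain ⟨-, G, hG, hG1, hG2⟩ := exists_residual hs (hp.comp Sum.inl_injective) h1 h0
  have hL0 := linProd_ne_zero μ fun i => (p (.inl i)).rep_nonzero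
  have hC' : Irr (toAmb N k l d e x).2.1 := hC
  have hD' : Irr (toAmb N k l d e x).2.2 := hD
  have hMC : M.C = curve (l - k) (form (toAmb N k l d e x).2.1.1) (form (toAmb N k l d e x).2.1.2) :=
    hM.2.1
  have hMD : M.D = curve (l - k) (form (toAmb N k l d e x).2.2.1) (form (toAmb N k l d e x).2.2.2) :=
    hM.2.2
  exact ⟨hs', M, _, _, _, hQM, coincidence hkl hG hC' hD' hMC hMD
    (by rw [hMC]; exact liesIn_iff hkl hM hL0 hG hG1 hG2 hC')
    (by rw [hMD]; exact liesIn_iff hkl hM hL0 hG hG1 hG2 hD')⟩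

/-- The dimension of a locus which is given by a pattern of coincidences. -/
theorem locusDim_of_coincidence (hkl : k ≤ l) (hl : 0 < l)
    (hs : ∑ i, μ i ≤ k + l → hh + ∑ i, μ i = k + l) {Q : MarkedMap (l - k) N → Prop}
    (c₁ c₂ c₃ : Prop) {δ : ℤ}
    (H : ∀ M p₁ p₂ p₃, Q M → Coincidence k l d e hh h M p₁ p₂ p₃ → hh + ∑ i, μ i = k + l →
      (∀ M p₁ p₂ p₃, Coincidence k l d e hh h M p₁ p₂ p₃ →
        (Q M ↔ ((p₁ ↔ c₁) ∧ (p₂ ↔ c₂) ∧ (p₃ ↔ c₃)))) ∧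
      ({x : Amb N k l d e | Config hh h μ ν c₁ c₂ c₃ x}.Nonempty →
        ∃ a : ℕ, HasDim {x : Amb N k l d e | Config hh h μ ν c₁ c₂ c₃ x} a ∧
          δ = a - (l - k + 8 + (if k = l then 1 else 0) : ℕ))) :
    LocusDim N k l d e h μ ν Q δ := by
  intro hne
  -- One point of the locus already settles the numerical relations between `d`, `e` and `hh`, under
  -- which the condition `Q` is equivalent to its pattern for all maps.
  obtain ⟨hs', M, p₁, p₂, p₃, hQM, hco⟩ := exists_coincidence hkl hs hne
  obtain ⟨hQ, hdim⟩ := H M p₁ p₂ p₃ hQM hco hs'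
  have heq := locus_eq_config (N := N) (d := d) (e := e) (h := h) (ν := ν) hkl hs' (Q := Q)
    (c₁ := c₁) (c₂ := c₂) (c₃ := c₃) fun M G C D hG hC hD hMC hMD hLC hLD =>
      hQ M _ _ _ (coincidence hkl hG hC hD hMC hMD hLC hLD)
  rw [heq] at hne ⊢
  obtain ⟨a, ha, hδ⟩ := hdim (by
    obtain ⟨x, hx⟩ := hne
    exact ⟨_, hx⟩)
  refine ⟨a, _, ?_, fun x hx => ?_, hδ⟩
  · have := (ha.image_equiv (toAmb N k l d e).symm).zariskiDim_eq
    rwa [LinearEquiv.image_symm_eq_preimage] at this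
  · have := ((hasDim_orbit hkl hl hx).image_equiv (toAmb N k l d e).symm).zariskiDim_eq
    rwa [LinearEquiv.image_symm_eq_preimage,
      Set.preimage_image_eq _ (toAmb N k l d e).injective] at this

end Assembly

end Scroll

theorem proposition6p3 (N k l d e m n : ℕ) (hkl : k ≤ l) (hl : 0 < l)
    (h : Fin (N + 1) → ℂ) (hh : h ≠ 0)
    (μ : Fin m → ℕ) (hμ : ∀ i, 1 ≤ μ i)
    (ν : Fin m ⊕ Fin n → ℕ) (hν : ∀ j : Fin n, 1 ≤ ν (.inr j)) :
    (k < ∑ i, μ i →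
      ∀ b : ℤ, b = N * (k + l + 2) + k - l - 5 - (if k = l then 1 else 0) + m →
        Scroll.LocusDim N k l d e h μ ν
          (fun M => M.LiesIn h M.C ∧ M.LiesIn h M.D)
          b ∧
        Scroll.LocusDim N k l d e h μ ν
          (fun M => M.C = M.D ∧ ¬ M.LiesIn h M.C)
          (b + (2 * d - k - l + 1)) ∧
        Scroll.LocusDim N k l d e h μ ν
          (fun M => M.LiesIn h M.C ∧ ¬ M.LiesIn h M.D)
          (b + (2 * e - k - l + 1 + n - ∑ i, (ν i : ℤ))) ∧
        Scroll.LocusDim N k l d e h μ ν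
          (fun M => M.C ≠ M.D ∧ ¬ M.LiesIn h M.C ∧ ¬ M.LiesIn h M.D)
          (b + (2 * d + 2 * e - 2 * k - 2 * l + 2 + n - ∑ i, (ν i : ℤ)))) ∧
    (∑ i, μ i ≤ k →
      ∀ b : ℤ, b = N * (k + l + 2) + 2 * k - 4 - (if k = l then 1 else 0)
          - 2 * (∑ i, (μ i : ℤ)) + m →
        Scroll.LocusDim N k l d e h μ ν
          (fun M => Scroll.IsDirectrix M.C ∧ Scroll.IsDirectrix M.D)
          b ∧
        Scroll.LocusDim N k l d e h μ ν
          (fun M => M.LiesIn h M.C ∧ M.LiesIn h M.D)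
          b ∧
        Scroll.LocusDim N k l d e h μ ν
          (fun M => Scroll.IsDirectrix M.C ∧ M.LiesIn h M.D)
          (b + (n - ∑ i, (ν i : ℤ))) ∧
        Scroll.LocusDim N k l d e h μ ν
          (fun M => M.LiesIn h M.C ∧ Scroll.IsDirectrix M.D)
          (b + (n - ∑ i, (ν i : ℤ))) ∧
        Scroll.LocusDim N k l d e h μ ν
          (fun M => M.C = M.D ∧ ¬ Scroll.IsDirectrix M.C ∧ ¬ M.LiesIn h M.C)
          (b + (2 * d - k - l + 1)) ∧
        Scroll.LocusDim N k l d e h μ ν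
          (fun M => Scroll.IsDirectrix M.D ∧ ¬ Scroll.IsDirectrix M.C ∧ ¬ M.LiesIn h M.C)
          (b + (2 * d - k - l + 1 + n - ∑ i, (ν i : ℤ))) ∧
        Scroll.LocusDim N k l d e h μ ν
          (fun M => M.LiesIn h M.D ∧ ¬ Scroll.IsDirectrix M.C ∧ ¬ M.LiesIn h M.C)
          (b + (2 * d - k - l + 1 + n - ∑ i, (ν i : ℤ))) ∧
        Scroll.LocusDim N k l d e h μ ν
          (fun M => M.C ≠ M.D ∧ ¬ Scroll.IsDirectrix M.C ∧ ¬ Scroll.IsDirectrix M.D ∧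
            ¬ M.LiesIn h M.C ∧ ¬ M.LiesIn h M.D)
          (b + (2 * d + 2 * e - 2 * k - 2 * l + 2 + n - ∑ i, (ν i : ℤ)))) := by
  have hcast : ∑ i, (μ i : ℤ) = ((∑ i, μ i : ℕ) : ℤ) := by push_cast; rfl
  have hs : ∑ i, μ i ≤ k + l → (k + l - ∑ i, μ i) + ∑ i, μ i = k + l := by omega
  -- For each condition it remains to name the pattern of `G = C`, `G = D`, `C = D`, and to compare
  -- the count for that pattern, less the orbit dimension, with the claim.
  have key := fun (Q : Scroll.MarkedMap (l - k) N → Prop) (c₁ c₂ c₃ : Prop) (δ : ℤ) =>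
    Scroll.locusDim_of_coincidence (h := h) (μ := μ) (ν := ν) (d := d) (e := e) hkl hl hs
      (Q := Q) c₁ c₂ c₃ (δ := δ)
  rw [hcast]
  refine ⟨fun hgt b hb => ⟨?_, ?_, ?_, ?_⟩, fun hle b hb => ⟨?_, ?_, ?_, ?_, ?_, ?_, ?_, ?_⟩⟩
  -- If the total contact order exceeds `k`, then `G` has degree less than `l` and is the directrix,
  -- so that `k < l`. Lying in the hyperplane and being the directrix are then the same.
  · refine key _ True True True _ fun M p₁ p₂ p₃ hQ hc hs' => ⟨fun _ _ _ _ _ => by grind [cases Scroll.Coincidence], fun hne => ?_⟩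
    obtain rfl : d = k + l - ∑ i, μ i := by grind [cases Scroll.Coincidence]
    obtain rfl : e = k + l - ∑ i, μ i := by grind [cases Scroll.Coincidence]
    obtain ⟨a, ha, haz⟩ := Scroll.hasDim_all_eq hkl hh hμ hs' hne
    exact ⟨a, ha, by grind [cases Scroll.Coincidence]⟩
  · refine key _ False False True _ fun M p₁ p₂ p₃ hQ hc hs' => ⟨fun _ _ _ _ _ => by grind [cases Scroll.Coincidence], fun hne => ?_⟩
    obtain rfl : e = d := by grind [cases Scroll.Coincidence]
    obtain ⟨a, ha, haz⟩ := Scroll.hasDim_eq hkl hh hμ hs' hne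
    exact ⟨a, ha, by grind [cases Scroll.Coincidence]⟩
  · refine key _ True False False _ fun M p₁ p₂ p₃ hQ hc hs' => ⟨fun _ _ _ _ _ => by grind [cases Scroll.Coincidence], fun hne => ?_⟩
    obtain rfl : d = k + l - ∑ i, μ i := by grind [cases Scroll.Coincidence]
    obtain ⟨a, ha, haz⟩ := Scroll.hasDim_fst_eq hkl hh hμ hν hs' hne
    exact ⟨a, ha, by grind [cases Scroll.Coincidence]⟩
  · refine key _ False False False _ fun M p₁ p₂ p₃ hQ hc hs' => ⟨fun _ _ _ _ _ => by grind [cases Scroll.Coincidence], fun hne => ?_⟩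
    obtain ⟨a, ha, haz⟩ := Scroll.hasDim_distinct hkl hh hμ hν hs' hne
    exact ⟨a, ha, by grind [cases Scroll.Coincidence]⟩
  -- If the total contact order is at most `k`, then `G` has degree at least `l` and is not the
  -- directrix. Two directrices thus coincide with each other but not with `G`.
  · refine key _ False False True _ fun M p₁ p₂ p₃ hQ hc hs' => ⟨fun _ _ _ _ _ => by grind [cases Scroll.Coincidence], fun hne => ?_⟩
    obtain rfl : e = d := by grind [cases Scroll.Coincidence]
    obtain ⟨a, ha, haz⟩ := Scroll.hasDim_eq hkl hh hμ hs' hne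
    exact ⟨a, ha, by grind [cases Scroll.Coincidence]⟩
  · refine key _ True True True _ fun M p₁ p₂ p₃ hQ hc hs' => ⟨fun _ _ _ _ _ => by grind [cases Scroll.Coincidence], fun hne => ?_⟩
    obtain rfl : d = k + l - ∑ i, μ i := by grind [cases Scroll.Coincidence]
    obtain rfl : e = k + l - ∑ i, μ i := by grind [cases Scroll.Coincidence]
    obtain ⟨a, ha, haz⟩ := Scroll.hasDim_all_eq hkl hh hμ hs' hne
    exact ⟨a, ha, by grind [cases Scroll.Coincidence]⟩
  · refine key _ False True False _ fun M p₁ p₂ p₃ hQ hc hs' => ⟨fun _ _ _ _ _ => by grind [cases Scroll.Coincidence], fun hne => ?_⟩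
    obtain rfl : e = k + l - ∑ i, μ i := by grind [cases Scroll.Coincidence]
    obtain ⟨a, ha, haz⟩ := Scroll.hasDim_snd_eq hkl hh hμ hν hs' hne
    exact ⟨a, ha, by grind [cases Scroll.Coincidence]⟩
  · refine key _ True False False _ fun M p₁ p₂ p₃ hQ hc hs' => ⟨fun _ _ _ _ _ => by grind [cases Scroll.Coincidence], fun hne => ?_⟩
    obtain rfl : d = k + l - ∑ i, μ i := by grind [cases Scroll.Coincidence]
    obtain ⟨a, ha, haz⟩ := Scroll.hasDim_fst_eq hkl hh hμ hν hs' hne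
    exact ⟨a, ha, by grind [cases Scroll.Coincidence]⟩
  · refine key _ False False True _ fun M p₁ p₂ p₃ hQ hc hs' => ⟨fun _ _ _ _ _ => by grind [cases Scroll.Coincidence], fun hne => ?_⟩
    obtain rfl : e = d := by grind [cases Scroll.Coincidence]
    obtain ⟨a, ha, haz⟩ := Scroll.hasDim_eq hkl hh hμ hs' hne
    exact ⟨a, ha, by grind [cases Scroll.Coincidence]⟩
  -- For the directrix `D` one has `e = k`, and its equation contributes only one dimension to the
  -- count for distinct sections.
  · refine key _ False False False _ fun M p₁ p₂ p₃ hQ hc hs' => ⟨fun _ _ _ _ _ => by grind [cases Scroll.Coincidence], fun hne => ?_⟩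
    obtain ⟨a, ha, haz⟩ := Scroll.hasDim_distinct hkl hh hμ hν hs' hne
    exact ⟨a, ha, by grind [cases Scroll.Coincidence]⟩
  · refine key _ False True False _ fun M p₁ p₂ p₃ hQ hc hs' => ⟨fun _ _ _ _ _ => by grind [cases Scroll.Coincidence], fun hne => ?_⟩
    obtain rfl : e = k + l - ∑ i, μ i := by grind [cases Scroll.Coincidence]
    obtain ⟨a, ha, haz⟩ := Scroll.hasDim_snd_eq hkl hh hμ hν hs' hne
    exact ⟨a, ha, by grind [cases Scroll.Coincidence]⟩
  · refine key _ False False False _ fun M p₁ p₂ p₃ hQ hc hs' => ⟨fun _ _ _ _ _ => by grind [cases Scroll.Coincidence], fun hne => ?_⟩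
    obtain ⟨a, ha, haz⟩ := Scroll.hasDim_distinct hkl hh hμ hν hs' hne
    exact ⟨a, ha, by grind [cases Scroll.Coincidence]⟩
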